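/- Let $N$ be a lattice of rank $r\ge 2$, $N_{\mathbb R}=N\otimes\mathbb R$, and let $\Delta=(n_e)_{e\in E}$ be a finite family, $|E|\ge 3$, of non-zero vectors of $N$ with $\sum_e n_e=0$. Fix $e_0\in E$. A parametrized rational tropical curve of degree $\Delta$ is a finite metric tree $\Gamma$ with unbounded ends labelled by $E$ and all vertices of valency at least $3$, with a map $h:\Gamma\to N_{\mathbb R}$ that is affine with slope in $N$ on every edge, with slope $n_e$ on the end $e$, such that the outgoing slopes at each vertex sum to $0$. Curves are considered up to isometries that respect the labels and $h$. If all vertices are trivalent, put $\pi_V=a_V\wedge b_V\in\Lambda^2N$, defined up to sign, where $a_V,b_V$ are two of the outgoing slopes at the vertex $V$. Let $\mathcal V_\Delta$ be the set of types of trivalent vertices, i.e. of partitions of $E$ into three non-empty subsets $A,B,C$, with $\pi_V=(\sum_{A}n_e)\wedge(\sum_{B}n_e)$ up to sign. For a real two-form $\omega\in\Lambda^2M_{\mathbb R}$ (where $M=\mathrm{Hom}(N,\mathbb Z)$) let $K_\omega\subset\Lambda^2N$ be the sublattice generated by the $\pi_V$, $V\in\mathcal V_\Delta$, with $\omega(\pi_V)=0$.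 Call $\omega$ admissible if $\iota_{n_e}\omega\ne0$ for all $e$. Given an admissible $\omega$, $\delta\in N$ with $\omega(n_{e_0},\delta)\neq 0$, $\mu\in\mathfrak M=\{\mu\in\mathbb R^{E}:\sum_e\mu_e=0\}$ and a line $D\subset N_{\mathbb R}/\langle n_{e_0}\rangle$ with slope $\delta$, the solutions are the curves of degree $\Delta$ with $\omega(n_e,h(e))=\mu_e$ for all $e$ and $h(e_0)\in D$. The pair $(\mu,D)$ is generic if all solutions are trivalent, with a combinatorial type on which the linear map recording the moments $(\omega(n_e,h(e)))_e$ and the class of $h(e_0)$ in $N_{\mathbb R}/\langle n_{e_0},\delta\rangle$ is injective; such pairs are dense. For generic $(\mu,D)$ there are finitely many solutions, and $$\sum_{\Gamma\text{ solution}}\ \prod_{V}(q^{\pi_V}-q^{-\pi_V})\in\mathbb Z[\Lambda^2N/K_\omega]$$ (the sign of $\pi_V$ being such that $\omega(\pi_V)>0$; a factor with $\omega(\pi_V)=0$ is $0$) does not depend on the generic $(\mu,D)$ nor on $\delta$. It is denoted by $\mathcal B_\Delta^{\omega,e_0}$; for non-admissible $\omega$ one sets $\mathcal B_\Delta^{\omega,e_0}=0$.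 Let $\Omega_\Delta$ be the fan in $\Lambda^2M_{\mathbb R}$ cut out by the linear forms $\omega\mapsto\omega(\pi_V)$, $V\in\mathcal V_\Delta$. For a cone $\sigma$ of $\Omega_\Delta$ let $K_\sigma$ be the sublattice generated by the $\pi_V$ that vanish on $\sigma$. **Theorem.** For each cone $\sigma$ of $\Omega_\Delta$ and each $\omega$ in the relative interior of $\sigma$ one has $K_\omega=K_\sigma$, and $\omega\mapsto\mathcal B_\Delta^{\omega,e_0}$ is constant on the relative interior of $\sigma$, with a value $\mathcal B(\sigma)\in\mathbb Z[\Lambda^2N/K_\sigma]$. If $\tau$ is a face of $\sigma$, then $K_\sigma\subset K_\tau$ and $\mathcal B(\tau)$ is the image of $\mathcal B(\sigma)$ under the projection $\mathbb Z[\Lambda^2N/K_\sigma]\to\mathbb Z[\Lambda^2N/K_\tau]$. -/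

import Mathlib

open scoped BigOperators

noncomputable section

namespace RefinedTropical

/-! ### Abstract and parametrized rational tropical curves -/

/-- An abstract rational tropical curve whose unbounded ends are labelled by `E`: a finite tree of
vertices and bounded edges, a positive length on each bounded edge, for each label the vertex to
which the corresponding unbounded end is attached, and no vertex of valency less than three.
(`len` is only meaningful on the edges of the tree.) -/
structure AbstractCurve (E : Type*) where
  numVert : ℕ
  graph : SimpleGraph (Fin numVert)
  isTree : graph.IsTree
  len : Sym2 (Fin numVert) → ℝ
  len_pos : ∀ s ∈ graph.edgeSet, 0 < len s
  endVert : E → Fin numVert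
  valency : ∀ v, 3 ≤ Nat.card ({w // graph.Adj v w} ⊕ {e // endVert e = v})

/-- The edges adjacent to the vertex `v`: bounded edges (given by their other extremity) and
unbounded ends. -/
abbrev AbstractCurve.Star {E : Type*} (Γ : AbstractCurve E) (v : Fin Γ.numVert) : Type _ :=
  {w // Γ.graph.Adj v w} ⊕ {e // Γ.endVert e = v}

variable {V : Type*} [NormedAddCommGroup V] [NormedSpace ℝ V] {N : Submodule ℤ V} {E : Type*}

/-- The outgoing slopes at a vertex `v`, given the slopes `s v w` of the bounded edges (oriented
from `v` to `w`) and the slopes `n e` of the unbounded ends. -/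
def outSlope (n : E → N) (Γ : AbstractCurve E) (s : Fin Γ.numVert → Fin Γ.numVert → N)
    (v : Fin Γ.numVert) : Γ.Star v → N :=
  Sum.elim (fun w => s v w) (fun e => n e)

/-- A parametrized rational tropical curve of degree `n : E → N` in `V = N_ℝ`. The map `h` is
affine on edges, so it is given by the positions of the vertices; on the end labelled `e` it is
`t ↦ pos (endVert e) + t • n e`. `slope v w` is the slope of the edge `vw` oriented from `v` to `w`
(only meaningful, and then determined by `pos` and `len`, if `v` and `w` are adjacent). -/
structure Curve (n : E → N) extends AbstractCurve E where
  pos : Fin numVert → V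
  slope : Fin numVert → Fin numVert → N
  affine : ∀ v w, graph.Adj v w → pos w = pos v + len s(v, w) • (slope v w : V)
  balanced : ∀ v, ∑ᶠ f, outSlope n toAbstractCurve slope v f = 0

namespace Curve

variable {n : E → N}

/-- An isomorphism of parametrized curves: an isometry (an isomorphism of the underlying
graphs preserving the lengths) which respects the labels of the ends and the maps to `V`. -/
def Iso (Γ Γ' : Curve n) : Prop :=
  ∃ φ : Γ.graph ≃g Γ'.graph,
    (∀ e, φ (Γ.endVert e) = Γ'.endVert e) ∧
    (∀ v w, Γ.graph.Adj v w → Γ'.len s(φ v, φ w) = Γ.len s(v, w)) ∧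
    ∀ v, Γ'.pos (φ v) = Γ.pos v

/-- Two curves have the same combinatorial type if their underlying labelled graphs are
isomorphic. -/
def SameType (Γ Γ' : Curve n) : Prop :=
  ∃ φ : Γ.graph ≃g Γ'.graph, ∀ e, φ (Γ.endVert e) = Γ'.endVert e

/-- The equivalence relation on curves given by isomorphism. -/
instance isoSetoid (n : E → N) : Setoid (Curve n) where
  r := Iso
  iseqv :=
    { refl := fun _ => ⟨SimpleGraph.Iso.refl, fun _ => rfl, fun _ _ _ => rfl, fun _ => rfl⟩
      symm := by
        rintro Γ Γ' ⟨φ, h1, h2, h3⟩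
        refine ⟨φ.symm, fun e => ?_, fun v w hvw => ?_, fun v => ?_⟩
        · rw [← h1 e]; exact φ.symm_apply_apply _
        · have := h2 (φ.symm v) (φ.symm w) (φ.symm.map_adj_iff.mpr hvw)
          simpa using this.symm
        · simpa using (h3 (φ.symm v)).symm
      trans := by
        rintro Γ Γ' Γ'' ⟨φ, h1, h2, h3⟩ ⟨ψ, g1, g2, g3⟩
        refine ⟨φ.trans ψ, fun e => ?_, fun v w hvw => ?_, fun v => ?_⟩
        · exact (congrArg ψ (h1 e)).trans (g1 e)
        · exact (g2 _ _ (φ.map_adj_iff.mpr hvw)).trans (h2 v w hvw)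
        · exact (g3 _).trans (h3 v) }

/-- Every vertex is adjacent to exactly three edges. -/
def IsTrivalent (Γ : Curve n) : Prop := ∀ v, Nat.card (Γ.Star v) = 3

/-- At each vertex there are two different adjacent edges. -/
theorem exists_pair (Γ : Curve n) (v : Fin Γ.numVert) :
    ∃ p : Γ.Star v × Γ.Star v, p.1 ≠ p.2 := by
  have h := Γ.valency v
  have hf : Finite (Γ.Star v) := Nat.finite_of_card_ne_zero (by unfold AbstractCurve.Star; omega)
  have : Nontrivial (Γ.Star v) := Finite.one_lt_card_iff_nontrivial.mp
    (by unfold AbstractCurve.Star; omega)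
  obtain ⟨x, y, hxy⟩ := exists_pair_ne (Γ.Star v)
  exact ⟨(x, y), hxy⟩

end Curve

/-- The moduli space `𝓜₀(Δ, N_ℝ)` of parametrized rational tropical curves of degree `n`. -/
abbrev ModuliSpace (n : E → N) : Type _ := Quotient (Curve.isoSetoid n)

/-! ### Bivectors, two-forms, the fan -/

/-- The lattice `Λ² N`. -/
abbrev Bivector (N : Submodule ℤ V) : Type _ := ↥(⋀[ℤ]^2 N)

/-- The bivector `a ∧ b`. -/
def wedge (a b : N) : Bivector N := exteriorPower.ιMulti ℤ 2 ![a, b]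

/-- The space `Λ² M_ℝ` of real two-forms on `N_ℝ = V`. -/
abbrev Form (V : Type*) [NormedAddCommGroup V] [NormedSpace ℝ V] : Type _ := V [⋀^Fin 2]→L[ℝ] ℝ

/-- The restriction to `N` of a two-form. -/
def restrictForm (N : Submodule ℤ V) (ω : Form V) : N [⋀^Fin 2]→ₗ[ℤ] ℝ where
  toMultilinearMap :=
    (ω.toAlternatingMap.toMultilinearMap.restrictScalars ℤ).compLinearMap fun _ => N.subtype
  map_eq_zero_of_eq' v _ _ h hij :=
    ω.toAlternatingMap.map_eq_zero_of_eq (fun k => (v k : V)) (congrArg Subtype.val h) hij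

/-- The linear form `Λ² N → ℝ`, `a ∧ b ↦ ω(a, b)`, induced by a two-form `ω`. -/
def pairing (N : Submodule ℤ V) (ω : Form V) : Bivector N →ₗ[ℤ] ℝ :=
  exteriorPower.alternatingMapLinearEquiv (restrictForm N ω)

theorem pairing_wedge (ω : Form V) (a b : N) : pairing N ω (wedge a b) = ω ![(a : V), (b : V)] := by
  unfold pairing wedge
  rw [exteriorPower.alternatingMapLinearEquiv_apply_ιMulti]
  change ω (fun i => ((![a, b] i : N) : V)) = _
  congr 1
  funext i
  fin_cases i <;> rfl

/-- The bivectors `π_V`, for the types `V` of trivalent vertices of curves of degree `n`. A type of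
trivalent vertex is a partition of the ends into three non-empty subsets `A`, `B`, `C`, the
outgoing slopes being the sums of the `n e` over `A`, `B` and `C`; `π_V` is only defined up to sign,
and both signs are in this set, since the subsets may be permuted. -/
def vertexBivectors [Fintype E] (n : E → N) : Set (Bivector N) :=
  {π | ∃ A B C : Finset E, A.Nonempty ∧ B.Nonempty ∧ C.Nonempty ∧
    Disjoint A B ∧ Disjoint A C ∧ Disjoint B C ∧ (∀ e, e ∈ A ∨ e ∈ B ∨ e ∈ C) ∧
    π = wedge (∑ e ∈ A, n e) (∑ e ∈ B, n e)}

variable [Fintype E]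

/-- `K_ω`, the sublattice generated by the `π_V` with `ω(π_V) = 0`. -/
def kernelLattice (n : E → N) (ω : Form V) : Submodule ℤ (Bivector N) :=
  Submodule.span ℤ {π | π ∈ vertexBivectors n ∧ pairing N ω π = 0}

/-- `K_σ`, the sublattice generated by the `π_V` on which every form of `σ` vanishes. -/
def coneLattice (n : E → N) (σ : Set (Form V)) : Submodule ℤ (Bivector N) :=
  Submodule.span ℤ {π | π ∈ vertexBivectors n ∧ ∀ ω ∈ σ, pairing N ω π = 0}

theorem coneLattice_le_kernelLattice (n : E → N) {σ : Set (Form V)} {ω : Form V} (h : ω ∈ σ) :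
    coneLattice n σ ≤ kernelLattice n ω :=
  Submodule.span_mono fun _ hπ => ⟨hπ.1, hπ.2 ω h⟩

theorem coneLattice_anti (n : E → N) {τ σ : Set (Form V)} (h : τ ⊆ σ) :
    coneLattice n σ ≤ coneLattice n τ :=
  Submodule.span_mono fun _ hπ => ⟨hπ.1, fun ω hω => hπ.2 ω (h hω)⟩

/-- The closed cone cut out by prescribing, for every `π_V`, that `ω(π_V)` is zero, non-negative
or non-positive, according to the sign of `ω₀(π_V)`. -/
def coneOf (n : E → N) (ω₀ : Form V) : Set (Form V) :=
  {ω | ∀ π ∈ vertexBivectors n,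
    (pairing N ω₀ π = 0 → pairing N ω π = 0) ∧
    (0 < pairing N ω₀ π → 0 ≤ pairing N ω π) ∧
    (pairing N ω₀ π < 0 → pairing N ω π ≤ 0)}

/-- The fan `Ω_Δ` in `Λ² M_ℝ` induced by the linear forms `ω ↦ ω(π_V)`, as the set of its (closed)
cones. -/
def fan (n : E → N) : Set (Set (Form V)) := Set.range (coneOf n)

/-- The ring `ℤ[Λ² N / K]` of Laurent polynomials with exponents modulo `K`. -/
abbrev LaurentMod (K : Submodule ℤ (Bivector N)) : Type _ := AddMonoidAlgebra ℤ (Bivector N ⧸ K)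

/-- The monomial `q ^ π`, the exponent being taken modulo `K`. -/
def qpow (K : Submodule ℤ (Bivector N)) (π : Bivector N) : LaurentMod K :=
  AddMonoidAlgebra.single (K.mkQ π) 1

/-- The projection `ℤ[Λ² N / K] → ℤ[Λ² N / K']` for `K ⊆ K'`. -/
def proj {K K' : Submodule ℤ (Bivector N)} (h : K ≤ K') : LaurentMod K →+* LaurentMod K' :=
  AddMonoidAlgebra.mapDomainRingHom ℤ (Submodule.factor h).toAddMonoidHom

theorem proj_qpow {K K' : Submodule ℤ (Bivector N)} (h : K ≤ K') (π : Bivector N) :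
    proj h (qpow K π) = qpow K' π := by
  simp [proj, qpow]

/-! ### Multiplicities and the count -/

namespace Curve

variable {n : E → N}

/-- The bivector `π_v` of a vertex: the wedge product of two of the outgoing slopes. At a trivalent
vertex it does not depend, up to sign, on the two chosen edges, by the balancing condition. -/
def bivector (Γ : Curve n) (v : Fin Γ.numVert) : Bivector N :=
  let p := (Γ.exists_pair v).choose
  wedge (outSlope n Γ.toAbstractCurve Γ.slope v p.1) (outSlope n Γ.toAbstractCurve Γ.slope v p.2)

open Classical in
/-- The refined multiplicity `∏_v (q ^ π_v - q ^ (-π_v))` in `ℤ[Λ² N / K_ω]` of a trivalent curve,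
where the sign of `π_v` is such that `ω(π_v) > 0`. If `ω(π_v) = 0`, then `π_v ∈ K_ω` and
the factor is zero for both signs. -/
def refinedMult (ω : Form V) (Γ : Curve n) : LaurentMod (kernelLattice n ω) :=
  ∏ v, if 0 < pairing N ω (Γ.bivector v) then
      qpow _ (Γ.bivector v) - qpow _ (-Γ.bivector v)
    else
      qpow _ (-Γ.bivector v) - qpow _ (Γ.bivector v)

/-- The moment `ω(n_e, p)` of the unbounded end `e`, where `p` is any point of its image. -/
def moment (ω : Form V) (Γ : Curve n) (e : E) : ℝ := ω ![(n e : V), Γ.pos (Γ.endVert e)]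

/-- The two curves have the same image under the composed evaluation map `ev^{ω,e₀}`: the moments
of their ends are equal, and the images of the end `e₀` in `N_ℝ / ⟨n_{e₀}⟩` differ by a multiple
of `δ`. -/
def SameEval (ω : Form V) (e₀ : E) (δ : N) (Γ Γ' : Curve n) : Prop :=
  (∀ e, Γ.moment ω e = Γ'.moment ω e) ∧
    Γ.pos (Γ.endVert e₀) - Γ'.pos (Γ'.endVert e₀) ∈ Submodule.span ℝ {(n e₀ : V), (δ : V)}

/-- The combinatorial type of the curve is top-dimensional and the composed evaluation map is
injective on the corresponding cone. -/
def IsRegular (ω : Form V) (e₀ : E) (δ : N) (Γ : Curve n) : Prop :=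
  Γ.IsTrivalent ∧ ∀ Γ₁ Γ₂ : Curve n, SameType Γ Γ₁ → SameType Γ Γ₂ →
    SameEval ω e₀ δ Γ₁ Γ₂ → Iso Γ₁ Γ₂

end Curve

/-- The space `𝔐` of families of moments of total sum zero. -/
abbrev MomentSpace (E : Type*) [Fintype E] : Type _ := {μ : E → ℝ // ∑ e, μ e = 0}

/-- `Γ` satisfies the constraints: `mom(Γ) = μ`, and the image of the end `e₀` in `N_ℝ / ⟨n_{e₀}⟩`
lies on the line `D` of slope `δ` through the image of `p`. -/
def Solves {n : E → N} (ω : Form V) (e₀ : E) (δ : N) (μ : MomentSpace E) (p : V)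
    (Γ : Curve n) : Prop :=
  (∀ e, Γ.moment ω e = μ.1 e) ∧
    Γ.pos (Γ.endVert e₀) - p ∈ Submodule.span ℝ {(n e₀ : V), (δ : V)}

/-- The set of solutions (up to isomorphism) of the `ω`-problem. -/
def solutions (n : E → N) (ω : Form V) (e₀ : E) (δ : N) (μ : MomentSpace E) (p : V) :
    Set (ModuliSpace n) :=
  {c | ∃ Γ : Curve n, Solves ω e₀ δ μ p Γ ∧ (Quotient.mk _ Γ : ModuliSpace n) = c}

/-- The constraints `(μ, D)` are generic: they are neither in the image of a cone of the moduli
space that is not top-dimensional, nor in the image of a top-dimensional cone on which the composed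
evaluation map is not injective. -/
def IsGeneric (n : E → N) (ω : Form V) (e₀ : E) (δ : N) (μ : MomentSpace E) (p : V) : Prop :=
  ∀ Γ : Curve n, Solves ω e₀ δ μ p Γ → Γ.IsRegular ω e₀ δ

/-- The refined count `𝓑_Δ(μ, D)` of the solutions of the `ω`-problem. -/
def refinedCount (n : E → N) (ω : Form V) (e₀ : E) (δ : N) (μ : MomentSpace E) (p : V) :
    LaurentMod (kernelLattice n ω) :=
  ∑ᶠ c ∈ solutions n ω e₀ δ μ p, Curve.refinedMult ω c.out

/-- The two-forms for which the `ω`-problem is considered: `ι_{n_e} ω ≠ 0` for each end `e`. -/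
def IsAdmissible (n : E → N) (ω : Form V) : Prop := ∀ e, ∃ x : V, ω ![(n e : V), x] ≠ 0

/-- `b` is the value of the refined count for all generic constraints, whatever the slope `δ`. -/
def IsRefinedInvariant (n : E → N) (ω : Form V) (e₀ : E) (b : LaurentMod (kernelLattice n ω)) :
    Prop :=
  ∀ δ : N, ω ![(n e₀ : V), (δ : V)] ≠ 0 → ∀ (μ : MomentSpace E) (p : V),
    IsGeneric n ω e₀ δ μ p → refinedCount n ω e₀ δ μ p = b

open Classical in
/-- The refined invariant `𝓑_Δ^{ω,e₀}`, the common value of the refined counts for generic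
constraints, extended by zero to the two-forms which are not admissible. -/
def refinedInvariant (n : E → N) (ω : Form V) (e₀ : E) : LaurentMod (kernelLattice n ω) :=
  if h : IsAdmissible n ω ∧ ∃ b, IsRefinedInvariant n ω e₀ b then h.2.choose else 0

end RefinedTropical

end

/-!
Rooting all curves at the end `e₀` turns the problem into a count of rooted binary trees. Moving
along a bounded edge whose far side carries the ends in `A`, by a length `t`, changes the moment of
an end `e` in `A` by `t * ∑ a ∈ A, ω(n_e, n_a)`, so that a solution is a family of clades (the sets
of ends beyond the vertices) together with lengths which solve a linear system involving only the
antisymmetric matrix `W` with entries `ω(n_a, n_b)` and the prescribed moments `f`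
(`Solves.exists_realizes`, `IsHierarchy.exists_solves`). An edge leading to `A` can split into edges
leading to `B` and `A \ B` exactly where the total moment of `B` vanishes; hence the count of
solutions obeys a recursion (`treeSum`, `rootedTreeSum`), in which the weights `q ^ (n_B ∧ n_C)` are
a bicharacter in `B`, `C` (`IsGeneric.proj_refinedCount`).

The proof that this count does not depend on the moments is algebraic. In the algebra of functions
on finite sets with the twisted convolution product, a function `Φ` factors uniquely as a product
of a part supported on the sets of negative total moment and a part supported on the other sets.
When the moments cross the hyperplane where the total moment of `B` is zero, the coefficient of the
factorization at `A` jumps by the weight of a splitting of `A` into `B` and `A \ B`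
(`factorCoeff_jump`). Following the flow `t ↦ f - t W 1_A` from `-∞` to `∞`, where the signs only
depend on `W`, one identifies the count with a coefficient which depends on `W` alone
(`exists_rootedTreeSum_eq`); here `Φ` is chosen so that the coefficients at one extremity of the
flow vanish.

This applies to matrices `W` with no accidental zeros, which need not come from a two-form. The
count is locally constant in `(W, f)` near `(W₀, f₀)` if no tree for `(W₀, f₀)` has an edge of
length zero, provided that `q` is trivial on the splittings with `W₀(B, C) = 0`; the latter is
why exponents are taken modulo `K_ω` (`eventually_forall_rootedTreeSum_eq`). Thus the refined count
of `ω`, modulo any lattice containing `K_ω`, is the common count for all generic `W` near the matrix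
of `ω`; this includes the forms which are not admissible, where all weights vanish
(`isNearbyCount_refinedInvariant`). It follows that the invariant does not depend on the
constraints, and that, modulo `K_ω'`, it is constant on a segment from `ω'` to `ω` if `ω'` is in the
cone of `ω` (`proj_refinedInvariant_of_mem_coneOf`), which yields all the statements about the fan.

Generic constraints are dense since the moments of the curves of a given type span at most the
space of all moments, with equality only for trivalent types on which the evaluation is injective
(`Curve.isRegular_of_momentSubmodule_le`, `dense_isGeneric`).
-/

noncomputable section

namespace RefinedTropical

/-! ### Factorization in a twisted convolution algebra -/

open scoped Classical in
/-- Coefficients of the factorization `Φ = X ⋆ Y` in the twisted convolution algebra of functions on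
finite sets, `(X ⋆ Y)(S) = ∑_{U ⊆ S} q(U, S \ U) X(U) Y(S \ U)`, where `X - 1` is supported on the
non-empty sets that satisfy `neg` and `Y - 1` on the other non-empty sets. As the two supports are
disjoint, the coefficients of `X` and `Y` are recorded in one function. -/
def factorCoeff {I R : Type*} [DecidableEq I] [CommRing R] (q : Finset I → Finset I → R)
    (Φ : Finset I → R) (neg : Finset I → Prop) (A : Finset I) : R :=
  Φ A - ∑ B ∈ A.powerset.attach, if _h : (B.1 ≠ ∅ ∧ B.1 ≠ A) ∧ neg B.1 ∧ ¬ neg (A \ B.1) then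
    q B.1 (A \ B.1) * factorCoeff q Φ neg B.1 * factorCoeff q Φ neg (A \ B.1) else 0
termination_by A.card
decreasing_by
  · exact Finset.card_lt_card ((Finset.mem_powerset.1 B.2).ssubset_of_ne _h.1.2)
  · refine Finset.card_lt_card (Finset.sdiff_ssubset (Finset.mem_powerset.1 B.2)
      (Finset.nonempty_iff_ne_empty.2 _h.1.1))

/-- A function of two finite sets which is multiplicative for disjoint unions in each argument. -/
structure IsBichar {I R : Type*} [DecidableEq I] [CommRing R] (q : Finset I → Finset I → R) :
    Prop where
  empty_left : ∀ C, q ∅ C = 1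
  empty_right : ∀ C, q C ∅ = 1
  union_left : ∀ A B C, Disjoint A B → q (A ∪ B) C = q A C * q B C
  union_right : ∀ A B C, Disjoint B C → q A (B ∪ C) = q A B * q A C

section factor

variable {I R : Type*} [DecidableEq I] [CommRing R] {q : Finset I → Finset I → R}
  {Φ Φ' : Finset I → R} {neg neg' : Finset I → Prop}

open scoped Classical in
theorem factorCoeff_eq (A : Finset I) : factorCoeff q Φ neg A =
    Φ A - ∑ B ∈ A.powerset, if (B ≠ ∅ ∧ B ≠ A) ∧ neg B ∧ ¬ neg (A \ B) then
      q B (A \ B) * factorCoeff q Φ neg B * factorCoeff q Φ neg (A \ B) else 0 := by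
  rw [factorCoeff]
  congr 1
  rw [← Finset.sum_attach A.powerset]
  refine Finset.sum_congr rfl fun B _ => ?_
  split_ifs <;> rfl

theorem factorCoeff_congr {A : Finset I} (hΦ : ∀ B ⊆ A, Φ B = Φ' B)
    (hneg : ∀ B ⊆ A, (neg B ↔ neg' B)) :
    factorCoeff q Φ neg A = factorCoeff q Φ' neg' A := by
  induction A using Finset.strongInduction with
  | H A ih =>
    rw [factorCoeff_eq, factorCoeff_eq, hΦ A subset_rfl]
    congr 1
    refine Finset.sum_congr rfl fun B hB => ?_
    have hBA := Finset.mem_powerset.1 hB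
    have hC : A \ B ⊆ A := Finset.sdiff_subset
    rw [hneg B hBA, hneg _ hC]
    split_ifs with h
    · have h1 : B ⊂ A := hBA.ssubset_of_ne h.1.2
      have h2 : A \ B ⊂ A := Finset.sdiff_ssubset hBA (Finset.nonempty_iff_ne_empty.2 h.1.1)
      rw [ih B h1 (fun S hS => hΦ S (hS.trans hBA)) fun S hS => hneg S (hS.trans hBA),
        ih _ h2 (fun S hS => hΦ S (hS.trans hC)) fun S hS => hneg S (hS.trans hC)]
    · rfl

theorem factorCoeff_singleton (e : I) : factorCoeff q Φ neg {e} = Φ {e} := by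
  rw [factorCoeff_eq, sub_eq_self]
  refine Finset.sum_eq_zero fun B hB => if_neg fun h => ?_
  rcases Finset.subset_singleton_iff.1 (Finset.mem_powerset.1 hB) with h' | h'
  · exact h.1.1 h'
  · exact h.1.2 h'

open scoped Classical in
/-- The factorization `Φ = X ⋆ Y`. -/
theorem sum_factorCoeff (hq : IsBichar q) {S : Finset I} (hS : S ≠ ∅) :
    ∑ U ∈ S.powerset, q U (S \ U) *
      (if U = ∅ then 1 else if neg U then factorCoeff q Φ neg U else 0) *
      (if S \ U = ∅ then 1 else if neg (S \ U) then 0 else factorCoeff q Φ neg (S \ U)) = Φ S := by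
  have h0 : (∅ : Finset I) ∈ S.powerset := Finset.empty_mem_powerset S
  have h1 : S ∈ S.powerset.erase ∅ := by simp [hS]
  rw [← Finset.add_sum_erase _ _ h0, ← Finset.add_sum_erase _ _ h1]
  have h2 := factorCoeff_eq (q := q) (Φ := Φ) (neg := neg) S
  rw [← Finset.add_sum_erase _ _ h0, ← Finset.add_sum_erase _ _ h1] at h2
  have h3 : ∀ U ∈ (S.powerset.erase ∅).erase S, q U (S \ U) *
      (if U = ∅ then 1 else if neg U then factorCoeff q Φ neg U else 0) *
      (if S \ U = ∅ then 1 else if neg (S \ U) then 0 else factorCoeff q Φ neg (S \ U)) =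
      if (U ≠ ∅ ∧ U ≠ S) ∧ neg U ∧ ¬ neg (S \ U) then
      q U (S \ U) * factorCoeff q Φ neg U * factorCoeff q Φ neg (S \ U) else 0 := by
    intro U hU
    simp only [Finset.mem_erase, Finset.mem_powerset] at hU
    have hne : S \ U ≠ ∅ := by
      rw [Ne, Finset.sdiff_eq_empty_iff_subset]
      exact fun h => hU.1 (hU.2.2.antisymm h)
    simp only [hU.2.1, hne, hU.1, if_false, ne_eq, not_false_eq_true, true_and]
    by_cases a : neg U <;> by_cases b : neg (S \ U) <;> simp [a, b]
  rw [Finset.sum_congr rfl h3]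
  simp only [ne_eq, not_true_eq_false, false_and, and_false, if_false, zero_add] at h2
  simp only [Finset.sdiff_self, hq.empty_left, hq.empty_right, Finset.sdiff_empty, hS, if_true,
    if_false, one_mul, mul_one]
  rw [h2]
  by_cases a : neg S <;> simp [a]

/-- Uniqueness of the factorization `Φ = X ⋆ Y`. -/
theorem factorCoeff_unique (hq : IsBichar q) {X Y : Finset I → R} {A : Finset I}
    (hX0 : X ∅ = 1) (hY0 : Y ∅ = 1)
    (hX : ∀ S ⊆ A, S ≠ ∅ → ¬ neg S → X S = 0) (hY : ∀ S ⊆ A, S ≠ ∅ → neg S → Y S = 0)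
    (h : ∀ S ⊆ A, S ≠ ∅ → ∑ U ∈ S.powerset, q U (S \ U) * X U * Y (S \ U) = Φ S)
    {S : Finset I} (hSA : S ⊆ A) (hS : S ≠ ∅) : factorCoeff q Φ neg S = X S + Y S := by
  classical
  induction S using Finset.strongInduction with
  | H S ih =>
    have h0 : (∅ : Finset I) ∈ S.powerset := Finset.empty_mem_powerset S
    have h1 : S ∈ S.powerset.erase ∅ := by simp [hS]
    have h2 := h S hSA hS
    rw [← Finset.add_sum_erase _ _ h0, ← Finset.add_sum_erase _ _ h1] at h2
    rw [factorCoeff_eq, ← Finset.add_sum_erase _ _ h0, ← Finset.add_sum_erase _ _ h1, ← h2]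
    have h3 : ∀ U ∈ (S.powerset.erase ∅).erase S, q U (S \ U) * X U * Y (S \ U) =
        if (U ≠ ∅ ∧ U ≠ S) ∧ neg U ∧ ¬ neg (S \ U) then
        q U (S \ U) * factorCoeff q Φ neg U * factorCoeff q Φ neg (S \ U) else 0 := by
      intro U hU
      simp only [Finset.mem_erase, Finset.mem_powerset] at hU
      have hne : S \ U ≠ ∅ := by
        rw [Ne, Finset.sdiff_eq_empty_iff_subset]
        exact fun h => hU.1 (hU.2.2.antisymm h)
      have hss : S \ U ⊂ S := Finset.sdiff_ssubset hU.2.2 (Finset.nonempty_iff_ne_empty.2 hU.2.1)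
      rw [ih U (hU.2.2.ssubset_of_ne hU.1) (hU.2.2.trans hSA) hU.2.1,
        ih _ hss (hss.1.trans hSA) hne]
      by_cases a : neg U
      · by_cases b : neg (S \ U)
        · simp [b, hY _ (hss.1.trans hSA) hne b]
        · simp [a, b, hU.1, hU.2.1, hY _ (hU.2.2.trans hSA) hU.2.1 a,
            hX _ (hss.1.trans hSA) hne b]
      · simp [a, hX _ (hU.2.2.trans hSA) hU.2.1 a]
    rw [Finset.sum_congr rfl h3]
    simp only [Finset.sdiff_self, hq.empty_left, hq.empty_right, Finset.sdiff_empty, hX0, hY0,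
      one_mul, mul_one, ne_eq, not_true_eq_false, false_and, and_false, if_false, zero_add]
    ring

open scoped Classical in
/-- Multiplying by `1 + z x_B` on the right of `X` and by `1 - z x_B` on the left of `Y` does not
change the twisted convolution product `X ⋆ Y`. -/
theorem sum_convolution_twist (hq : IsBichar q) {B S : Finset I} (hB : B ≠ ∅) (z : R)
    (X Y : Finset I → R) :
    ∑ U ∈ S.powerset, q U (S \ U) * (X U + if B ⊆ U then q (U \ B) B * X (U \ B) * z else 0) *
      (Y (S \ U) - if B ⊆ S \ U then q B ((S \ U) \ B) * z * Y ((S \ U) \ B) else 0) =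
    ∑ U ∈ S.powerset, q U (S \ U) * X U * Y (S \ U) := by
  have key : ∀ U ∈ S.powerset,
      q U (S \ U) * (X U + if B ⊆ U then q (U \ B) B * X (U \ B) * z else 0) *
      (Y (S \ U) - if B ⊆ S \ U then q B ((S \ U) \ B) * z * Y ((S \ U) \ B) else 0) =
      q U (S \ U) * X U * Y (S \ U) +
      (if B ⊆ U then q U (S \ U) * (q (U \ B) B * X (U \ B) * z) * Y (S \ U) else 0) -
      (if B ⊆ S \ U then q U (S \ U) * X U * (q B ((S \ U) \ B) * z * Y ((S \ U) \ B)) else 0) := by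
    intro U _
    by_cases a : B ⊆ U
    · have b : ¬ B ⊆ S \ U := fun b => hB (by
        rw [← Finset.subset_empty]
        intro x hx
        exact absurd (a hx) (Finset.mem_sdiff.1 (b hx)).2)
      simp only [a, b, if_true, if_false]; ring
    · by_cases b : B ⊆ S \ U <;> simp only [a, b, if_true, if_false] <;> ring
  rw [Finset.sum_congr rfl key, Finset.sum_sub_distrib, Finset.sum_add_distrib, add_sub_assoc,
    add_eq_left, sub_eq_zero, ← Finset.sum_filter, ← Finset.sum_filter]
  refine Finset.sum_nbij' (fun U => U \ B) (fun U => U ∪ B) ?_ ?_ ?_ ?_ ?_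
  · intro U hU
    simp only [Finset.mem_filter, Finset.mem_powerset] at hU ⊢
    refine ⟨Finset.sdiff_subset.trans hU.1, fun x hx => ?_⟩
    simp [hU.1 (hU.2 hx), hx]
  · intro U hU
    simp only [Finset.mem_filter, Finset.mem_powerset] at hU ⊢
    exact ⟨Finset.union_subset hU.1 (hU.2.trans Finset.sdiff_subset), Finset.subset_union_right⟩
  · intro U hU
    simp only [Finset.mem_filter, Finset.mem_powerset] at hU
    exact Finset.sdiff_union_of_subset hU.2
  · intro U hU
    simp only [Finset.mem_filter, Finset.mem_powerset] at hU
    rw [Finset.union_sdiff_right, Finset.sdiff_eq_self_iff_disjoint]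
    exact (Finset.disjoint_left.2 fun x hx => (Finset.mem_sdiff.1 (hU.2 hx)).2).symm
  · intro U hU
    simp only [Finset.mem_filter, Finset.mem_powerset] at hU
    have e1 : S \ (U \ B) = B ∪ S \ U := by
      ext x
      have := @hU.1 x
      have := @hU.2 x
      simp only [Finset.mem_sdiff, Finset.mem_union]
      tauto
    have d1 : Disjoint B (S \ U) :=
      Finset.disjoint_left.2 fun x hx h => (Finset.mem_sdiff.1 h).2 (hU.2 hx)
    have e2 : (S \ (U \ B)) \ B = S \ U := by
      rw [e1, Finset.union_sdiff_left, Finset.sdiff_eq_self_iff_disjoint]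
      exact d1.symm
    rw [e2, e1, hq.union_right _ _ _ d1]
    nth_rewrite 1 [← Finset.sdiff_union_of_subset hU.2]
    rw [hq.union_left _ _ _ Finset.sdiff_disjoint]
    ring

/-- Wall-crossing: if `B` and its complement in `A` lie on the wall for `neg`, and `neg'` differs
from `neg` only by the fact that `B` becomes negative, then the coefficient of `A` changes by the
product of those of the two parts. -/
theorem factorCoeff_jump (hq : IsBichar q) {A B : Finset I} (hBA : B ⊆ A) (hB : B ≠ ∅)
    (hC : A \ B ≠ ∅) (hnB : ¬ neg B) (hnC : ¬ neg (A \ B)) (hnA : ¬ neg A) (hnB' : neg' B)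
    (heq : ∀ S ⊆ A, S ≠ B → (neg S ↔ neg' S))
    (htrans : ∀ S ⊆ A, B ⊆ S → S ≠ B → (neg S ↔ neg (S \ B))) :
    factorCoeff q Φ neg' A = factorCoeff q Φ neg A -
      q B (A \ B) * factorCoeff q Φ neg B * factorCoeff q Φ neg (A \ B) := by
  classical
  set X : Finset I → R := fun U =>
    if U = ∅ then 1 else if neg U then factorCoeff q Φ neg U else 0 with hXdef
  set Y : Finset I → R := fun U =>
    if U = ∅ then 1 else if neg U then 0 else factorCoeff q Φ neg U with hYdef
  -- the factorization for `neg'` is obtained by moving the factor `1 + z x_B` from `Y` to `X`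
  set z := factorCoeff q Φ neg B with hz
  set X' : Finset I → R := fun U => X U + if B ⊆ U then q (U \ B) B * X (U \ B) * z else 0
  set Y' : Finset I → R := fun U => Y U - if B ⊆ U then q B (U \ B) * z * Y (U \ B) else 0
  have hBe : ¬ B ⊆ ∅ := fun h => hB (Finset.subset_empty.1 h)
  have hAne : A ≠ ∅ := fun h => hB (Finset.subset_empty.1 (h ▸ hBA))
  have hAB : A ≠ B := fun h => hC (by simp [h])
  have hX : ∀ S ⊆ A, S ≠ ∅ → ¬ neg' S → X' S = 0 := by
    intro S hS hS0 hn
    have hSB : S ≠ B := fun h => hn (h ▸ hnB')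
    have hn' : ¬ neg S := fun h => hn ((heq S hS hSB).1 h)
    by_cases hBS : B ⊆ S
    · have h1 : ¬ S ⊆ B := fun h => hSB (h.antisymm hBS)
      have h2 : ¬ neg (S \ B) := fun h => hn' ((htrans S hS hBS hSB).2 h)
      simp [X', hXdef, hS0, hn', h1, h2]
    · simp [X', hXdef, hS0, hn', hBS]
  have hY : ∀ S ⊆ A, S ≠ ∅ → neg' S → Y' S = 0 := by
    intro S hS hS0 hn
    by_cases hSB : S = B
    · subst hSB
      simp [Y', hYdef, hS0, hnB, hq.empty_right, hz]
    have hn' : neg S := (heq S hS hSB).2 hn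
    by_cases hBS : B ⊆ S
    · have h1 : ¬ S ⊆ B := fun h => hSB (h.antisymm hBS)
      have h2 : neg (S \ B) := (htrans S hS hBS hSB).1 hn'
      simp [Y', hYdef, hS0, hn', h1, h2]
    · simp [Y', hYdef, hS0, hn', hBS]
  have := factorCoeff_unique (neg := neg') (Φ := Φ) hq (X := X') (Y := Y') (A := A)
    (by simp [X', hXdef, hBe]) (by simp [Y', hYdef, hBe]) hX hY
    (fun S _ hS => (sum_convolution_twist hq hB z X Y).trans (sum_factorCoeff hq hS))
    subset_rfl hAne
  rw [this, hX A subset_rfl hAne fun h => hnA ((heq A subset_rfl hAB).2 h), zero_add]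
  have hC' : ¬ A ⊆ B := fun h => hC (Finset.sdiff_eq_empty_iff_subset.2 h)
  simp [Y', hYdef, hAne, hnA, hBA, hC', hnC]

/-- One can choose `Φ` such that, for a given family of sign functions `neg A`, the coefficient
of each `A` with at least two elements with respect to `neg A` vanishes. -/
theorem exists_factorCoeff_eq_zero [Fintype I] (q : Finset I → Finset I → R)
    (neg : Finset I → Finset I → Prop) :
    ∃ Φ : Finset I → R, (∀ e, Φ {e} = 1) ∧
      ∀ A : Finset I, 2 ≤ A.card → factorCoeff q Φ (neg A) A = 0 := by
  -- `factorCoeff q Φ neg A` is `Φ A` plus terms which only depend on smaller sets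
  have h : ∀ k : ℕ, ∃ Φ : Finset I → R, (∀ e, Φ {e} = 1) ∧
      ∀ A : Finset I, 2 ≤ A.card → A.card ≤ k → factorCoeff q Φ (neg A) A = 0 := by
    intro k
    induction k with
    | zero => exact ⟨fun _ => 1, fun _ => rfl, fun A h1 h2 => by omega⟩
    | succ k ih =>
      obtain ⟨Φ, h1, h2⟩ := ih
      refine ⟨fun A => if 2 ≤ A.card ∧ A.card = k + 1 then Φ A - factorCoeff q Φ (neg A) A else Φ A,
        fun e => by simp [h1], fun A hA hAk => ?_⟩
      rcases Nat.lt_or_ge k A.card with hlt | hge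
      · have hA' : A.card = k + 1 := by omega
        rw [factorCoeff_eq, if_pos ⟨hA, hA'⟩]
        nth_rewrite 1 [factorCoeff_eq]
        rw [sub_sub_cancel, sub_eq_zero]
        refine Finset.sum_congr rfl fun B hB => ?_
        split_ifs with h
        · have hBA := Finset.mem_powerset.1 hB
          have l1 := Finset.card_lt_card (hBA.ssubset_of_ne h.1.2)
          have l2 := Finset.card_lt_card
            (Finset.sdiff_ssubset hBA (Finset.nonempty_iff_ne_empty.2 h.1.1))
          congr 1
          · congr 1
            refine factorCoeff_congr (fun S hS => ?_) fun _ _ => Iff.rfl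
            have := Finset.card_le_card hS
            rw [if_neg (by omega)]
          · refine factorCoeff_congr (fun S hS => ?_) fun _ _ => Iff.rfl
            have := Finset.card_le_card hS
            rw [if_neg (by omega)]
        · rfl
      · rw [← h2 A hA hge]
        refine factorCoeff_congr (fun S hS => ?_) fun _ _ => Iff.rfl
        have := Finset.card_le_card hS
        rw [if_neg (by omega)]
  obtain ⟨Φ, h1, h2⟩ := h (Fintype.card I)
  exact ⟨Φ, h1, fun A hA => h2 A hA (Finset.card_le_univ A)⟩

end factor

/-! ### Weighted counts of trees -/

section flow

variable {I R : Type*} [DecidableEq I] [CommRing R]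

/-- The sum of the entries of the matrix `W` in the rows `B` and the columns `C`. -/
def blockSum (W : I → I → ℝ) (B C : Finset I) : ℝ := ∑ b ∈ B, ∑ c ∈ C, W b c

/-- The moments `f` after a displacement of length `t` in the direction of the sum of the slopes
of the ends in `A`. -/
def flow (W : I → I → ℝ) (A : Finset I) (t : ℝ) (f : I → ℝ) : I → ℝ :=
  fun e => f e - t * ∑ a ∈ A, W e a

/-- The moments at the point where the edge leading to the ends in `A` can split into edges
leading to `B` and to `A \ B`: the total moment of `B` is zero there. It is only meaningful if
`blockSum W B (A \ B) ≠ 0`. -/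
def splitFlow (W : I → I → ℝ) (A B : Finset I) (f : I → ℝ) : I → ℝ :=
  flow W A ((∑ e ∈ B, f e) / blockSum W B (A \ B)) f

open scoped Classical in
/-- The weighted count of binary trees with set of leaves `A`, starting from the moments `f`; a
splitting of `A` into `B` and `C` with `W(B, C) > 0` has weight `q(B, C) - q(C, B)`. -/
def treeSum (W : I → I → ℝ) (q : Finset I → Finset I → R) (A : Finset I) (f : I → ℝ) : R :=
  if A.card ≤ 1 then 1 else
  ∑ B ∈ A.powerset.attach, if _h : 0 < blockSum W B.1 (A \ B.1) ∧ 0 < ∑ e ∈ B.1, f e then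
    (q B.1 (A \ B.1) - q (A \ B.1) B.1) * treeSum W q B.1 (splitFlow W A B.1 f) *
      treeSum W q (A \ B.1) (splitFlow W A B.1 f) else 0
termination_by A.card
decreasing_by
  · refine Finset.card_lt_card ((Finset.mem_powerset.1 B.2).ssubset_of_ne fun h => ?_)
    have := _h.1
    simp [h, blockSum] at this
  · refine Finset.card_lt_card (Finset.sdiff_ssubset (Finset.mem_powerset.1 B.2)
      (Finset.nonempty_iff_ne_empty.2 fun h => ?_))
    have := _h.1
    simp [h, blockSum] at this

open scoped Classical in
/-- The same count when the length of the first edge may be any real number. -/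
def rootedTreeSum (W : I → I → ℝ) (q : Finset I → Finset I → R) (A : Finset I) (f : I → ℝ) : R :=
  ∑ B ∈ A.powerset, if 0 < blockSum W B (A \ B) then
    (q B (A \ B) - q (A \ B) B) * treeSum W q B (splitFlow W A B f) *
      treeSum W q (A \ B) (splitFlow W A B f) else 0

variable {W : I → I → ℝ} {q : Finset I → Finset I → R} {A B C : Finset I} {f : I → ℝ}

theorem nonempty_of_blockSum_ne_zero (h : blockSum W B C ≠ 0) : B ≠ ∅ ∧ C ≠ ∅ := by
  constructor <;> rintro rfl <;> simp [blockSum] at h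

theorem ne_of_blockSum_sdiff_ne_zero (h : blockSum W B (A \ B) ≠ 0) : B ≠ ∅ ∧ B ≠ A := by
  refine ⟨(nonempty_of_blockSum_ne_zero h).1, ?_⟩
  rintro rfl
  simp [blockSum] at h

theorem ssubset_of_blockSum_ne_zero (hB : B ⊆ A) (h : blockSum W B (A \ B) ≠ 0) :
    B ⊂ A ∧ A \ B ⊂ A := by
  have := ne_of_blockSum_sdiff_ne_zero h
  exact ⟨hB.ssubset_of_ne this.2, Finset.sdiff_ssubset hB (Finset.nonempty_iff_ne_empty.2 this.1)⟩

open scoped Classical in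
theorem treeSum_eq (hA : 2 ≤ A.card) : treeSum W q A f =
    ∑ B ∈ A.powerset, if 0 < blockSum W B (A \ B) ∧ 0 < ∑ e ∈ B, f e then
      (q B (A \ B) - q (A \ B) B) * treeSum W q B (splitFlow W A B f) *
      treeSum W q (A \ B) (splitFlow W A B f) else 0 := by
  rw [treeSum, if_neg (by omega), ← Finset.sum_attach A.powerset]
  refine Finset.sum_congr rfl fun B _ => ?_
  split_ifs <;> rfl

theorem treeSum_of_card_le (hA : A.card ≤ 1) : treeSum W q A f = 1 := by
  rw [treeSum, if_pos hA]

theorem sum_flow (S : Finset I) (t : ℝ) :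
    ∑ e ∈ S, flow W A t f e = ∑ e ∈ S, f e - t * blockSum W S A := by
  simp [flow, blockSum, Finset.sum_sub_distrib, Finset.mul_sum]

theorem blockSum_swap (hW : ∀ a b, W a b = -W b a) (B C : Finset I) :
    blockSum W B C = -blockSum W C B := by
  unfold blockSum
  rw [Finset.sum_comm, ← Finset.sum_neg_distrib]
  refine Finset.sum_congr rfl fun c _ => ?_
  rw [← Finset.sum_neg_distrib]
  exact Finset.sum_congr rfl fun b _ => hW b c

theorem blockSum_self (hW : ∀ a b, W a b = -W b a) (B : Finset I) : blockSum W B B = 0 := by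
  linarith [blockSum_swap hW B B]

theorem blockSum_union_right (h : Disjoint B C) :
    blockSum W A (B ∪ C) = blockSum W A B + blockSum W A C := by
  simp [blockSum, Finset.sum_union h, Finset.sum_add_distrib]

theorem blockSum_of_subset (hW : ∀ a b, W a b = -W b a) (hBA : B ⊆ A) :
    blockSum W B A = blockSum W B (A \ B) := by
  nth_rewrite 1 [← Finset.union_sdiff_of_subset hBA]
  rw [blockSum_union_right Finset.disjoint_sdiff, blockSum_self hW, zero_add]

theorem blockSum_sdiff_swap (hW : ∀ a b, W a b = -W b a) (hBA : B ⊆ A) :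
    blockSum W (A \ B) (A \ (A \ B)) = -blockSum W B (A \ B) := by
  rw [Finset.sdiff_sdiff_eq_self hBA, blockSum_swap hW]

theorem sum_sdiff_eq_neg (hBA : B ⊆ A) (hf : ∑ e ∈ A, f e = 0) :
    ∑ e ∈ A \ B, f e = -∑ e ∈ B, f e := by
  linarith [Finset.sum_sdiff (f := f) hBA]

theorem sum_flow_self (hW : ∀ a b, W a b = -W b a) (hf : ∑ e ∈ A, f e = 0) (t : ℝ) :
    ∑ e ∈ A, flow W A t f e = 0 := by
  rw [sum_flow, blockSum_self hW, hf]; ring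

theorem sum_splitFlow_self (hW : ∀ a b, W a b = -W b a) (hf : ∑ e ∈ A, f e = 0) (B : Finset I) :
    ∑ e ∈ A, splitFlow W A B f e = 0 := sum_flow_self hW hf _

theorem sum_splitFlow (hW : ∀ a b, W a b = -W b a) (hBA : B ⊆ A)
    (h : blockSum W B (A \ B) ≠ 0) : ∑ e ∈ B, splitFlow W A B f e = 0 := by
  rw [splitFlow, sum_flow, blockSum_of_subset hW hBA, div_mul_cancel₀ _ h, sub_self]

theorem sum_splitFlow_sdiff (hW : ∀ a b, W a b = -W b a) (hBA : B ⊆ A)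
    (h : blockSum W B (A \ B) ≠ 0) (hf : ∑ e ∈ A, f e = 0) :
    ∑ e ∈ A \ B, splitFlow W A B f e = 0 := by
  rw [sum_sdiff_eq_neg hBA (sum_splitFlow_self hW hf B), sum_splitFlow hW hBA h, neg_zero]

/-- The moments `f` are so general that at each step of the construction of binary trees with
leaves in `A`, only one splitting is possible at a time. -/
def VeryGeneric (W : I → I → ℝ) (A : Finset I) (f : I → ℝ) : Prop :=
  ∀ B : Finset I, (h : B ⊆ A ∧ 0 < blockSum W B (A \ B)) →
    ∑ e ∈ B, f e ≠ 0 ∧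
    (∀ S ⊆ A, S ≠ ∅ → S ≠ A → S ≠ B → S ≠ A \ B → ∑ e ∈ S, splitFlow W A B f e ≠ 0) ∧
    VeryGeneric W B (splitFlow W A B f) ∧ VeryGeneric W (A \ B) (splitFlow W A B f)
termination_by A.card
decreasing_by
  · exact Finset.card_lt_card (ssubset_of_blockSum_ne_zero h.1 h.2.ne').1
  · exact Finset.card_lt_card (ssubset_of_blockSum_ne_zero h.1 h.2.ne').2

/-- The variation of a function of a real variable which is locally constant outside of finitely
many jumps `J i` at distinct points `τ i`. -/
theorem sub_eq_sum_jumps {ι M : Type*} [DecidableEq ι] [AddCommGroup M] (g : ℝ → M) (J : ι → M)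
    (τ : ι → ℝ) (s : Finset ι)
    (h0 : ∀ x y, x < y → (∀ i ∈ s, τ i < x ∨ y < τ i) → g x = g y)
    (h1 : ∀ i ∈ s, ∀ x y, x < τ i → τ i < y →
      (∀ j ∈ s, j ≠ i → τ j < x ∨ y < τ j) → g x - g y = J i)
    (hτ : ∀ i ∈ s, ∀ j ∈ s, i ≠ j → τ i ≠ τ j)
    {a b : ℝ} (hab : a < b) (ha : ∀ i ∈ s, τ i ≠ a) (hb : ∀ i ∈ s, τ i ≠ b) :
    g a - g b = ∑ i ∈ s with (a < τ i ∧ τ i < b), J i := by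
  classical
  obtain ⟨k, hk⟩ : ∃ k, k = (s.filter fun i => a < τ i ∧ τ i < b).card := ⟨_, rfl⟩
  induction k generalizing a with
  | zero =>
    have he := Finset.card_eq_zero.1 hk.symm
    rw [he, Finset.sum_empty, sub_eq_zero]
    refine h0 a b hab fun i hi => ?_
    have := (Finset.filter_eq_empty_iff.1 he) hi
    rcases lt_or_gt_of_ne (ha i hi) with h | h
    · exact Or.inl h
    · exact Or.inr (lt_of_le_of_ne (not_lt.1 fun h' => this ⟨h, h'⟩) (hb i hi).symm)
  | succ k ih =>
    set F := s.filter fun i => a < τ i ∧ τ i < b with hF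
    have hne : F.Nonempty := Finset.card_pos.1 (by omega)
    obtain ⟨i, hi, hmin⟩ := Finset.exists_min_image F τ hne
    have hi' := (Finset.mem_filter.1 hi)
    -- a point `c` after `τ i`, before the other jumps and before `b`
    obtain ⟨c, hc1, hc2, hc3⟩ : ∃ c, τ i < c ∧ c < b ∧ ∀ j ∈ s, τ i < τ j → c < τ j := by
      have : ∀ᶠ c in nhdsWithin (τ i) (Set.Ioi (τ i)),
          τ i < c ∧ c < b ∧ ∀ j ∈ s, τ i < τ j → c < τ j := by
        refine Filter.Eventually.and eventually_mem_nhdsWithin (Filter.Eventually.and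
          (nhdsWithin_le_nhds (eventually_lt_nhds hi'.2.2)) ?_)
        refine (Finset.eventually_all s).2 fun j _ => ?_
        by_cases h : τ i < τ j
        · filter_upwards [nhdsWithin_le_nhds (eventually_lt_nhds h)] with c hc _ using hc
        · exact Filter.Eventually.of_forall fun c h' => absurd h' h
      exact this.exists
    have hac : a < c := hi'.2.1.trans hc1
    have hjump : g a - g c = J i := by
      refine h1 i hi'.1 a c hi'.2.1 hc1 fun j hj hji => ?_
      rcases lt_or_gt_of_ne (ha j hj) with h | h
      · exact Or.inl h
      · right
        refine hc3 j hj (lt_of_le_of_ne ?_ (hτ i hi'.1 j hj hji.symm))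
        by_cases hjb : τ j < b
        · exact hmin j (Finset.mem_filter.2 ⟨hj, h, hjb⟩)
        · exact hi'.2.2.le.trans (not_lt.1 hjb)
    have hset : F = insert i (s.filter fun j => c < τ j ∧ τ j < b) := by
      ext j
      simp only [hF, Finset.mem_filter, Finset.mem_insert]
      constructor
      · rintro ⟨hj, h1', h2'⟩
        by_cases hji : j = i
        · exact Or.inl hji
        · refine Or.inr ⟨hj, hc3 j hj (lt_of_le_of_ne ?_ (hτ i hi'.1 j hj (Ne.symm hji))), h2'⟩
          exact hmin j (Finset.mem_filter.2 ⟨hj, h1', h2'⟩)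
      · rintro (rfl | ⟨hj, h1', h2'⟩)
        · exact ⟨hi'.1, hi'.2⟩
        · exact ⟨hj, hac.trans h1', h2'⟩
    have hni : i ∉ s.filter fun j => c < τ j ∧ τ j < b := by
      simp only [Finset.mem_filter, not_and]
      intro _ h
      exact absurd h (not_lt.2 hc1.le)
    rw [hset, Finset.sum_insert hni, ← hjump, ← ih hc2]
    · abel
    · intro j hj hjc
      rcases lt_trichotomy (τ j) (τ i) with h | h | h
      · linarith
      · linarith
      · linarith [hc3 j hj h]
    · rw [hset, Finset.card_insert_of_notMem hni] at hk
      omega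

end flow

/-! ### Independence of generic moments -/

section invariance

variable {I R : Type*} [DecidableEq I] [CommRing R] {W : I → I → ℝ} {q : Finset I → Finset I → R}
  {A B C : Finset I} {f : I → ℝ} {Φ : Finset I → R}

/-- An antisymmetric matrix such that no sum of entries over a rectangle with disjoint sides
vanishes. -/
structure IsGenericMatrix (W : I → I → ℝ) : Prop where
  antisymm : ∀ a b, W a b = -W b a
  ne_zero : ∀ B C : Finset I, B ≠ ∅ → C ≠ ∅ → Disjoint B C → blockSum W B C ≠ 0

theorem sum_flow_neg_iff (hW : ∀ a b, W a b = -W b a) (hBA : B ⊆ A)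
    (h : 0 < blockSum W B (A \ B)) (t : ℝ) :
    ∑ e ∈ B, flow W A t f e < 0 ↔ (∑ e ∈ B, f e) / blockSum W B (A \ B) < t := by
  rw [sum_flow, blockSum_of_subset hW hBA, div_lt_iff₀ h, sub_neg]

theorem sum_flow_sdiff_neg_iff (hW : ∀ a b, W a b = -W b a) (hBA : B ⊆ A)
    (hf : ∑ e ∈ A, f e = 0) (h : 0 < blockSum W B (A \ B)) (t : ℝ) :
    ∑ e ∈ A \ B, flow W A t f e < 0 ↔ t < (∑ e ∈ B, f e) / blockSum W B (A \ B) := by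
  rw [sum_sdiff_eq_neg hBA (sum_flow_self hW hf t), sum_flow, blockSum_of_subset hW hBA,
    lt_div_iff₀ h, neg_lt_zero, sub_pos]

/-- Of a proper subset and its complement, exactly one is the first part of a splitting. -/
theorem IsGenericMatrix.pos_or_pos (hW : IsGenericMatrix W) (hBA : B ⊆ A) (hB : B ≠ ∅)
    (hBA' : B ≠ A) : 0 < blockSum W B (A \ B) ∨ 0 < blockSum W (A \ B) (A \ (A \ B)) := by
  have hC : A \ B ≠ ∅ := by
    rw [Ne, Finset.sdiff_eq_empty_iff_subset]
    exact fun h => hBA' (hBA.antisymm h)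
  rw [blockSum_sdiff_swap hW.antisymm hBA, neg_pos]
  exact (hW.ne_zero B _ hB hC Finset.disjoint_sdiff).lt_or_gt.symm

/-- The signs of the moments do not change along the flow between two splittings, except possibly
for `B₀` and its complement. -/
theorem sum_flow_neg_congr (hW : IsGenericMatrix W) (hf : ∑ e ∈ A, f e = 0) {x y : ℝ}
    (hxy : x ≤ y) (B₀ : Finset I)
    (h : ∀ B ⊆ A, 0 < blockSum W B (A \ B) → B ≠ B₀ →
      (∑ e ∈ B, f e) / blockSum W B (A \ B) < x ∨ y < (∑ e ∈ B, f e) / blockSum W B (A \ B))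
    {S : Finset I} (hS : S ⊆ A) (h1 : S ≠ B₀) (h2 : S ≠ A \ B₀) :
    (∑ e ∈ S, flow W A x f e < 0 ↔ ∑ e ∈ S, flow W A y f e < 0) := by
  by_cases hS0 : S = ∅
  · simp [hS0]
  by_cases hSA : S = A
  · rw [hSA, sum_flow_self hW.antisymm hf, sum_flow_self hW.antisymm hf]
  rcases hW.pos_or_pos hS hS0 hSA with hp | hp
  · rw [sum_flow_neg_iff hW.antisymm hS hp, sum_flow_neg_iff hW.antisymm hS hp]
    rcases h S hS hp h1 with h' | h'
    · exact ⟨fun _ => h'.trans_le hxy, fun _ => h'⟩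
    · exact ⟨fun a => absurd (a.trans_le hxy) (not_lt.2 h'.le), fun a => absurd a (not_lt.2 h'.le)⟩
  · have hS' : A \ (A \ S) = S := Finset.sdiff_sdiff_eq_self hS
    have e1 := sum_flow_sdiff_neg_iff hW.antisymm Finset.sdiff_subset hf hp x
    have e2 := sum_flow_sdiff_neg_iff hW.antisymm Finset.sdiff_subset hf hp y
    simp only [hS'] at e1 e2
    rw [e1, e2]
    have hne : A \ S ≠ B₀ := fun h' => h2 (by rw [← h', hS'])
    have := h (A \ S) Finset.sdiff_subset hp hne
    rw [hS'] at this
    rcases this with h' | h'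
    · exact ⟨fun a => absurd a (not_lt.2 h'.le), fun a => absurd (hxy.trans_lt a) (not_lt.2 h'.le)⟩
    · exact ⟨fun _ => h', fun _ => hxy.trans_lt h'⟩

/-- The variation of the coefficient of `A` along the flow is the sum of the contributions of the
splittings which are met. -/
theorem factorCoeff_flow_sub (hW : IsGenericMatrix W) (hq : IsBichar q)
    (hf : ∑ e ∈ A, f e = 0)
    (hgen : ∀ B ⊆ A, 0 < blockSum W B (A \ B) →
      ∀ S ⊆ A, S ≠ ∅ → S ≠ A → S ≠ B → S ≠ A \ B → ∑ e ∈ S, splitFlow W A B f e ≠ 0)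
    {a b : ℝ} (hab : a < b)
    (ha : ∀ B ⊆ A, 0 < blockSum W B (A \ B) → (∑ e ∈ B, f e) / blockSum W B (A \ B) ≠ a)
    (hb : ∀ B ⊆ A, 0 < blockSum W B (A \ B) → (∑ e ∈ B, f e) / blockSum W B (A \ B) ≠ b) :
    factorCoeff q Φ (fun S => ∑ e ∈ S, flow W A a f e < 0) A -
      factorCoeff q Φ (fun S => ∑ e ∈ S, flow W A b f e < 0) A =
    ∑ B ∈ (A.powerset.filter fun B => 0 < blockSum W B (A \ B)) with
      (a < (∑ e ∈ B, f e) / blockSum W B (A \ B) ∧ (∑ e ∈ B, f e) / blockSum W B (A \ B) < b),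
      (q B (A \ B) - q (A \ B) B) *
        factorCoeff q Φ (fun S => ∑ e ∈ S, splitFlow W A B f e < 0) B *
        factorCoeff q Φ (fun S => ∑ e ∈ S, splitFlow W A B f e < 0) (A \ B) := by
  refine sub_eq_sum_jumps
    (fun t => factorCoeff q Φ (fun S => ∑ e ∈ S, flow W A t f e < 0) A)
    (fun B => (q B (A \ B) - q (A \ B) B) *
        factorCoeff q Φ (fun S => ∑ e ∈ S, splitFlow W A B f e < 0) B *
        factorCoeff q Φ (fun S => ∑ e ∈ S, splitFlow W A B f e < 0) (A \ B))
    (fun B => (∑ e ∈ B, f e) / blockSum W B (A \ B)) _ ?_ ?_ ?_ hab ?_ ?_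
  · intro x y hxy h
    refine factorCoeff_congr (fun _ _ => rfl) fun S hS => ?_
    by_cases hS0 : S = ∅
    · simp [hS0]
    by_cases hSA : S = A
    · rw [hSA, sum_flow_self hW.antisymm hf, sum_flow_self hW.antisymm hf]
    refine sum_flow_neg_congr hW hf hxy.le ∅ (fun B hB hp _ => ?_) hS hS0 (by simpa using hSA)
    exact h B (Finset.mem_filter.2 ⟨Finset.mem_powerset.2 hB, hp⟩)
  · intro B hB x y hx hy h
    obtain ⟨hBA, hp⟩ := Finset.mem_filter.1 hB
    rw [Finset.mem_powerset] at hBA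
    replace h : ∀ S ⊆ A, 0 < blockSum W S (A \ S) → S ≠ B →
      (∑ e ∈ S, f e) / blockSum W S (A \ S) < x ∨ y < (∑ e ∈ S, f e) / blockSum W S (A \ S) :=
      fun S hS hS' hne => h S (Finset.mem_filter.2 ⟨Finset.mem_powerset.2 hS, hS'⟩) hne
    have hne := ne_of_blockSum_sdiff_ne_zero hp.ne'
    have hC := (nonempty_of_blockSum_ne_zero hp.ne').2
    have hCB : A \ (A \ B) = B := Finset.sdiff_sdiff_eq_self hBA
    have z1 := sum_splitFlow hW.antisymm hBA hp.ne' (f := f)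
    have z2 := sum_splitFlow_sdiff hW.antisymm hBA hp.ne' hf
    have z3 := sum_splitFlow_self hW.antisymm hf B
    have nyB : ∑ e ∈ B, flow W A y f e < 0 := (sum_flow_neg_iff hW.antisymm hBA hp y).2 hy
    have nyC : ¬ ∑ e ∈ A \ B, flow W A y f e < 0 := by
      rw [sum_flow_sdiff_neg_iff hW.antisymm hBA hf hp]; exact not_lt.2 hy.le
    have nxB : ¬ ∑ e ∈ B, flow W A x f e < 0 := by
      rw [sum_flow_neg_iff hW.antisymm hBA hp]; exact not_lt.2 hx.le
    have nxC : ∑ e ∈ A \ B, flow W A x f e < 0 :=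
      (sum_flow_sdiff_neg_iff hW.antisymm hBA hf hp x).2 hx
    have hBC : B ≠ A \ B := fun h => by
      rw [← h, blockSum_self hW.antisymm] at hp
      exact hp.false
    have j1 := factorCoeff_jump (Φ := Φ) (neg := fun S => ∑ e ∈ S, splitFlow W A B f e < 0)
      (neg' := fun S => ∑ e ∈ S, flow W A y f e < 0) hq hBA hne.1 hC (by simp [z1]) (by simp [z2])
      (by simp [z3]) nyB (fun S hS hSB => by
        by_cases hSC : S = A \ B
        · subst hSC
          simp only [z2, lt_irrefl, nyC]
        · refine sum_flow_neg_congr hW hf hy.le B (fun S hS hS' hne => ?_) hS hSB hSC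
          exact (h S hS hS' hne).imp_left fun h => h.trans hx)
      (fun S hS hBS _ => by
        rw [← Finset.sum_sdiff hBS, z1, add_zero])
    have j2 := factorCoeff_jump (Φ := Φ) (neg := fun S => ∑ e ∈ S, splitFlow W A B f e < 0)
      (neg' := fun S => ∑ e ∈ S, flow W A x f e < 0) hq (Finset.sdiff_subset (s := A) (t := B)) hC
      (by rw [hCB]; exact hne.1) (by simp [z2]) (by rw [hCB]; simp [z1])
      (by simp [z3]) nxC (fun S hS hSC => by
        by_cases hSB : S = B
        · subst hSB
          simp only [z1, lt_irrefl, nxB]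
        · refine (sum_flow_neg_congr hW hf hx.le B (fun S hS hS' hne => ?_) hS hSB hSC).symm
          exact (h S hS hS' hne).imp_right fun h => hy.trans h)
      (fun S hS hBS _ => by
        rw [← Finset.sum_sdiff hBS, z2, add_zero])
    rw [j1, j2, hCB]
    ring
  · intro B hB C hC hne heq
    obtain ⟨hBA, hp⟩ := Finset.mem_filter.1 hB
    obtain ⟨hCA, hp'⟩ := Finset.mem_filter.1 hC
    rw [Finset.mem_powerset] at hBA hCA
    have h1 := ne_of_blockSum_sdiff_ne_zero hp'.ne'
    refine hgen B hBA hp C hCA h1.1 h1.2 hne.symm ?_ ?_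
    · rintro rfl
      rw [blockSum_sdiff_swap hW.antisymm hBA] at hp'
      linarith
    · rw [splitFlow, heq]
      exact sum_splitFlow hW.antisymm hCA hp'.ne'
  · intro B hB
    obtain ⟨hBA, hp⟩ := Finset.mem_filter.1 hB
    exact ha B (Finset.mem_powerset.1 hBA) hp
  · intro B hB
    obtain ⟨hBA, hp⟩ := Finset.mem_filter.1 hB
    exact hb B (Finset.mem_powerset.1 hBA) hp

theorem exists_forall_lt_real {ι : Type*} (s : Finset ι) (τ : ι → ℝ) (x : ℝ) :
    ∃ b, x < b ∧ ∀ i ∈ s, τ i < b := by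
  have h : ∀ᶠ b in Filter.atTop, x < b ∧ ∀ i ∈ s, τ i < b :=
    (Filter.eventually_gt_atTop x).and
      ((Finset.eventually_all s).2 fun i _ => Filter.eventually_gt_atTop (τ i))
  exact h.exists

theorem exists_forall_gt_real {ι : Type*} (s : Finset ι) (τ : ι → ℝ) (x : ℝ) :
    ∃ a, a < x ∧ ∀ i ∈ s, a < τ i := by
  obtain ⟨b, h1, h2⟩ := exists_forall_lt_real s (fun i => -τ i) (-x)
  exact ⟨-b, by linarith, fun i hi => by linarith [h2 i hi]⟩

/-- Far along the flow, the signs are those of the direction of the flow. -/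
theorem factorCoeff_flow_of_large (hW : IsGenericMatrix W) (hf : ∑ e ∈ A, f e = 0) {b : ℝ}
    (hb : ∀ B ⊆ A, 0 < blockSum W B (A \ B) → (∑ e ∈ B, f e) / blockSum W B (A \ B) < b) :
    factorCoeff q Φ (fun S => ∑ e ∈ S, flow W A b f e < 0) A =
      factorCoeff q Φ (fun S => 0 < blockSum W S A) A := by
  refine factorCoeff_congr (fun _ _ => rfl) fun S hS => ?_
  by_cases hS0 : S = ∅
  · simp [hS0, blockSum]
  by_cases hSA : S = A
  · simp [hSA, sum_flow_self hW.antisymm hf, blockSum_self hW.antisymm]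
  rw [blockSum_of_subset hW.antisymm hS]
  rcases hW.pos_or_pos hS hS0 hSA with hp | hp
  · rw [sum_flow_neg_iff hW.antisymm hS hp]
    exact ⟨fun _ => hp, fun _ => hb S hS hp⟩
  · have e1 := sum_flow_sdiff_neg_iff hW.antisymm Finset.sdiff_subset hf hp b
    have := hb _ Finset.sdiff_subset hp
    rw [Finset.sdiff_sdiff_eq_self hS] at e1 this
    rw [e1]
    rw [blockSum_sdiff_swap hW.antisymm hS] at hp
    exact ⟨fun h => absurd h (not_lt.2 this.le), fun h => by linarith⟩

theorem factorCoeff_flow_of_small (hW : IsGenericMatrix W) (hf : ∑ e ∈ A, f e = 0) {a : ℝ}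
    (ha : ∀ B ⊆ A, 0 < blockSum W B (A \ B) → a < (∑ e ∈ B, f e) / blockSum W B (A \ B)) :
    factorCoeff q Φ (fun S => ∑ e ∈ S, flow W A a f e < 0) A =
      factorCoeff q Φ (fun S => blockSum W S A < 0) A := by
  refine factorCoeff_congr (fun _ _ => rfl) fun S hS => ?_
  by_cases hS0 : S = ∅
  · simp [hS0, blockSum]
  by_cases hSA : S = A
  · simp [hSA, sum_flow_self hW.antisymm hf, blockSum_self hW.antisymm]
  rw [blockSum_of_subset hW.antisymm hS]
  rcases hW.pos_or_pos hS hS0 hSA with hp | hp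
  · rw [sum_flow_neg_iff hW.antisymm hS hp]
    exact ⟨fun h => absurd h (not_lt.2 (ha S hS hp).le), fun h => by linarith⟩
  · have e1 := sum_flow_sdiff_neg_iff hW.antisymm Finset.sdiff_subset hf hp a
    have := ha _ Finset.sdiff_subset hp
    rw [Finset.sdiff_sdiff_eq_self hS] at e1 this
    rw [e1]
    rw [blockSum_sdiff_swap hW.antisymm hS] at hp
    exact ⟨fun h => by linarith, fun h => this⟩

/-- If the coefficients far along the flow vanish, then the count of binary trees is a
coefficient of the factorization associated with the signs of the moments. -/
theorem treeSum_eq_factorCoeff (hW : IsGenericMatrix W) (hq : IsBichar q)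
    (hΦ1 : ∀ e, Φ {e} = 1)
    (hΦ : ∀ A : Finset I, 2 ≤ A.card → factorCoeff q Φ (fun S => 0 < blockSum W S A) A = 0)
    (hA : A ≠ ∅) (hf : ∑ e ∈ A, f e = 0) (hv : VeryGeneric W A f) :
    treeSum W q A f = factorCoeff q Φ (fun S => ∑ e ∈ S, f e < 0) A := by
  classical
  induction A using Finset.strongInduction generalizing f with
  | H A ih =>
    rcases Nat.lt_or_ge A.card 2 with h | h
    · obtain ⟨e, rfl⟩ : ∃ e, A = {e} := by
        rw [← Finset.card_eq_one]
        have := Finset.card_pos.2 (Finset.nonempty_iff_ne_empty.2 hA)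
        omega
      rw [treeSum_of_card_le (by omega), factorCoeff_singleton, hΦ1]
    rw [VeryGeneric] at hv
    obtain ⟨b, hb0, hb⟩ := exists_forall_lt_real A.powerset
      (fun B => (∑ e ∈ B, f e) / blockSum W B (A \ B)) 0
    have hb' : ∀ B ⊆ A, 0 < blockSum W B (A \ B) → (∑ e ∈ B, f e) / blockSum W B (A \ B) < b :=
      fun B hB _ => hb B (Finset.mem_powerset.2 hB)
    have key := factorCoeff_flow_sub (Φ := Φ) hW hq hf
      (fun B hB hp => (hv B ⟨hB, hp⟩).2.1) hb0
      (fun B hB hp => div_ne_zero (hv B ⟨hB, hp⟩).1 hp.ne') (fun B hB hp => (hb' B hB hp).ne)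
    rw [factorCoeff_flow_of_large hW hf hb', hΦ A h, sub_zero] at key
    have hzero : flow W A 0 f = f := by funext e; simp [flow]
    rw [hzero] at key
    rw [key, treeSum_eq h, ← Finset.sum_filter, Finset.filter_filter]
    refine Finset.sum_congr (Finset.filter_congr fun B hB => ?_) fun B hB => ?_
    · refine and_congr_right fun hp => ?_
      rw [div_pos_iff_of_pos_right hp]
      exact ⟨fun h => ⟨h, hb B hB⟩, fun h => h.1⟩
    · simp only [Finset.mem_filter, Finset.mem_powerset] at hB
      have hs := ssubset_of_blockSum_ne_zero hB.1 hB.2.1.ne'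
      have hne := nonempty_of_blockSum_ne_zero hB.2.1.ne'
      have hvB := hv B ⟨hB.1, hB.2.1⟩
      rw [ih B hs.1 hne.1 (sum_splitFlow hW.antisymm hB.1 hB.2.1.ne') hvB.2.2.1,
        ih _ hs.2 hne.2 (sum_splitFlow_sdiff hW.antisymm hB.1 hB.2.1.ne' hf) hvB.2.2.2]

/-- For a generic matrix, the count of rooted binary trees does not depend on the very generic
moments. -/
theorem exists_rootedTreeSum_eq [Fintype I] (hW : IsGenericMatrix W) (hq : IsBichar q)
    (A : Finset I) (hA : 2 ≤ A.card) :
    ∃ c : R, ∀ f, ∑ e ∈ A, f e = 0 → VeryGeneric W A f → rootedTreeSum W q A f = c := by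
  classical
  obtain ⟨Φ, hΦ1, hΦ⟩ := exists_factorCoeff_eq_zero q fun A S => 0 < blockSum W S A
  refine ⟨factorCoeff q Φ (fun S => blockSum W S A < 0) A, fun f hf hv => ?_⟩
  rw [VeryGeneric] at hv
  obtain ⟨b, hb0, hb⟩ := exists_forall_lt_real A.powerset
    (fun B => (∑ e ∈ B, f e) / blockSum W B (A \ B)) 0
  obtain ⟨a, ha0, ha⟩ := exists_forall_gt_real A.powerset
    (fun B => (∑ e ∈ B, f e) / blockSum W B (A \ B)) 0
  have hb' : ∀ B ⊆ A, 0 < blockSum W B (A \ B) → (∑ e ∈ B, f e) / blockSum W B (A \ B) < b :=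
    fun B hB _ => hb B (Finset.mem_powerset.2 hB)
  have ha' : ∀ B ⊆ A, 0 < blockSum W B (A \ B) → a < (∑ e ∈ B, f e) / blockSum W B (A \ B) :=
    fun B hB _ => ha B (Finset.mem_powerset.2 hB)
  have key := factorCoeff_flow_sub (Φ := Φ) hW hq hf
    (fun B hB hp => (hv B ⟨hB, hp⟩).2.1) (ha0.trans hb0)
    (fun B hB hp => (ha' B hB hp).ne') (fun B hB hp => (hb' B hB hp).ne)
  rw [factorCoeff_flow_of_large hW hf hb', hΦ A hA, sub_zero,
    factorCoeff_flow_of_small hW hf ha'] at key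
  rw [key, rootedTreeSum, ← Finset.sum_filter, Finset.filter_filter]
  refine Finset.sum_congr (Finset.filter_congr fun B hB => ?_) fun B hB => ?_
  · exact ⟨fun h => ⟨h, ha B hB, hb B hB⟩, fun h => h.1⟩
  · simp only [Finset.mem_filter, Finset.mem_powerset] at hB
    have hne := nonempty_of_blockSum_ne_zero hB.2.1.ne'
    have hvB := hv B ⟨hB.1, hB.2.1⟩
    rw [treeSum_eq_factorCoeff hW hq hΦ1 hΦ hne.1 (sum_splitFlow hW.antisymm hB.1 hB.2.1.ne')
        hvB.2.2.1, treeSum_eq_factorCoeff hW hq hΦ1 hΦ hne.2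
        (sum_splitFlow_sdiff hW.antisymm hB.1 hB.2.1.ne' hf) hvB.2.2.2]

end invariance

/-! ### Generic matrices and generic moments -/

section density

open Filter Topology

/-- Finitely many linear forms which do not vanish identically on a subspace can be made non-zero
by an arbitrarily small displacement in this subspace. -/
theorem exists_small_forall_dual_ne_zero {X : Type*} [AddCommGroup X] [Module ℝ X]
    [TopologicalSpace X] [ContinuousAdd X] [ContinuousSMul ℝ X] (p : Submodule ℝ X)
    {Λ : Set (Module.Dual ℝ X)} (hΛ : Λ.Finite) (h : ∀ l ∈ Λ, ∃ g ∈ p, l g ≠ 0) (x : X)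
    {U : Set X} (hU : U ∈ 𝓝 x) : ∃ v ∈ p, x + v ∈ U ∧ ∀ l ∈ Λ, l (x + v) ≠ 0 := by
  have : Finite Λ := hΛ
  obtain ⟨v, hv, hv'⟩ := Module.Dual.exists_forall_mem_ne_zero_of_forall_exists p
    (fun l : Λ => l.1) fun l => h l.1 l.2
  have h1 : Tendsto (fun ε : ℝ => x + ε • v) (𝓝[≠] 0) (𝓝 x) := by
    have : Continuous fun ε : ℝ => x + ε • v := by fun_prop
    have := this.tendsto 0
    simp only [zero_smul, add_zero] at this
    exact this.mono_left nhdsWithin_le_nhds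
  have h2 : ∀ᶠ ε : ℝ in 𝓝[≠] 0, ∀ l : Λ, l.1 (x + ε • v) ≠ 0 := by
    refine eventually_all.2 fun l => ?_
    have hl := hv' l
    by_cases hx : l.1 x = 0
    · filter_upwards [self_mem_nhdsWithin] with ε hε
      simpa [hx, hl] using hε
    · have : {-(l.1 x / l.1 v)}ᶜ ∈ 𝓝 (0 : ℝ) := by
        refine isOpen_compl_singleton.mem_nhds ?_
        exact fun h => neg_ne_zero.2 (div_ne_zero hx hl) (Set.mem_singleton_iff.1 h).symm
      filter_upwards [nhdsWithin_le_nhds this] with ε hε h0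
      rw [map_add, map_smul, smul_eq_mul] at h0
      refine hε ?_
      rw [Set.mem_singleton_iff]
      field_simp
      linarith
  obtain ⟨ε, h3, h4⟩ := ((h1.eventually hU).and h2).exists
  exact ⟨ε • v, p.smul_mem _ hv, h3, fun l hl => h4 ⟨l, hl⟩⟩

variable {I : Type*} [DecidableEq I] [Fintype I] {W : I → I → ℝ}

/-- Generic matrices are dense among the antisymmetric ones. -/
theorem exists_isGenericMatrix_mem {W₀ : I → I → ℝ} (hW₀ : ∀ a b, W₀ a b = -W₀ b a)
    {U : Set (I → I → ℝ)} (hU : U ∈ 𝓝 W₀) : ∃ W ∈ U, IsGenericMatrix W := by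
  classical
  let p : Submodule ℝ (I → I → ℝ) :=
    { carrier := {W | ∀ a b, W a b = -W b a}
      add_mem' := fun {x y} hx hy a b => by simp [hx a b, hy a b]; ring
      zero_mem' := by simp
      smul_mem' := fun c x hx a b => by simp [hx a b] }
  let l (s : Finset I × Finset I) : Module.Dual ℝ (I → I → ℝ) :=
    { toFun := fun W => blockSum W s.1 s.2
      map_add' := by simp [blockSum, Finset.sum_add_distrib]
      map_smul' := by simp [blockSum, Finset.mul_sum] }
  obtain ⟨v, hv, h1, h2⟩ := exists_small_forall_dual_ne_zero p
    (Λ := l '' {s | s.1 ≠ ∅ ∧ s.2 ≠ ∅ ∧ Disjoint s.1 s.2}) ((Set.toFinite _).image _) (by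
      rintro _ ⟨⟨B, C⟩, ⟨hB, hC, hBC⟩, rfl⟩
      obtain ⟨b, hb⟩ := Finset.nonempty_iff_ne_empty.2 hB
      obtain ⟨c, hc⟩ := Finset.nonempty_iff_ne_empty.2 hC
      simp only at hb hc hBC
      have hcB : c ∉ B := fun h => Finset.disjoint_left.1 hBC h hc
      refine ⟨fun x y => (if x = b then if y = c then 1 else 0 else 0) -
        (if x = c then if y = b then 1 else 0 else 0), fun x y => ?_, ?_⟩
      · by_cases x = b <;> by_cases x = c <;> by_cases y = b <;> by_cases y = c <;> simp_all
      · change ∑ x ∈ B, ∑ y ∈ C, _ ≠ (0 : ℝ)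
        simp [Finset.sum_sub_distrib, Finset.sum_ite_irrel, hb, hc, hcB]) W₀ hU
  refine ⟨W₀ + v, h1, fun a b => ?_,
    fun B C hB hC hBC => h2 (l (B, C)) ⟨(B, C), ⟨hB, hC, hBC⟩, rfl⟩⟩
  have := hv a b
  simp [hW₀ a b, this]
  ring

/-- A property of the families of moments which holds outside of a finite union of hyperplanes
of the space of moments supported on `A` of total sum zero. -/
def HoldsGenerically (A : Finset I) (P : (I → ℝ) → Prop) : Prop :=
  ∃ Λ : Set (Module.Dual ℝ (I → ℝ)), Λ.Finite ∧
    (∀ l ∈ Λ, ∃ g : I → ℝ, (∀ e ∉ A, g e = 0) ∧ ∑ e ∈ A, g e = 0 ∧ l g ≠ 0) ∧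
    ∀ f, ∑ e ∈ A, f e = 0 → (∀ l ∈ Λ, l f ≠ 0) → P f

variable {A : Finset I} {P : (I → ℝ) → Prop}

theorem holdsGenerically_forall {ι : Type*} [Finite ι] {P : ι → (I → ℝ) → Prop}
    (h : ∀ i, HoldsGenerically A (P i)) : HoldsGenerically A fun f => ∀ i, P i f := by
  choose Λ h1 h2 h3 using h
  refine ⟨⋃ i, Λ i, Set.finite_iUnion h1, fun l hl => ?_, fun f hf hl i => ?_⟩
  · obtain ⟨i, hi⟩ := Set.mem_iUnion.1 hl
    exact h2 i l hi
  · exact h3 i f hf fun l hl' => hl l (Set.mem_iUnion.2 ⟨i, hl'⟩)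

theorem HoldsGenerically.and {Q : (I → ℝ) → Prop} (hP : HoldsGenerically A P)
    (hQ : HoldsGenerically A Q) : HoldsGenerically A fun f => P f ∧ Q f := by
  obtain ⟨Λ, h1, h2, h3⟩ := hP
  obtain ⟨Λ', h1', h2', h3'⟩ := hQ
  refine ⟨Λ ∪ Λ', h1.union h1', fun l hl => hl.elim (h2 l) (h2' l), fun f hf hl => ⟨?_, ?_⟩⟩
  · exact h3 f hf fun l h => hl l (Or.inl h)
  · exact h3' f hf fun l h => hl l (Or.inr h)

theorem holdsGenerically_of_forall (h : ∀ f, ∑ e ∈ A, f e = 0 → P f) : HoldsGenerically A P :=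
  ⟨∅, Set.finite_empty, by simp, fun f hf _ => h f hf⟩

theorem holdsGenerically_imp {Q : Prop} (h : Q → HoldsGenerically A P) :
    HoldsGenerically A fun f => Q → P f := by
  by_cases hQ : Q
  · obtain ⟨Λ, h1, h2, h3⟩ := h hQ
    exact ⟨Λ, h1, h2, fun f hf hl _ => h3 f hf hl⟩
  · exact holdsGenerically_of_forall fun f _ h => absurd h hQ

theorem holdsGenerically_dual_ne_zero (l : Module.Dual ℝ (I → ℝ)) (g : I → ℝ)
    (h1 : ∀ e ∉ A, g e = 0) (h2 : ∑ e ∈ A, g e = 0) (h3 : l g ≠ 0) :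
    HoldsGenerically A fun f => l f ≠ 0 :=
  ⟨{l}, Set.finite_singleton l, by rintro _ rfl; exact ⟨g, h1, h2, h3⟩, fun f _ h => h l rfl⟩

/-- `splitFlow W A B` as a linear map. -/
def splitFlowLinear (W : I → I → ℝ) (A B : Finset I) : (I → ℝ) →ₗ[ℝ] (I → ℝ) where
  toFun := splitFlow W A B
  map_add' f g := by
    funext e
    simp [splitFlow, flow, Finset.sum_add_distrib]; ring
  map_smul' c f := by
    funext e
    simp [splitFlow, flow, ← Finset.mul_sum]; ring

theorem splitFlow_eq_self {B : Finset I} {f : I → ℝ} (h : ∑ e ∈ B, f e = 0) :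
    splitFlow W A B f = f := by
  funext e
  simp [splitFlow, flow, h]

/-- A generic condition on the moments after a splitting is a generic condition on the initial
moments: the displacement fixes the families supported on `S`. -/
theorem HoldsGenerically.comp_splitFlow {B S : Finset I} (h : HoldsGenerically S P)
    (hS : S ⊆ A) (hSB : S = B ∨ Disjoint S B)
    (hsum : ∀ f, ∑ e ∈ A, f e = 0 → ∑ e ∈ S, splitFlow W A B f e = 0) :
    HoldsGenerically A fun f => P (splitFlow W A B f) := by
  obtain ⟨Λ, h1, h2, h3⟩ := h
  refine ⟨(fun l => l ∘ₗ splitFlowLinear W A B) '' Λ, h1.image _, ?_, fun f hf hl => ?_⟩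
  · rintro _ ⟨l, hl, rfl⟩
    obtain ⟨g, g1, g2, g3⟩ := h2 l hl
    have hz : ∑ e ∈ B, g e = 0 := by
      rcases hSB with rfl | h
      · exact g2
      · exact Finset.sum_eq_zero fun e he => g1 e fun he' => Finset.disjoint_left.1 h he' he
    refine ⟨g, fun e he => g1 e fun he' => he (hS he'), ?_, ?_⟩
    · rw [← Finset.sum_subset hS fun e _ he => g1 e he, g2]
    · change l (splitFlow W A B g) ≠ 0
      rwa [splitFlow_eq_self hz]
  · exact h3 _ (hsum f hf) fun l hl' => hl _ ⟨l, hl', rfl⟩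

theorem sum_single_sub_single {S : Finset I} {b c : I} :
    ∑ e ∈ S, ((Pi.single b (1 : ℝ) : I → ℝ) e - (Pi.single c (1 : ℝ) : I → ℝ) e) =
      (if b ∈ S then 1 else 0) - if c ∈ S then 1 else 0 := by
  rw [Finset.sum_sub_distrib, Finset.sum_pi_single', Finset.sum_pi_single']

theorem holdsGenerically_veryGeneric (hW : IsGenericMatrix W) (A : Finset I) :
    HoldsGenerically A (VeryGeneric W A) := by
  induction A using Finset.strongInduction with
  | H A ih =>
    have hrw : VeryGeneric W A = fun f => ∀ B : Finset I, (B ⊆ A ∧ 0 < blockSum W B (A \ B)) →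
        ∑ e ∈ B, f e ≠ 0 ∧
        (∀ S : Finset I, (S ⊆ A ∧ S ≠ ∅ ∧ S ≠ A ∧ S ≠ B ∧ S ≠ A \ B) →
          ∑ e ∈ S, splitFlow W A B f e ≠ 0) ∧
        VeryGeneric W B (splitFlow W A B f) ∧ VeryGeneric W (A \ B) (splitFlow W A B f) := by
      funext f
      rw [VeryGeneric]
      refine propext (forall_congr' fun B => forall_congr' fun hB => ?_)
      refine and_congr_right fun _ => and_congr_left fun _ => forall_congr' fun S => ?_
      tauto
    rw [hrw]
    refine holdsGenerically_forall fun B => holdsGenerically_imp fun ⟨hBA, hp⟩ => ?_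
    have hss := ssubset_of_blockSum_ne_zero hBA hp.ne'
    have hne := nonempty_of_blockSum_ne_zero hp.ne'
    obtain ⟨b, hb⟩ := Finset.nonempty_iff_ne_empty.2 hne.1
    obtain ⟨c, hc⟩ := Finset.nonempty_iff_ne_empty.2 hne.2
    have hc' := Finset.mem_sdiff.1 hc
    let sumL (S : Finset I) : Module.Dual ℝ (I → ℝ) := ∑ e ∈ S, LinearMap.proj e
    have hsumL : ∀ S f, sumL S f = ∑ e ∈ S, f e := fun S f => by simp [sumL]
    have hsupp : ∀ {b c : I}, b ∈ A → c ∈ A → ∀ e ∉ A,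
        (Pi.single b (1 : ℝ) - Pi.single c 1 : I → ℝ) e = 0 := by
      intro b c hb hc e he
      have h1 : e ≠ b := fun h => he (h ▸ hb)
      have h2 : e ≠ c := fun h => he (h ▸ hc)
      simp [h1, h2]
    refine HoldsGenerically.and ?_ (HoldsGenerically.and ?_ (HoldsGenerically.and ?_ ?_))
    · have := holdsGenerically_dual_ne_zero (A := A) (sumL B) (Pi.single b 1 - Pi.single c 1)
        (hsupp (hBA hb) hc'.1)
        (by simp only [Pi.sub_apply, sum_single_sub_single]; simp [hBA hb, hc'.1])
        (by rw [hsumL]; simp only [Pi.sub_apply, sum_single_sub_single]; simp [hb, hc'.2])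
      simpa only [hsumL] using this
    · refine holdsGenerically_forall fun S => holdsGenerically_imp fun ⟨hSA, h0, h1, h2, h3⟩ => ?_
      -- `S` separates two elements of `B` or two elements of `A \ B`
      obtain ⟨x, y, hx, hy, hxS, hyS, hxy⟩ : ∃ x y, x ∈ A ∧ y ∈ A ∧ x ∈ S ∧ y ∉ S ∧
          (x ∈ B ↔ y ∈ B) := by
        by_contra! hcon
        obtain ⟨s, hs⟩ := Finset.nonempty_iff_ne_empty.2 h0
        by_cases hsB : s ∈ B
        · refine h2 (Finset.Subset.antisymm (fun y hy => ?_) fun y hy => ?_)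
          · by_contra hyB
            obtain ⟨z, hz, hzS⟩ : ∃ z ∈ A, z ∉ S := by
              by_contra! h
              exact h1 (hSA.antisymm h)
            have e1 := hcon s z (hSA hs) hz hs hzS
            have e2 := hcon y z (hSA hy) hz hy hzS
            tauto
          · by_contra hyS
            have e1 := hcon s y (hSA hs) (hBA hy) hs hyS
            tauto
        · refine h3 (Finset.Subset.antisymm (fun y hy => ?_) fun y hy => ?_)
          · refine Finset.mem_sdiff.2 ⟨hSA hy, fun hyB => ?_⟩
            obtain ⟨z, hz, hzS⟩ : ∃ z ∈ A, z ∉ S := by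
              by_contra! h
              exact h1 (hSA.antisymm h)
            have e1 := hcon s z (hSA hs) hz hs hzS
            have e2 := hcon y z (hSA hy) hz hy hzS
            tauto
          · rw [Finset.mem_sdiff] at hy
            by_contra hyS
            have e1 := hcon s y (hSA hs) hy.1 hs hyS
            tauto
      have hz : ∑ e ∈ B, (Pi.single x (1 : ℝ) - Pi.single y 1 : I → ℝ) e = 0 := by
        simp only [Pi.sub_apply, sum_single_sub_single]
        by_cases h : x ∈ B
        · simp [h, hxy.1 h]
        · rw [if_neg h, if_neg fun h' => h (hxy.2 h'), sub_zero]
      have := holdsGenerically_dual_ne_zero (A := A) (sumL S ∘ₗ splitFlowLinear W A B)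
        (Pi.single x 1 - Pi.single y 1) (hsupp hx hy)
        (by simp only [Pi.sub_apply, sum_single_sub_single]; simp [hx, hy])
        (by
          change sumL S (splitFlow W A B _) ≠ 0
          rw [hsumL, splitFlow_eq_self hz]
          simp only [Pi.sub_apply, sum_single_sub_single]; simp [hxS, hyS])
      have e : ∀ f, (sumL S ∘ₗ splitFlowLinear W A B) f = ∑ e ∈ S, splitFlow W A B f e :=
        fun f => hsumL S _
      simpa only [e] using this
    · exact (ih B hss.1).comp_splitFlow hBA (Or.inl rfl) fun f _ =>
        sum_splitFlow hW.antisymm hBA hp.ne'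
    · exact (ih _ hss.2).comp_splitFlow hss.2.1 (Or.inr Finset.sdiff_disjoint) fun f hf =>
        sum_splitFlow_sdiff hW.antisymm hBA hp.ne' hf

theorem exists_veryGeneric_mem (hW : IsGenericMatrix W) {A : Finset I} {f₀ : I → ℝ}
    (hf₀ : ∑ e ∈ A, f₀ e = 0) {U : Set (I → ℝ)} (hU : U ∈ 𝓝 f₀) :
    ∃ f ∈ U, ∑ e ∈ A, f e = 0 ∧ VeryGeneric W A f := by
  obtain ⟨Λ, h1, h2, h3⟩ := holdsGenerically_veryGeneric hW A
  let p : Submodule ℝ (I → ℝ) := LinearMap.ker (∑ e ∈ A, LinearMap.proj e : Module.Dual ℝ (I → ℝ))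
  have hp : ∀ g, g ∈ p ↔ ∑ e ∈ A, g e = 0 := fun g => by simp [p]
  obtain ⟨v, hv, hvU, hv'⟩ := exists_small_forall_dual_ne_zero p h1
    (fun l hl => by obtain ⟨g, -, g2, g3⟩ := h2 l hl; exact ⟨g, (hp g).2 g2, g3⟩) f₀ hU
  have hs : ∑ e ∈ A, (f₀ + v) e = 0 := by
    simp [Finset.sum_add_distrib, hf₀, (hp v).1 hv]
  exact ⟨f₀ + v, hvU, hs, h3 _ hs hv'⟩

end density

/-! ### Local constancy of the count -/

section continuity

open Filter Topology

variable {I R : Type*} [DecidableEq I] [CommRing R] {q : Finset I → Finset I → R}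
  {W W₀ : I → I → ℝ} {A B : Finset I} {f f₀ : I → ℝ}

/-- There is a binary tree with set of leaves `A` all of whose edge lengths are non-negative, and
whose splittings have `W(B, C) ≠ 0`. -/
def WeaklyRealizable (W : I → I → ℝ) (A : Finset I) (f : I → ℝ) : Prop :=
  A.card ≤ 1 ∨ ∃ B : Finset I, ∃ _h : B ⊆ A ∧ 0 < blockSum W B (A \ B), 0 ≤ ∑ e ∈ B, f e ∧
    WeaklyRealizable W B (splitFlow W A B f) ∧ WeaklyRealizable W (A \ B) (splitFlow W A B f)
termination_by A.card
decreasing_by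
  · exact Finset.card_lt_card (ssubset_of_blockSum_ne_zero _h.1 _h.2.ne').1
  · exact Finset.card_lt_card (ssubset_of_blockSum_ne_zero _h.1 _h.2.ne').2

/-- There is a tree as in `WeaklyRealizable` with an edge of length zero. -/
def Degenerate (W : I → I → ℝ) (A : Finset I) (f : I → ℝ) : Prop :=
  ∃ B : Finset I, ∃ _h : B ⊆ A ∧ 0 < blockSum W B (A \ B), 0 ≤ ∑ e ∈ B, f e ∧
    WeaklyRealizable W B (splitFlow W A B f) ∧ WeaklyRealizable W (A \ B) (splitFlow W A B f) ∧
    (∑ e ∈ B, f e = 0 ∨ Degenerate W B (splitFlow W A B f) ∨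
      Degenerate W (A \ B) (splitFlow W A B f))
termination_by A.card
decreasing_by
  · exact Finset.card_lt_card (ssubset_of_blockSum_ne_zero _h.1 _h.2.ne').1
  · exact Finset.card_lt_card (ssubset_of_blockSum_ne_zero _h.1 _h.2.ne').2

/-- The same notion when the length of the first edge may be any real number. -/
def RootedDegenerate (W : I → I → ℝ) (A : Finset I) (f : I → ℝ) : Prop :=
  ∃ B : Finset I, (B ⊆ A ∧ 0 < blockSum W B (A \ B)) ∧
    WeaklyRealizable W B (splitFlow W A B f) ∧ WeaklyRealizable W (A \ B) (splitFlow W A B f) ∧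
    (Degenerate W B (splitFlow W A B f) ∨ Degenerate W (A \ B) (splitFlow W A B f))

variable {X : Type*} {l : Filter X} {Wx : X → I → I → ℝ} {fx : X → I → ℝ}

theorem tendsto_blockSum (hW : Tendsto Wx l (𝓝 W₀)) (B C : Finset I) :
    Tendsto (fun x => blockSum (Wx x) B C) l (𝓝 (blockSum W₀ B C)) :=
  tendsto_finsetSum _ fun b _ => tendsto_finsetSum _ fun c _ =>
    tendsto_pi_nhds.1 (tendsto_pi_nhds.1 hW b) c

theorem tendsto_splitFlow (hW : Tendsto Wx l (𝓝 W₀)) (hf : Tendsto fx l (𝓝 f₀))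
    (h : blockSum W₀ B (A \ B) ≠ 0) :
    Tendsto (fun x => splitFlow (Wx x) A B (fx x)) l (𝓝 (splitFlow W₀ A B f₀)) := by
  refine tendsto_pi_nhds.2 fun e => ?_
  refine (tendsto_pi_nhds.1 hf e).sub (Tendsto.mul (Tendsto.div ?_ (tendsto_blockSum hW _ _) h) ?_)
  · exact tendsto_finsetSum _ fun b _ => tendsto_pi_nhds.1 hf b
  · exact tendsto_finsetSum _ fun c _ => tendsto_pi_nhds.1 (tendsto_pi_nhds.1 hW e) c

/-- `q` is trivial on the pairs of disjoint sets on which the antisymmetric matrix `W₀` vanishes. -/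
structure IsTrivialOnZeros (q : Finset I → Finset I → R) (W₀ : I → I → ℝ) : Prop where
  antisymm : ∀ a b, W₀ a b = -W₀ b a
  eq_one : ∀ B C : Finset I, B ≠ ∅ → C ≠ ∅ → Disjoint B C → blockSum W₀ B C = 0 → q B C = 1

theorem IsTrivialOnZeros.sub_eq_zero (h : IsTrivialOnZeros q W₀) {B C : Finset I} (hB : B ≠ ∅)
    (hC : C ≠ ∅) (hBC : Disjoint B C) (h0 : blockSum W₀ B C = 0) : q B C - q C B = 0 := by
  rw [h.eq_one B C hB hC hBC h0, h.eq_one C B hC hB hBC.symm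
    (by rw [blockSum_swap h.antisymm, h0, neg_zero]), sub_self]

/-- The contributions of splittings which are not possible for `W₀` disappear. -/
theorem IsTrivialOnZeros.eventually_zero (hq : IsTrivialOnZeros q W₀) (hW : Tendsto Wx l (𝓝 W₀))
    (h : ¬ 0 < blockSum W₀ B (A \ B)) :
    ∀ᶠ x in l, ¬ 0 < blockSum (Wx x) B (A \ B) ∨ q B (A \ B) - q (A \ B) B = 0 := by
  by_cases hB : B = ∅
  · exact Eventually.of_forall fun x => Or.inl (by simp [hB, blockSum])
  by_cases hC : A \ B = ∅
  · exact Eventually.of_forall fun x => Or.inl (by simp [hC, blockSum])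
  rcases (not_lt.1 h).lt_or_eq with h' | h'
  · filter_upwards [(tendsto_blockSum hW _ _).eventually_lt_const h'] with x hx
    exact Or.inl (not_lt.2 hx.le)
  · exact Eventually.of_forall fun x => Or.inr (hq.sub_eq_zero hB hC Finset.disjoint_sdiff h')

theorem tendsto_sum_moments (hf : Tendsto fx l (𝓝 f₀)) (B : Finset I) :
    Tendsto (fun x => ∑ e ∈ B, fx x e) l (𝓝 (∑ e ∈ B, f₀ e)) :=
  tendsto_finsetSum _ fun b _ => tendsto_pi_nhds.1 hf b

/-- The count vanishes near moments which are not the limit of moments of trees. -/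
theorem eventually_treeSum_eq_zero (hq : IsTrivialOnZeros q W₀) (hW : Tendsto Wx l (𝓝 W₀))
    (hf : Tendsto fx l (𝓝 f₀)) (h : ¬ WeaklyRealizable W₀ A f₀) :
    ∀ᶠ x in l, treeSum (Wx x) q A (fx x) = 0 := by
  classical
  induction A using Finset.strongInduction generalizing f₀ fx with
  | H A ih =>
    rw [WeaklyRealizable] at h
    push Not at h
    obtain ⟨hA, h⟩ := h
    have key : ∀ B ∈ A.powerset, ∀ᶠ x in l,
        (if 0 < blockSum (Wx x) B (A \ B) ∧ 0 < ∑ e ∈ B, fx x e then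
          (q B (A \ B) - q (A \ B) B) * treeSum (Wx x) q B (splitFlow (Wx x) A B (fx x)) *
          treeSum (Wx x) q (A \ B) (splitFlow (Wx x) A B (fx x)) else 0) = 0 := by
      intro B hB
      have hBA := Finset.mem_powerset.1 hB
      by_cases hp : 0 < blockSum W₀ B (A \ B)
      · have hss := ssubset_of_blockSum_ne_zero hBA hp.ne'
        have hflow := tendsto_splitFlow hW hf hp.ne'
        by_cases h0 : 0 ≤ ∑ e ∈ B, f₀ e
        · by_cases hwB : WeaklyRealizable W₀ B (splitFlow W₀ A B f₀)
          · filter_upwards [ih _ hss.2 hflow (h B ⟨hBA, hp⟩ h0 hwB)] with x hx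
            simp [hx]
          · filter_upwards [ih _ hss.1 hflow hwB] with x hx
            simp [hx]
        · filter_upwards [(tendsto_sum_moments hf B).eventually_lt_const (not_le.1 h0)] with x hx
          rw [if_neg fun h' => absurd h'.2 (not_lt.2 hx.le)]
      · filter_upwards [hq.eventually_zero hW hp] with x hx
        rcases hx with hx | hx
        · rw [if_neg fun h' => hx h'.1]
        · simp [hx]
    filter_upwards [(Finset.eventually_all _).2 key] with x hx
    rw [treeSum_eq (by omega)]
    exact Finset.sum_eq_zero hx

theorem treeSum_eq_zero (hq : IsTrivialOnZeros q W₀) (h : ¬ WeaklyRealizable W₀ A f₀) :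
    treeSum W₀ q A f₀ = 0 := by
  have := eventually_treeSum_eq_zero (l := pure ()) (Wx := fun _ => W₀) (fx := fun _ => f₀) hq
    tendsto_const_nhds tendsto_const_nhds h
  simpa using this

/-- The count of binary trees is locally constant in the matrix and the moments, as long as no
edge is contracted. -/
theorem eventually_treeSum_eq (hq : IsTrivialOnZeros q W₀) (hW : Tendsto Wx l (𝓝 W₀))
    (hf : Tendsto fx l (𝓝 f₀)) (h : ¬ Degenerate W₀ A f₀) :
    ∀ᶠ x in l, treeSum (Wx x) q A (fx x) = treeSum W₀ q A f₀ := by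
  classical
  induction A using Finset.strongInduction generalizing f₀ fx with
  | H A ih =>
    rcases Nat.lt_or_ge A.card 2 with hA | hA
    · refine Eventually.of_forall fun x => ?_
      rw [treeSum_of_card_le (by omega), treeSum_of_card_le (by omega)]
    rw [Degenerate] at h
    push Not at h
    have key : ∀ B ∈ A.powerset, ∀ᶠ x in l,
        (if 0 < blockSum (Wx x) B (A \ B) ∧ 0 < ∑ e ∈ B, fx x e then
          (q B (A \ B) - q (A \ B) B) * treeSum (Wx x) q B (splitFlow (Wx x) A B (fx x)) *
          treeSum (Wx x) q (A \ B) (splitFlow (Wx x) A B (fx x)) else 0) =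
        (if 0 < blockSum W₀ B (A \ B) ∧ 0 < ∑ e ∈ B, f₀ e then
          (q B (A \ B) - q (A \ B) B) * treeSum W₀ q B (splitFlow W₀ A B f₀) *
          treeSum W₀ q (A \ B) (splitFlow W₀ A B f₀) else 0) := by
      intro B hB
      have hBA := Finset.mem_powerset.1 hB
      by_cases hp : 0 < blockSum W₀ B (A \ B)
      · have hss := ssubset_of_blockSum_ne_zero hBA hp.ne'
        have hflow := tendsto_splitFlow hW hf hp.ne'
        by_cases hwB : WeaklyRealizable W₀ B (splitFlow W₀ A B f₀)
        · by_cases hwC : WeaklyRealizable W₀ (A \ B) (splitFlow W₀ A B f₀)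
          · rcases lt_or_ge (∑ e ∈ B, f₀ e) 0 with h0 | h0
            · filter_upwards [(tendsto_sum_moments hf B).eventually_lt_const h0] with x hx
              rw [if_neg fun h' => absurd h'.2 (not_lt.2 hx.le),
                if_neg fun h' => absurd h'.2 (not_lt.2 h0.le)]
            · obtain ⟨h1, h2, h3⟩ := h B ⟨hBA, hp⟩ h0 hwB hwC
              have h4 : 0 < ∑ e ∈ B, f₀ e := lt_of_le_of_ne h0 (Ne.symm h1)
              filter_upwards [(tendsto_sum_moments hf B).eventually_const_lt h4,
                (tendsto_blockSum hW B (A \ B)).eventually_const_lt hp,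
                ih _ hss.1 hflow h2, ih _ hss.2 hflow h3] with x e1 e2 e3 e4
              rw [if_pos ⟨e2, e1⟩, if_pos ⟨hp, h4⟩, e3, e4]
          · filter_upwards [eventually_treeSum_eq_zero hq hW hflow hwC] with x hx
            simp [hx, treeSum_eq_zero hq hwC]
        · filter_upwards [eventually_treeSum_eq_zero hq hW hflow hwB] with x hx
          simp [hx, treeSum_eq_zero hq hwB]
      · filter_upwards [hq.eventually_zero hW hp] with x hx
        rcases hx with hx | hx
        · rw [if_neg fun h' => hx h'.1, if_neg fun h' => hp h'.1]
        · simp [hx]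
    filter_upwards [(Finset.eventually_all _).2 key] with x hx
    rw [treeSum_eq hA, treeSum_eq hA]
    exact Finset.sum_congr rfl hx

theorem eventually_rootedTreeSum_eq (hq : IsTrivialOnZeros q W₀) (hW : Tendsto Wx l (𝓝 W₀))
    (hf : Tendsto fx l (𝓝 f₀)) (h : ¬ RootedDegenerate W₀ A f₀) :
    ∀ᶠ x in l, rootedTreeSum (Wx x) q A (fx x) = rootedTreeSum W₀ q A f₀ := by
  classical
  unfold RootedDegenerate at h
  push Not at h
  have key : ∀ B ∈ A.powerset, ∀ᶠ x in l,
      (if 0 < blockSum (Wx x) B (A \ B) then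
        (q B (A \ B) - q (A \ B) B) * treeSum (Wx x) q B (splitFlow (Wx x) A B (fx x)) *
        treeSum (Wx x) q (A \ B) (splitFlow (Wx x) A B (fx x)) else 0) =
      (if 0 < blockSum W₀ B (A \ B) then
        (q B (A \ B) - q (A \ B) B) * treeSum W₀ q B (splitFlow W₀ A B f₀) *
        treeSum W₀ q (A \ B) (splitFlow W₀ A B f₀) else 0) := by
    intro B hB
    have hBA := Finset.mem_powerset.1 hB
    by_cases hp : 0 < blockSum W₀ B (A \ B)
    · have hflow := tendsto_splitFlow hW hf hp.ne'
      by_cases hwB : WeaklyRealizable W₀ B (splitFlow W₀ A B f₀)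
      · by_cases hwC : WeaklyRealizable W₀ (A \ B) (splitFlow W₀ A B f₀)
        · obtain ⟨h2, h3⟩ := h B ⟨hBA, hp⟩ hwB hwC
          filter_upwards [(tendsto_blockSum hW B (A \ B)).eventually_const_lt hp,
            eventually_treeSum_eq hq hW hflow h2, eventually_treeSum_eq hq hW hflow h3]
            with x e2 e3 e4
          rw [if_pos e2, if_pos hp, e3, e4]
        · filter_upwards [eventually_treeSum_eq_zero hq hW hflow hwC] with x hx
          simp [hx, treeSum_eq_zero hq hwC]
      · filter_upwards [eventually_treeSum_eq_zero hq hW hflow hwB] with x hx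
        simp [hx, treeSum_eq_zero hq hwB]
    · filter_upwards [hq.eventually_zero hW hp] with x hx
      rw [if_neg hp]
      rcases hx with hx | hx
      · rw [if_neg hx]
      · simp [hx]
  filter_upwards [(Finset.eventually_all _).2 key] with x hx
  exact Finset.sum_congr rfl hx

/-- For generic matrices near `W₀` and very generic moments, the count of rooted binary trees is
the one for `W₀` and any moments for which no edge is contracted. -/
theorem eventually_forall_rootedTreeSum_eq [Fintype I] (hq : IsTrivialOnZeros q W₀)
    (hq' : IsBichar q) (hA : 2 ≤ A.card) (hf₀ : ∑ e ∈ A, f₀ e = 0)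
    (h : ¬ RootedDegenerate W₀ A f₀) :
    ∀ᶠ W in 𝓝 W₀, IsGenericMatrix W → ∀ f, ∑ e ∈ A, f e = 0 → VeryGeneric W A f →
      rootedTreeSum W q A f = rootedTreeSum W₀ q A f₀ := by
  have h1 := eventually_rootedTreeSum_eq (l := 𝓝 W₀ ×ˢ 𝓝 f₀) (Wx := Prod.fst) (fx := Prod.snd)
    hq tendsto_fst tendsto_snd h
  obtain ⟨pa, ha, pb, hb, hab⟩ := Filter.eventually_prod_iff.1 h1
  filter_upwards [ha] with W hWa hW f hf hv
  obtain ⟨c, hc⟩ := exists_rootedTreeSum_eq (R := R) hW hq' A hA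
  obtain ⟨f', hf'U, hf', hv'⟩ := exists_veryGeneric_mem hW hf₀ hb
  rw [hc f hf hv, ← hc f' hf' hv']
  exact hab hWa hf'U

/-- If `q` is trivial on the pairs which contain a given leaf, then the count vanishes. -/
theorem treeSum_eq_zero_of_leaf {e : I} (h : ∀ B, q {e} B = 1 ∧ q B {e} = 1) (he : e ∈ A)
    (hA : 2 ≤ A.card) : treeSum W q A f = 0 := by
  classical
  induction A using Finset.strongInduction generalizing f with
  | H A ih =>
    rw [treeSum_eq hA]
    refine Finset.sum_eq_zero fun B hB => ?_
    have hBA := Finset.mem_powerset.1 hB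
    split_ifs with hp
    · have hss := ssubset_of_blockSum_ne_zero hBA hp.1.ne'
      by_cases heB : e ∈ B
      · rcases Nat.lt_or_ge B.card 2 with h1 | h1
        · obtain rfl : B = {e} := by
            refine (Finset.eq_of_subset_of_card_le (Finset.singleton_subset_iff.2 heB) ?_).symm
            rw [Finset.card_singleton]; omega
          simp [h]
        · simp [ih B hss.1 heB h1]
      · have heC : e ∈ A \ B := Finset.mem_sdiff.2 ⟨he, heB⟩
        rcases Nat.lt_or_ge (A \ B).card 2 with h1 | h1
        · have h2 : A \ B = {e} := by
            refine (Finset.eq_of_subset_of_card_le (Finset.singleton_subset_iff.2 heC) ?_).symm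
            rw [Finset.card_singleton]; omega
          simp [h2, h]
        · simp [ih _ hss.2 heC h1]
    · rfl

theorem rootedTreeSum_eq_zero_of_leaf {e : I} (h : ∀ B, q {e} B = 1 ∧ q B {e} = 1) (he : e ∈ A) :
    rootedTreeSum W q A f = 0 := by
  classical
  refine Finset.sum_eq_zero fun B hB => ?_
  have hBA := Finset.mem_powerset.1 hB
  split_ifs with hp
  · by_cases heB : e ∈ B
    · rcases Nat.lt_or_ge B.card 2 with h1 | h1
      · obtain rfl : B = {e} := by
          refine (Finset.eq_of_subset_of_card_le (Finset.singleton_subset_iff.2 heB) ?_).symm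
          rw [Finset.card_singleton]; omega
        simp [h]
      · simp [treeSum_eq_zero_of_leaf h heB h1]
    · have heC : e ∈ A \ B := Finset.mem_sdiff.2 ⟨he, heB⟩
      rcases Nat.lt_or_ge (A \ B).card 2 with h1 | h1
      · have h2 : A \ B = {e} := by
          refine (Finset.eq_of_subset_of_card_le (Finset.singleton_subset_iff.2 heC) ?_).symm
          rw [Finset.card_singleton]; omega
        simp [h2, h]
      · simp [treeSum_eq_zero_of_leaf h heC h1]
  · rfl

end continuity

/-! ### Binary trees as families of sets -/

section hierarchy

variable {I R : Type*} [DecidableEq I] [CommRing R] {q : Finset I → Finset I → R}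
  {W : I → I → ℝ} {A B H : Finset I} {f : I → ℝ} {𝓗 X Y : Finset (Finset I)}
  {l l₁ l₂ : Finset I → ℝ}

/-- A member of the hierarchy or a leaf. -/
def IsBlock (𝓗 : Finset (Finset I)) (B : Finset I) : Prop := B ∈ 𝓗 ∨ B.card = 1

/-- A rooted binary tree with set of leaves `A`, described by the sets of leaves below its inner
vertices, the root being at the top. -/
structure IsBinary (A : Finset I) (𝓗 : Finset (Finset I)) : Prop where
  subset : ∀ H ∈ 𝓗, H ⊆ A
  two_le : ∀ H ∈ 𝓗, 2 ≤ H.card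
  top : IsBlock 𝓗 A
  laminar : ∀ H ∈ 𝓗, ∀ H' ∈ 𝓗, H ⊆ H' ∨ H' ⊆ H ∨ Disjoint H H'
  split : ∀ H ∈ 𝓗, ∃ B ⊆ H, B ≠ ∅ ∧ B ≠ H ∧ IsBlock 𝓗 B ∧ IsBlock 𝓗 (H \ B)

/-- The moments `f` are those of a tree with vertices `𝓗`, where `l H` is the length of the edge at
the top of the vertex `H`. -/
def Realizes (W : I → I → ℝ) (A : Finset I) (f : I → ℝ) (𝓗 : Finset (Finset I))
    (l : Finset I → ℝ) : Prop :=
  ∀ e ∈ A, f e = ∑ H ∈ 𝓗 with e ∈ H, l H * ∑ a ∈ H, W e a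

open scoped Classical in
/-- The factor of the weight of a binary tree at a vertex; the sum has at most one non-zero term. -/
def vertexWeight (W : I → I → ℝ) (q : Finset I → Finset I → R) (𝓗 : Finset (Finset I))
    (H : Finset I) : R :=
  ∑ B ∈ H.powerset, if IsBlock 𝓗 B ∧ IsBlock 𝓗 (H \ B) ∧ 0 < blockSum W B (H \ B) then
    q B (H \ B) - q (H \ B) B else 0

theorem IsBinary.laminar_block (h : IsBinary A 𝓗) (hB : IsBlock 𝓗 B) (hH : H ∈ 𝓗) :
    H ⊆ B ∨ B ⊆ H ∨ Disjoint H B := by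
  rcases hB with hB | hB
  · exact h.laminar H hH B hB
  · obtain ⟨b, rfl⟩ := Finset.card_eq_one.1 hB
    by_cases hb : b ∈ H
    · exact Or.inr (Or.inl (Finset.singleton_subset_iff.2 hb))
    · exact Or.inr (Or.inr (Finset.disjoint_singleton_right.2 hb))

theorem IsBinary.eq_or_subset (h : IsBinary A 𝓗) (hBA : B ⊆ A)
    (hB : IsBlock 𝓗 B) (hC : IsBlock 𝓗 (A \ B)) (hH : H ∈ 𝓗) : H = A ∨ H ⊆ B ∨ H ⊆ A \ B := by
  have hHA := h.subset H hH
  rcases h.laminar_block hB hH with h1 | h1 | h1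
  · exact Or.inr (Or.inl h1)
  · rcases h.laminar_block hC hH with h2 | h2 | h2
    · exact Or.inr (Or.inr h2)
    · left
      refine hHA.antisymm ?_
      rw [← Finset.union_sdiff_of_subset hBA]
      exact Finset.union_subset h1 h2
    · right; left
      intro x hx
      by_contra hxB
      exact Finset.disjoint_left.1 h2 hx (Finset.mem_sdiff.2 ⟨hHA hx, hxB⟩)
  · right; right
    exact fun x hx => Finset.mem_sdiff.2 ⟨hHA hx, Finset.disjoint_left.1 h1 hx⟩

theorem IsBinary.nonempty (h : IsBinary A 𝓗) (hH : H ∈ 𝓗) : H.Nonempty :=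
  Finset.card_pos.1 (by have := h.two_le H hH; omega)

theorem isBlock_filter {S : Finset I} (hBS : B ⊆ S) (hB : IsBlock 𝓗 B) :
    IsBlock (𝓗.filter (· ⊆ S)) B :=
  hB.imp_left fun h => Finset.mem_filter.2 ⟨h, hBS⟩

theorem IsBinary.filter (h : IsBinary A 𝓗) (hB : IsBlock 𝓗 B) :
    IsBinary B (𝓗.filter (· ⊆ B)) where
  subset H hH := (Finset.mem_filter.1 hH).2
  two_le H hH := h.two_le H (Finset.mem_filter.1 hH).1
  top := isBlock_filter subset_rfl hB
  laminar H hH H' hH' := h.laminar H (Finset.mem_filter.1 hH).1 H' (Finset.mem_filter.1 hH').1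
  split H hH := by
    obtain ⟨D, hD, h0, h1, h2, h3⟩ := h.split H (Finset.mem_filter.1 hH).1
    have hHB := (Finset.mem_filter.1 hH).2
    exact ⟨D, hD, h0, h1, isBlock_filter (hD.trans hHB) h2,
      isBlock_filter (Finset.sdiff_subset.trans hHB) h3⟩

theorem IsBlock.mono (h : X ⊆ 𝓗) (hB : IsBlock X B) : IsBlock 𝓗 B := hB.imp_left fun h' => h h'

theorem subset_insert_union_left : X ⊆ insert A (X ∪ Y) :=
  Finset.subset_union_left.trans (Finset.subset_insert _ _)

theorem subset_insert_union_right : Y ⊆ insert A (X ∪ Y) :=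
  Finset.subset_union_right.trans (Finset.subset_insert _ _)

/-- Two binary trees can be grafted on a common root. -/
theorem IsBinary.graft (hBA : B ⊆ A) (hB0 : B ≠ ∅) (hC0 : A \ B ≠ ∅) (hX : IsBinary B X)
    (hY : IsBinary (A \ B) Y) : IsBinary A (insert A (X ∪ Y)) where
  subset H hH := by
    rcases Finset.mem_insert.1 hH with rfl | hH
    · exact subset_rfl
    · rcases Finset.mem_union.1 hH with hH | hH
      · exact (hX.subset H hH).trans hBA
      · exact (hY.subset H hH).trans Finset.sdiff_subset
  two_le H hH := by
    rcases Finset.mem_insert.1 hH with rfl | hH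
    · have h1 := Finset.card_pos.2 (Finset.nonempty_iff_ne_empty.2 hB0)
      have h2 := Finset.card_pos.2 (Finset.nonempty_iff_ne_empty.2 hC0)
      have := Finset.card_sdiff_add_card_eq_card hBA
      omega
    · exact (Finset.mem_union.1 hH).elim (hX.two_le H) (hY.two_le H)
  top := Or.inl (Finset.mem_insert_self _ _)
  laminar H hH H' hH' := by
    have key : ∀ H ∈ insert A (X ∪ Y), H ⊆ A := fun H hH => by
      rcases Finset.mem_insert.1 hH with rfl | hH
      · exact subset_rfl
      · rcases Finset.mem_union.1 hH with hH | hH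
        · exact (hX.subset H hH).trans hBA
        · exact (hY.subset H hH).trans Finset.sdiff_subset
    have h1 := key H hH
    have h2 := key H' hH'
    rcases Finset.mem_insert.1 hH with rfl | hH
    · exact Or.inr (Or.inl h2)
    rcases Finset.mem_insert.1 hH' with rfl | hH'
    · exact Or.inl h1
    rcases Finset.mem_union.1 hH with hH | hH <;> rcases Finset.mem_union.1 hH' with hH' | hH'
    · exact hX.laminar H hH H' hH'
    · exact Or.inr (Or.inr (Finset.disjoint_of_subset_left (hX.subset H hH)
        (Finset.disjoint_of_subset_right (hY.subset H' hH') Finset.disjoint_sdiff)))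
    · exact Or.inr (Or.inr (Finset.disjoint_of_subset_left (hY.subset H hH)
        (Finset.disjoint_of_subset_right (hX.subset H' hH') Finset.sdiff_disjoint)))
    · exact hY.laminar H hH H' hH'
  split H hH := by
    rcases Finset.mem_insert.1 hH with rfl | hH
    · refine ⟨B, hBA, hB0, fun h => hC0 (by simp [h]), hX.top.mono subset_insert_union_left,
        hY.top.mono subset_insert_union_right⟩
    rcases Finset.mem_union.1 hH with hH | hH
    · obtain ⟨D, hD, h0, h1, h2, h3⟩ := hX.split H hH
      exact ⟨D, hD, h0, h1, h2.mono subset_insert_union_left, h3.mono subset_insert_union_left⟩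
    · obtain ⟨D, hD, h0, h1, h2, h3⟩ := hY.split H hH
      exact ⟨D, hD, h0, h1, h2.mono subset_insert_union_right, h3.mono subset_insert_union_right⟩

theorem IsBinary.ne_of_mem_of_disjoint (hX : IsBinary B X) (hH : H ∈ X) {C : Finset I}
    (hBC : Disjoint B C) : ¬ H ⊆ C := fun h => by
  obtain ⟨x, hx⟩ := hX.nonempty hH
  exact Finset.disjoint_left.1 hBC (hX.subset H hH hx) (h hx)

theorem IsBinary.filter_graft_left (hC0 : A \ B ≠ ∅) (hX : IsBinary B X)
    (hY : IsBinary (A \ B) Y) : (insert A (X ∪ Y)).filter (· ⊆ B) = X := by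
  ext H
  simp only [Finset.mem_filter, Finset.mem_insert, Finset.mem_union]
  constructor
  · rintro ⟨rfl | h | h, h'⟩
    · exact absurd (Finset.sdiff_eq_empty_iff_subset.2 h') hC0
    · exact h
    · exact absurd h' (hY.ne_of_mem_of_disjoint h Finset.sdiff_disjoint)
  · exact fun h => ⟨Or.inr (Or.inl h), hX.subset H h⟩

theorem IsBinary.filter_graft_right (hBA : B ⊆ A) (hB0 : B ≠ ∅) (hX : IsBinary B X)
    (hY : IsBinary (A \ B) Y) : (insert A (X ∪ Y)).filter (· ⊆ A \ B) = Y := by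
  ext H
  simp only [Finset.mem_filter, Finset.mem_insert, Finset.mem_union]
  constructor
  · rintro ⟨rfl | h | h, h'⟩
    · refine absurd (Finset.subset_empty.1 fun x hx => ?_) hB0
      exact absurd hx (Finset.mem_sdiff.1 (h' (hBA hx))).2
    · exact absurd h' (hX.ne_of_mem_of_disjoint h Finset.disjoint_sdiff)
    · exact h
  · exact fun h => ⟨Or.inr (Or.inr h), hY.subset H h⟩

theorem IsBinary.eq_graft (h : IsBinary A 𝓗) (hBA : B ⊆ A) (hB0 : B ≠ ∅) (hC0 : A \ B ≠ ∅)
    (hB : IsBlock 𝓗 B) (hC : IsBlock 𝓗 (A \ B)) :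
    insert A (𝓗.filter (· ⊆ B) ∪ 𝓗.filter (· ⊆ A \ B)) = 𝓗 := by
  have hA : A ∈ 𝓗 := by
    refine h.top.resolve_right fun hA => ?_
    have h1 := Finset.card_pos.2 (Finset.nonempty_iff_ne_empty.2 hB0)
    have h2 := Finset.card_pos.2 (Finset.nonempty_iff_ne_empty.2 hC0)
    have := Finset.card_sdiff_add_card_eq_card hBA
    omega
  ext H
  simp only [Finset.mem_filter, Finset.mem_insert, Finset.mem_union]
  constructor
  · rintro (rfl | h | h)
    · exact hA
    · exact h.1
    · exact h.1
  · intro hH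
    rcases h.eq_or_subset hBA hB hC hH with h' | h' | h'
    · exact Or.inl h'
    · exact Or.inr (Or.inl ⟨hH, h'⟩)
    · exact Or.inr (Or.inr ⟨hH, h'⟩)

theorem IsBinary.disjoint_graft (hX : IsBinary B X) (hY : IsBinary (A \ B) Y) : Disjoint X Y :=
  Finset.disjoint_left.2 fun _ h h' =>
    hX.ne_of_mem_of_disjoint h Finset.disjoint_sdiff (hY.subset _ h')

theorem IsBinary.notMem_graft (hBA : B ⊆ A) (hB0 : B ≠ ∅) (hC0 : A \ B ≠ ∅) (hX : IsBinary B X)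
    (hY : IsBinary (A \ B) Y) : A ∉ X ∪ Y := by
  rw [Finset.mem_union, not_or]
  refine ⟨fun h => hC0 (Finset.sdiff_eq_empty_iff_subset.2 (hX.subset A h)), fun h => hB0 ?_⟩
  exact Finset.subset_empty.1 fun x hx => absurd hx (Finset.mem_sdiff.1 (hY.subset A h (hBA hx))).2

theorem vertexWeight_congr (h : ∀ B ⊆ H, (IsBlock X B ↔ IsBlock Y B)) :
    vertexWeight W q X H = vertexWeight W q Y H := by
  classical
  refine Finset.sum_congr rfl fun B hB => ?_
  rw [h B (Finset.mem_powerset.1 hB), h (H \ B) Finset.sdiff_subset]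

theorem IsBinary.isBlock_graft_left (hC0 : A \ B ≠ ∅) (hX : IsBinary B X)
    (hY : IsBinary (A \ B) Y) {D : Finset I} (hD : D ⊆ B) :
    IsBlock (insert A (X ∪ Y)) D ↔ IsBlock X D := by
  refine ⟨fun h => ?_, fun h => h.mono subset_insert_union_left⟩
  have := isBlock_filter hD h
  rwa [hX.filter_graft_left hC0 hY] at this

theorem IsBinary.isBlock_graft_right (hBA : B ⊆ A) (hB0 : B ≠ ∅)
    (hX : IsBinary B X) (hY : IsBinary (A \ B) Y) {D : Finset I} (hD : D ⊆ A \ B) :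
    IsBlock (insert A (X ∪ Y)) D ↔ IsBlock Y D := by
  refine ⟨fun h => ?_, fun h => h.mono subset_insert_union_right⟩
  have := isBlock_filter hD h
  rwa [hX.filter_graft_right hBA hB0 hY] at this

theorem prod_vertexWeight_graft (hBA : B ⊆ A) (hB0 : B ≠ ∅) (hC0 : A \ B ≠ ∅) (hX : IsBinary B X)
    (hY : IsBinary (A \ B) Y) :
    ∏ H ∈ (insert A (X ∪ Y)).erase A, vertexWeight W q (insert A (X ∪ Y)) H =
      (∏ H ∈ X, vertexWeight W q X H) * ∏ H ∈ Y, vertexWeight W q Y H := by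
  rw [Finset.erase_insert (hX.notMem_graft hBA hB0 hC0 hY),
    Finset.prod_union (hX.disjoint_graft hY)]
  congr 1
  · exact Finset.prod_congr rfl fun H hH => vertexWeight_congr fun D hD =>
      hX.isBlock_graft_left hC0 hY (hD.trans (hX.subset H hH))
  · exact Finset.prod_congr rfl fun H hH => vertexWeight_congr fun D hD =>
      hX.isBlock_graft_right hBA hB0 hY (hD.trans (hY.subset H hH))

theorem sum_filter_graft_left (hBA : B ⊆ A) (hB0 : B ≠ ∅) (hC0 : A \ B ≠ ∅) (hX : IsBinary B X)
    (hY : IsBinary (A \ B) Y) (g : Finset I → ℝ) {e : I} (he : e ∈ B) :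
    ∑ H ∈ insert A (X ∪ Y) with e ∈ H, g H = g A + ∑ H ∈ X with e ∈ H, g H := by
  have h1 : (insert A (X ∪ Y)).filter (e ∈ ·) = insert A (X.filter (e ∈ ·)) := by
    ext H
    simp only [Finset.mem_filter, Finset.mem_insert, Finset.mem_union]
    constructor
    · rintro ⟨rfl | h | h, h'⟩
      · exact Or.inl rfl
      · exact Or.inr ⟨h, h'⟩
      · exact absurd he (Finset.mem_sdiff.1 (hY.subset H h h')).2
    · rintro (rfl | h)
      · exact ⟨Or.inl rfl, hBA he⟩
      · exact ⟨Or.inr (Or.inl h.1), h.2⟩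
  rw [h1, Finset.sum_insert]
  exact fun h => hX.notMem_graft hBA hB0 hC0 hY (Finset.mem_union_left _ (Finset.mem_filter.1 h).1)

theorem sum_filter_graft_right (hBA : B ⊆ A) (hB0 : B ≠ ∅) (hC0 : A \ B ≠ ∅) (hX : IsBinary B X)
    (hY : IsBinary (A \ B) Y) (g : Finset I → ℝ) {e : I} (he : e ∈ A \ B) :
    ∑ H ∈ insert A (X ∪ Y) with e ∈ H, g H = g A + ∑ H ∈ Y with e ∈ H, g H := by
  have h1 : (insert A (X ∪ Y)).filter (e ∈ ·) = insert A (Y.filter (e ∈ ·)) := by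
    ext H
    simp only [Finset.mem_filter, Finset.mem_insert, Finset.mem_union]
    constructor
    · rintro ⟨rfl | h | h, h'⟩
      · exact Or.inl rfl
      · exact absurd (hX.subset H h h') (Finset.mem_sdiff.1 he).2
      · exact Or.inr ⟨h, h'⟩
    · rintro (rfl | h)
      · exact ⟨Or.inl rfl, (Finset.mem_sdiff.1 he).1⟩
      · exact ⟨Or.inr (Or.inr h.1), h.2⟩
  rw [h1, Finset.sum_insert]
  exact fun h => hX.notMem_graft hBA hB0 hC0 hY (Finset.mem_union_right _ (Finset.mem_filter.1 h).1)

/-- The total moment of `S` does not see the edges that lead to subsets of `S`. -/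
theorem Realizes.sum_eq_zero (hW : ∀ a b, W a b = -W b a) (h : Realizes W A f 𝓗 l)
    (hs : ∀ H ∈ 𝓗, H ⊆ A) : ∑ e ∈ A, f e = 0 := by
  rw [Finset.sum_congr rfl h]
  simp_rw [Finset.sum_filter]
  rw [Finset.sum_comm]
  refine Finset.sum_eq_zero fun H hH => ?_
  rw [← Finset.sum_filter, Finset.filter_mem_eq_inter, Finset.inter_eq_right.2 (hs H hH),
    ← Finset.mul_sum]
  have := blockSum_self hW H
  unfold blockSum at this
  rw [this, mul_zero]

theorem Realizes.flow_left (hBA : B ⊆ A) (hB0 : B ≠ ∅) (hC0 : A \ B ≠ ∅) (hX : IsBinary B X)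
    (hY : IsBinary (A \ B) Y) (h : Realizes W A f (insert A (X ∪ Y)) l) :
    Realizes W B (flow W A (l A) f) X l := fun e he => by
  rw [flow, h e (hBA he),
    sum_filter_graft_left hBA hB0 hC0 hX hY (fun H => l H * ∑ a ∈ H, W e a) he]
  ring

theorem Realizes.flow_right (hBA : B ⊆ A) (hB0 : B ≠ ∅) (hC0 : A \ B ≠ ∅) (hX : IsBinary B X)
    (hY : IsBinary (A \ B) Y) (h : Realizes W A f (insert A (X ∪ Y)) l) :
    Realizes W (A \ B) (flow W A (l A) f) Y l := fun e he => by
  rw [flow, h e (Finset.mem_sdiff.1 he).1,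
    sum_filter_graft_right hBA hB0 hC0 hX hY (fun H => l H * ∑ a ∈ H, W e a) he]
  ring

/-- The length of the first edge is determined by the moments. -/
theorem Realizes.length_eq (hW : ∀ a b, W a b = -W b a) (hBA : B ⊆ A)
    (hp : blockSum W B (A \ B) ≠ 0) (hX : IsBinary B X)
    (hY : IsBinary (A \ B) Y) (h : Realizes W A f (insert A (X ∪ Y)) l) :
    l A = (∑ e ∈ B, f e) / blockSum W B (A \ B) := by
  have hne := nonempty_of_blockSum_ne_zero hp
  have := (h.flow_left hBA hne.1 hne.2 hX hY).sum_eq_zero hW hX.subset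
  rw [sum_flow, blockSum_of_subset hW hBA] at this
  rw [eq_div_iff hp]
  linarith

/-- The lengths of the edges of a grafted tree. -/
def graftLength (A B : Finset I) (t : ℝ) (l₁ l₂ : Finset I → ℝ) (H : Finset I) : ℝ :=
  if H = A then t else if H ⊆ B then l₁ H else l₂ H

theorem graftLength_self (t : ℝ) : graftLength A B t l₁ l₂ A = t := if_pos rfl

theorem graftLength_left (hBA : B ⊆ A) (hB0 : B ≠ ∅) (hC0 : A \ B ≠ ∅) (hX : IsBinary B X)
    (hY : IsBinary (A \ B) Y) (t : ℝ) (hH : H ∈ X) : graftLength A B t l₁ l₂ H = l₁ H := by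
  rw [graftLength, if_neg, if_pos (hX.subset H hH)]
  rintro rfl
  exact hX.notMem_graft hBA hB0 hC0 hY (Finset.mem_union_left _ hH)

theorem graftLength_right (hBA : B ⊆ A) (hB0 : B ≠ ∅) (hC0 : A \ B ≠ ∅) (hX : IsBinary B X)
    (hY : IsBinary (A \ B) Y) (t : ℝ) (hH : H ∈ Y) : graftLength A B t l₁ l₂ H = l₂ H := by
  rw [graftLength, if_neg, if_neg (hY.ne_of_mem_of_disjoint hH Finset.sdiff_disjoint)]
  rintro rfl
  exact hX.notMem_graft hBA hB0 hC0 hY (Finset.mem_union_right _ hH)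

theorem Realizes.graft (hBA : B ⊆ A) (hB0 : B ≠ ∅) (hC0 : A \ B ≠ ∅) (hX : IsBinary B X)
    (hY : IsBinary (A \ B) Y) {t : ℝ} (h1 : Realizes W B (flow W A t f) X l₁)
    (h2 : Realizes W (A \ B) (flow W A t f) Y l₂) :
    Realizes W A f (insert A (X ∪ Y)) (graftLength A B t l₁ l₂) := by
  intro e he
  by_cases heB : e ∈ B
  · rw [sum_filter_graft_left hBA hB0 hC0 hX hY
      (fun H => graftLength A B t l₁ l₂ H * ∑ a ∈ H, W e a) heB, graftLength_self]
    have e2 : ∑ H ∈ X with e ∈ H, graftLength A B t l₁ l₂ H * ∑ a ∈ H, W e a =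
        ∑ H ∈ X with e ∈ H, l₁ H * ∑ a ∈ H, W e a := Finset.sum_congr rfl fun H hH => by
      rw [graftLength_left hBA hB0 hC0 hX hY t (Finset.mem_filter.1 hH).1]
    rw [e2, ← h1 e heB, flow]
    ring
  · have heC := Finset.mem_sdiff.2 ⟨he, heB⟩
    rw [sum_filter_graft_right hBA hB0 hC0 hX hY
      (fun H => graftLength A B t l₁ l₂ H * ∑ a ∈ H, W e a) heC, graftLength_self]
    have e2 : ∑ H ∈ Y with e ∈ H, graftLength A B t l₁ l₂ H * ∑ a ∈ H, W e a =
        ∑ H ∈ Y with e ∈ H, l₂ H * ∑ a ∈ H, W e a := Finset.sum_congr rfl fun H hH => by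
      rw [graftLength_right hBA hB0 hC0 hX hY t (Finset.mem_filter.1 hH).1]
    rw [e2, ← h2 e heC, flow]
    ring

open scoped Classical in
/-- The binary trees with leaves in `A` which can be realized with positive edge lengths, except for
the first edge, whose length is subject to the condition `P`. -/
def realizable [Fintype I] (W : I → I → ℝ) (P : ℝ → Prop) (A : Finset I) (f : I → ℝ) :
    Finset (Finset (Finset I)) :=
  Finset.univ.filter fun 𝓗 => IsBinary A 𝓗 ∧
    ∃ l, (A ∈ 𝓗 → P (l A)) ∧ (∀ H ∈ 𝓗, H ≠ A → 0 < l H) ∧ Realizes W A f 𝓗 l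

/-- The sum over the trees is computed by removing the root: the trees with leaves in `B` and
`A \ B` which remain are arbitrary, and the length of the first edge is determined by the moments. -/
theorem sum_realizable_step [Fintype I] (hW : ∀ a b, W a b = -W b a) (P : ℝ → Prop)
    (hA : 2 ≤ A.card) {T : Finset I → R} [∀ B, Decidable (0 < blockSum W B (A \ B) ∧
      P ((∑ e ∈ B, f e) / blockSum W B (A \ B)))]
    (hT : ∀ B ⊆ A, 0 < blockSum W B (A \ B) → T B =
      (q B (A \ B) - q (A \ B) B) *
      (∑ 𝓗 ∈ realizable W (0 < ·) B (splitFlow W A B f), ∏ H ∈ 𝓗, vertexWeight W q 𝓗 H) *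
      (∑ 𝓗 ∈ realizable W (0 < ·) (A \ B) (splitFlow W A B f),
        ∏ H ∈ 𝓗, vertexWeight W q 𝓗 H)) :
    ∑ 𝓗 ∈ realizable W P A f, ∏ H ∈ 𝓗, vertexWeight W q 𝓗 H =
    ∑ B ∈ A.powerset, if 0 < blockSum W B (A \ B) ∧ P ((∑ e ∈ B, f e) / blockSum W B (A \ B)) then
      T B else 0 := by
  classical
  have hmem : ∀ 𝓗 ∈ realizable W P A f, A ∈ 𝓗 := fun 𝓗 h =>
    (Finset.mem_filter.1 h).2.1.top.resolve_right (by omega)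
  have h1 : ∀ 𝓗 ∈ realizable W P A f, ∏ H ∈ 𝓗, vertexWeight W q 𝓗 H =
      ∑ B ∈ A.powerset, if IsBlock 𝓗 B ∧ IsBlock 𝓗 (A \ B) ∧ 0 < blockSum W B (A \ B) then
        (q B (A \ B) - q (A \ B) B) * ∏ H ∈ 𝓗.erase A, vertexWeight W q 𝓗 H else 0 := by
    intro 𝓗 h
    rw [← Finset.mul_prod_erase _ _ (hmem 𝓗 h)]
    nth_rewrite 1 [vertexWeight]
    rw [Finset.sum_mul]
    refine Finset.sum_congr rfl fun B _ => ?_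
    split_ifs <;> simp
  rw [Finset.sum_congr rfl h1, Finset.sum_comm]
  refine Finset.sum_congr rfl fun B hB => ?_
  have hBA := Finset.mem_powerset.1 hB
  by_cases hp : 0 < blockSum W B (A \ B)
  swap
  · rw [if_neg fun h => hp h.1]
    exact Finset.sum_eq_zero fun 𝓗 _ => if_neg fun h => hp h.2.2
  obtain ⟨hB0, hC0⟩ := nonempty_of_blockSum_ne_zero hp.ne'
  split_ifs with hP
  · rw [hT B hBA hp, mul_assoc, Finset.sum_mul_sum, ← Finset.sum_product', Finset.mul_sum,
      ← Finset.sum_filter]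
    refine Finset.sum_nbij' (fun 𝓗 => (𝓗.filter (· ⊆ B), 𝓗.filter (· ⊆ A \ B)))
      (fun s => insert A (s.1 ∪ s.2)) ?_ ?_ ?_ ?_ ?_
    · intro 𝓗 h
      obtain ⟨h2, hb, hc, -⟩ := Finset.mem_filter.1 h
      obtain ⟨-, hbin, l, hl1, hl2, hl3⟩ := Finset.mem_filter.1 h2
      have hXb := hbin.filter hb
      have hYb := hbin.filter hc
      rw [← hbin.eq_graft hBA hB0 hC0 hb hc] at hl3
      have hlA := hl3.length_eq hW hBA hp.ne' hXb hYb
      have r1 := hl3.flow_left hBA hB0 hC0 hXb hYb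
      have r2 := hl3.flow_right hBA hB0 hC0 hXb hYb
      rw [hlA] at r1 r2
      have hpos : ∀ S ⊂ A, ∀ H ∈ 𝓗.filter (· ⊆ S), 0 < l H := fun S hS H hH => by
        obtain ⟨h3, h4⟩ := Finset.mem_filter.1 hH
        refine hl2 H h3 ?_
        rintro rfl
        exact hS.2 h4
      have hss := ssubset_of_blockSum_ne_zero hBA hp.ne'
      refine Finset.mem_product.2 ⟨Finset.mem_filter.2 ⟨Finset.mem_univ _, hXb, l,
        hpos B hss.1 B, fun H hH _ => hpos B hss.1 H hH, r1⟩,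
        Finset.mem_filter.2 ⟨Finset.mem_univ _, hYb, l,
        hpos _ hss.2 _, fun H hH _ => hpos _ hss.2 H hH, r2⟩⟩
    · rintro ⟨X, Y⟩ h
      obtain ⟨hX, hY⟩ := Finset.mem_product.1 h
      obtain ⟨-, hXb, l₁, h2, h3, h4⟩ := Finset.mem_filter.1 hX
      obtain ⟨-, hYb, l₂, h2', h3', h4'⟩ := Finset.mem_filter.1 hY
      simp only at hXb hYb h2 h3 h4 h2' h3' h4'
      have hbin := hXb.graft hBA hB0 hC0 hYb
      refine Finset.mem_filter.2 ⟨Finset.mem_filter.2 ⟨Finset.mem_univ _, hbin,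
        graftLength A B ((∑ e ∈ B, f e) / blockSum W B (A \ B)) l₁ l₂, ?_, ?_,
        h4.graft hBA hB0 hC0 hXb hYb h4'⟩, hXb.top.mono subset_insert_union_left,
        hYb.top.mono subset_insert_union_right, hp⟩
      · rw [graftLength_self]
        exact fun _ => hP.2
      · intro H hH hHA
        rcases Finset.mem_union.1 (Finset.mem_of_mem_insert_of_ne hH hHA) with hH | hH
        · rw [graftLength_left hBA hB0 hC0 hXb hYb _ hH]
          by_cases e : H = B
          · subst e; exact h2 hH
          · exact h3 H hH e
        · rw [graftLength_right hBA hB0 hC0 hXb hYb _ hH]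
          by_cases e : H = A \ B
          · subst e; exact h2' hH
          · exact h3' H hH e
    · intro 𝓗 h
      obtain ⟨h2, hb, hc, -⟩ := Finset.mem_filter.1 h
      exact (Finset.mem_filter.1 h2).2.1.eq_graft hBA hB0 hC0 hb hc
    · rintro ⟨X, Y⟩ h
      obtain ⟨hX, hY⟩ := Finset.mem_product.1 h
      have hXb := (Finset.mem_filter.1 hX).2.1
      have hYb := (Finset.mem_filter.1 hY).2.1
      simp only at hXb hYb
      simp only [hXb.filter_graft_left hC0 hYb, hXb.filter_graft_right hBA hB0 hYb]
    · intro 𝓗 h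
      obtain ⟨h2, hb, hc, -⟩ := Finset.mem_filter.1 h
      have hbin := (Finset.mem_filter.1 h2).2.1
      have := prod_vertexWeight_graft (W := W) (q := q) hBA hB0 hC0 (hbin.filter hb)
        (hbin.filter hc)
      rw [hbin.eq_graft hBA hB0 hC0 hb hc] at this
      rw [this]
  · refine Finset.sum_eq_zero fun 𝓗 h => if_neg fun ⟨hb, hc, _⟩ => hP ⟨hp, ?_⟩
    obtain ⟨-, hbin, l, hl1, hl2, hl3⟩ := Finset.mem_filter.1 h
    rw [← hbin.eq_graft hBA hB0 hC0 hb hc] at hl3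
    rw [← hl3.length_eq hW hBA hp.ne' (hbin.filter hb) (hbin.filter hc)]
    exact hl1 (hmem 𝓗 h)

/-- `treeSum` is a sum over the binary trees that can be realized. -/
theorem treeSum_eq_sum_realizable [Fintype I] (hW : ∀ a b, W a b = -W b a) (hA : A ≠ ∅)
    (hf : ∑ e ∈ A, f e = 0) : treeSum W q A f =
    ∑ 𝓗 ∈ realizable W (0 < ·) A f, ∏ H ∈ 𝓗, vertexWeight W q 𝓗 H := by
  classical
  induction A using Finset.strongInduction generalizing f with
  | H A ih =>
    rcases Nat.lt_or_ge A.card 2 with h | h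
    · have hA1 : A.card = 1 := by
        have := Finset.card_pos.2 (Finset.nonempty_iff_ne_empty.2 hA)
        omega
      have : realizable W (0 < ·) A f = {∅} := by
        ext 𝓗
        simp only [realizable, Finset.mem_filter, Finset.mem_univ, true_and, Finset.mem_singleton]
        constructor
        · rintro ⟨h1, -⟩
          refine Finset.eq_empty_of_forall_notMem fun H hH => ?_
          have := h1.two_le H hH
          have := Finset.card_le_card (h1.subset H hH)
          omega
        · rintro rfl
          obtain ⟨e, rfl⟩ := Finset.card_eq_one.1 hA1
          refine ⟨⟨by simp, by simp, Or.inr hA1, by simp, by simp⟩, 0, by simp, by simp, ?_⟩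
          intro e' he'
          rw [Finset.mem_singleton.1 he']
          simpa using hf
      rw [this, treeSum_of_card_le (by omega)]
      simp
    · rw [treeSum_eq h, sum_realizable_step (T := fun B => (q B (A \ B) - q (A \ B) B) *
        treeSum W q B (splitFlow W A B f) * treeSum W q (A \ B) (splitFlow W A B f)) hW _ h]
      · refine Finset.sum_congr rfl fun B _ => ?_
        refine if_congr (and_congr_right fun hp => ?_) rfl rfl
        rw [div_pos_iff_of_pos_right hp]
      · intro B hBA hp
        have hne := nonempty_of_blockSum_ne_zero hp.ne'
        have hss := ssubset_of_blockSum_ne_zero hBA hp.ne'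
        rw [ih B hss.1 hne.1 (sum_splitFlow hW hBA hp.ne'),
          ih _ hss.2 hne.2 (sum_splitFlow_sdiff hW hBA hp.ne' hf)]

theorem rootedTreeSum_eq_sum_realizable [Fintype I] (hW : ∀ a b, W a b = -W b a)
    (hA : 2 ≤ A.card) (hf : ∑ e ∈ A, f e = 0) : rootedTreeSum W q A f =
    ∑ 𝓗 ∈ realizable W (fun _ => True) A f, ∏ H ∈ 𝓗, vertexWeight W q 𝓗 H := by
  classical
  rw [sum_realizable_step (T := fun B => (q B (A \ B) - q (A \ B) B) *
    treeSum W q B (splitFlow W A B f) * treeSum W q (A \ B) (splitFlow W A B f)) hW _ hA]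
  · exact Finset.sum_congr rfl fun B _ => by simp
  · intro B hBA hp
    have hne := nonempty_of_blockSum_ne_zero hp.ne'
    rw [treeSum_eq_sum_realizable hW hne.1 (sum_splitFlow hW hBA hp.ne'),
      treeSum_eq_sum_realizable hW hne.2 (sum_splitFlow_sdiff hW hBA hp.ne' hf)]

theorem card_graft_lt (hBA : B ⊆ A) (hX : X.card < B.card) (hY : Y.card < (A \ B).card) :
    (insert A (X ∪ Y)).card < A.card := by
  have h1 := Finset.card_insert_le A (X ∪ Y)
  have h2 := Finset.card_union_le X Y
  have := Finset.card_sdiff_add_card_eq_card hBA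
  omega

/-- The recursive description of trees agrees with the one by families of sets. -/
theorem WeaklyRealizable.exists_isBinary (hW : ∀ a b, W a b = -W b a) (hA : A ≠ ∅)
    (hf : ∑ e ∈ A, f e = 0) (h : WeaklyRealizable W A f) :
    ∃ 𝓗 l, IsBinary A 𝓗 ∧ 𝓗.card < A.card ∧ (∀ H ∈ 𝓗, 0 ≤ l H) ∧ Realizes W A f 𝓗 l := by
  induction A using Finset.strongInduction generalizing f with
  | H A ih =>
    have hA0 := Finset.card_pos.2 (Finset.nonempty_iff_ne_empty.2 hA)
    rw [WeaklyRealizable] at h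
    rcases h with h | ⟨B, ⟨hBA, hp⟩, h0, hB, hC⟩
    · have hA1 : A.card = 1 := by omega
      refine ⟨∅, 0, ⟨by simp, by simp, Or.inr hA1, by simp, by simp⟩, by simpa using hA0,
        by simp, ?_⟩
      intro e he
      obtain ⟨e', rfl⟩ := Finset.card_eq_one.1 hA1
      rw [Finset.mem_singleton.1 he]
      simpa using hf
    · have hne := nonempty_of_blockSum_ne_zero hp.ne'
      have hss := ssubset_of_blockSum_ne_zero hBA hp.ne'
      obtain ⟨X, l₁, hX, hXc, hl₁, hr₁⟩ := ih B hss.1 hne.1 (sum_splitFlow hW hBA hp.ne') hB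
      obtain ⟨Y, l₂, hY, hYc, hl₂, hr₂⟩ := ih _ hss.2 hne.2
        (sum_splitFlow_sdiff hW hBA hp.ne' hf) hC
      refine ⟨_, _, hX.graft hBA hne.1 hne.2 hY, card_graft_lt hBA hXc hYc, fun H hH => ?_,
        hr₁.graft hBA hne.1 hne.2 hX hY hr₂⟩
      rcases Finset.mem_insert.1 hH with rfl | hH
      · rw [graftLength_self]
        exact div_nonneg h0 hp.le
      · rcases Finset.mem_union.1 hH with hH | hH
        · rw [graftLength_left hBA hne.1 hne.2 hX hY _ hH]; exact hl₁ H hH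
        · rw [graftLength_right hBA hne.1 hne.2 hX hY _ hH]; exact hl₂ H hH

theorem Degenerate.exists_isBinary (hW : ∀ a b, W a b = -W b a)
    (hf : ∑ e ∈ A, f e = 0) (h : Degenerate W A f) :
    ∃ 𝓗 l, IsBinary A 𝓗 ∧ 𝓗.card < A.card ∧ (∀ H ∈ 𝓗, 0 ≤ l H) ∧ (∃ H ∈ 𝓗, l H = 0) ∧
      Realizes W A f 𝓗 l := by
  induction A using Finset.strongInduction generalizing f with
  | H A ih =>
    rw [Degenerate] at h
    obtain ⟨B, ⟨hBA, hp⟩, h0, hB, hC, h⟩ := h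
    have hne := nonempty_of_blockSum_ne_zero hp.ne'
    have hss := ssubset_of_blockSum_ne_zero hBA hp.ne'
    have hfB := sum_splitFlow hW hBA hp.ne' (f := f)
    have hfC := sum_splitFlow_sdiff hW hBA hp.ne' hf
    obtain ⟨X, l₁, Y, l₂, hX, hXc, hl₁, hr₁, hY, hYc, hl₂, hr₂, hz⟩ :
        ∃ X l₁ Y l₂, IsBinary B X ∧ X.card < B.card ∧ (∀ H ∈ X, 0 ≤ l₁ H) ∧
        Realizes W B (splitFlow W A B f) X l₁ ∧ IsBinary (A \ B) Y ∧ Y.card < (A \ B).card ∧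
        (∀ H ∈ Y, 0 ≤ l₂ H) ∧ Realizes W (A \ B) (splitFlow W A B f) Y l₂ ∧
        (∑ e ∈ B, f e = 0 ∨ (∃ H ∈ X, l₁ H = 0) ∨ ∃ H ∈ Y, l₂ H = 0) := by
      obtain ⟨X, l₁, hX, hXc, hl₁, hr₁⟩ := hB.exists_isBinary hW hne.1 hfB
      obtain ⟨Y, l₂, hY, hYc, hl₂, hr₂⟩ := hC.exists_isBinary hW hne.2 hfC
      rcases h with h | h | h
      · exact ⟨X, l₁, Y, l₂, hX, hXc, hl₁, hr₁, hY, hYc, hl₂, hr₂, Or.inl h⟩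
      · obtain ⟨X, l₁, hX, hXc, hl₁, hz, hr₁⟩ := ih B hss.1 hfB h
        exact ⟨X, l₁, Y, l₂, hX, hXc, hl₁, hr₁, hY, hYc, hl₂, hr₂, Or.inr (Or.inl hz)⟩
      · obtain ⟨Y, l₂, hY, hYc, hl₂, hz, hr₂⟩ := ih _ hss.2 hfC h
        exact ⟨X, l₁, Y, l₂, hX, hXc, hl₁, hr₁, hY, hYc, hl₂, hr₂, Or.inr (Or.inr hz)⟩
    refine ⟨_, _, hX.graft hBA hne.1 hne.2 hY, card_graft_lt hBA hXc hYc, fun H hH => ?_, ?_,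
      hr₁.graft hBA hne.1 hne.2 hX hY hr₂⟩
    · rcases Finset.mem_insert.1 hH with rfl | hH
      · rw [graftLength_self]
        exact div_nonneg h0 hp.le
      · rcases Finset.mem_union.1 hH with hH | hH
        · rw [graftLength_left hBA hne.1 hne.2 hX hY _ hH]; exact hl₁ H hH
        · rw [graftLength_right hBA hne.1 hne.2 hX hY _ hH]; exact hl₂ H hH
    · rcases hz with h | ⟨H, hH, h⟩ | ⟨H, hH, h⟩
      · exact ⟨A, Finset.mem_insert_self _ _, by rw [graftLength_self, h, zero_div]⟩
      · exact ⟨H, subset_insert_union_left hH, by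
          rw [graftLength_left hBA hne.1 hne.2 hX hY _ hH, h]⟩
      · exact ⟨H, subset_insert_union_right hH, by
          rw [graftLength_right hBA hne.1 hne.2 hX hY _ hH, h]⟩

theorem RootedDegenerate.exists_isBinary (hW : ∀ a b, W a b = -W b a)
    (hf : ∑ e ∈ A, f e = 0) (h : RootedDegenerate W A f) :
    ∃ 𝓗 l, IsBinary A 𝓗 ∧ 𝓗.card < A.card ∧ (∀ H ∈ 𝓗, H ≠ A → 0 ≤ l H) ∧
      (∃ H ∈ 𝓗, H ≠ A ∧ l H = 0) ∧ A ∈ 𝓗 ∧ Realizes W A f 𝓗 l := by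
  obtain ⟨B, ⟨hBA, hp⟩, hB, hC, h⟩ := h
  have hne := nonempty_of_blockSum_ne_zero hp.ne'
  have hfB := sum_splitFlow hW hBA hp.ne' (f := f)
  have hfC := sum_splitFlow_sdiff hW hBA hp.ne' hf
  obtain ⟨X, l₁, Y, l₂, hX, hXc, hl₁, hr₁, hY, hYc, hl₂, hr₂, hz⟩ :
      ∃ X l₁ Y l₂, IsBinary B X ∧ X.card < B.card ∧ (∀ H ∈ X, 0 ≤ l₁ H) ∧
      Realizes W B (splitFlow W A B f) X l₁ ∧ IsBinary (A \ B) Y ∧ Y.card < (A \ B).card ∧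
      (∀ H ∈ Y, 0 ≤ l₂ H) ∧ Realizes W (A \ B) (splitFlow W A B f) Y l₂ ∧
      ((∃ H ∈ X, l₁ H = 0) ∨ ∃ H ∈ Y, l₂ H = 0) := by
    obtain ⟨X, l₁, hX, hXc, hl₁, hr₁⟩ := hB.exists_isBinary hW hne.1 hfB
    obtain ⟨Y, l₂, hY, hYc, hl₂, hr₂⟩ := hC.exists_isBinary hW hne.2 hfC
    rcases h with h | h
    · obtain ⟨X, l₁, hX, hXc, hl₁, hz, hr₁⟩ := h.exists_isBinary hW hfB
      exact ⟨X, l₁, Y, l₂, hX, hXc, hl₁, hr₁, hY, hYc, hl₂, hr₂, Or.inl hz⟩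
    · obtain ⟨Y, l₂, hY, hYc, hl₂, hz, hr₂⟩ := h.exists_isBinary hW hfC
      exact ⟨X, l₁, Y, l₂, hX, hXc, hl₁, hr₁, hY, hYc, hl₂, hr₂, Or.inr hz⟩
  have hni := hX.notMem_graft hBA hne.1 hne.2 hY
  refine ⟨_, _, hX.graft hBA hne.1 hne.2 hY, card_graft_lt hBA hXc hYc, fun H hH hHA => ?_, ?_,
    Finset.mem_insert_self _ _, hr₁.graft hBA hne.1 hne.2 hX hY hr₂⟩
  · rcases Finset.mem_union.1 (Finset.mem_of_mem_insert_of_ne hH hHA) with hH | hH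
    · rw [graftLength_left hBA hne.1 hne.2 hX hY _ hH]; exact hl₁ H hH
    · rw [graftLength_right hBA hne.1 hne.2 hX hY _ hH]; exact hl₂ H hH
  · rcases hz with ⟨H, hH, h⟩ | ⟨H, hH, h⟩
    · exact ⟨H, subset_insert_union_left hH,
        fun e => hni (Finset.mem_union_left _ (e ▸ hH)), by
        rw [graftLength_left hBA hne.1 hne.2 hX hY _ hH, h]⟩
    · exact ⟨H, subset_insert_union_right hH,
        fun e => hni (Finset.mem_union_right _ (e ▸ hH)), by
        rw [graftLength_right hBA hne.1 hne.2 hX hY _ hH, h]⟩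

end hierarchy

/-! ### Parent functions on trees -/

section parent

variable {X : Type*} {G : SimpleGraph X} {r : X} {p p' : X → X} {d : X → ℕ}

/-- `p` maps each vertex of a tree with root `r` to the next vertex on the way to the root (and `r`
to itself), and `d` increases away from the root. -/
structure IsParent (G : SimpleGraph X) (r : X) (p : X → X) (d : X → ℕ) : Prop where
  adj_iff : ∀ v w, G.Adj v w ↔ v ≠ w ∧ (p v = w ∨ p w = v)
  root : p r = r
  lt : ∀ v, v ≠ r → d (p v) < d v

theorem exists_isParent [Fintype X] (hG : G.IsTree) (r : X) :
    ∃ p, IsParent G r p fun v => G.dist v r := by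
  classical
  have h : ∀ v, v ≠ r → ∃ w, G.Adj v w ∧ G.dist w r < G.dist v r := by
    intro v hv
    obtain ⟨q, hq⟩ := hG.connected.exists_walk_length_eq_dist v r
    cases q with
    | nil => exact absurd rfl hv
    | cons h q =>
      refine ⟨_, h, ?_⟩
      rw [← hq, SimpleGraph.Walk.length_cons]
      exact Nat.lt_succ_of_le (SimpleGraph.dist_le q)
  choose! p h1 h2 using h
  let p' : X → X := fun v => if v = r then r else p v
  have hp' : ∀ v, v ≠ r → p' v = p v := fun v hv => if_neg hv
  have hr : p' r = r := if_pos rfl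
  have hinj : Set.InjOn (fun v => s(v, p v)) ((Finset.univ.erase r : Finset X) : Set X) := by
    intro v hv w hw hvw
    rw [Finset.mem_coe, Finset.mem_erase] at hv hw
    rcases Sym2.eq_iff.1 hvw with h | h
    · exact h.1
    · have e1 := h2 v hv.1
      have e2 := h2 w hw.1
      rw [h.2] at e1
      rw [← h.1] at e2
      omega
  have himg : (Finset.univ.erase r).image (fun v => s(v, p v)) = G.edgeFinset := by
    refine Finset.eq_of_subset_of_card_le (fun z hz => ?_) ?_
    · obtain ⟨v, hv, rfl⟩ := Finset.mem_image.1 hz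
      rw [SimpleGraph.mem_edgeFinset, SimpleGraph.mem_edgeSet]
      exact h1 v (Finset.mem_erase.1 hv).1
    · rw [Finset.card_image_of_injOn hinj, Finset.card_erase_of_mem (Finset.mem_univ r),
        Finset.card_univ, ← hG.card_edgeFinset]
      simp
  refine ⟨p', fun v w => ⟨fun h => ⟨h.ne, ?_⟩, ?_⟩, hr, fun v hv => ?_⟩
  · have : s(v, w) ∈ G.edgeFinset := by rwa [SimpleGraph.mem_edgeFinset, SimpleGraph.mem_edgeSet]
    rw [← himg] at this
    obtain ⟨u, hu, hu'⟩ := Finset.mem_image.1 this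
    rw [← hp' u (Finset.mem_erase.1 hu).1] at hu'
    rcases Sym2.eq_iff.1 hu' with h | h
    · left; rw [← h.1, h.2]
    · right; rw [← h.1, h.2]
  · rintro ⟨hne, h | h⟩
    · have hv : v ≠ r := fun h' => hne (by rw [← h, h', hr])
      rw [hp' v hv] at h
      exact h ▸ h1 v hv
    · have hw : w ≠ r := fun h' => hne (by rw [← h, h', hr])
      rw [hp' w hw] at h
      exact (h ▸ h1 w hw).symm
  · rw [hp' v hv]
    exact h2 v hv

namespace IsParent

variable (hp : IsParent G r p d)

include hp

theorem ne {v : X} (hv : v ≠ r) : p v ≠ v := fun h => by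
  have := hp.lt v hv
  rw [h] at this
  omega

theorem adj {v : X} (hv : v ≠ r) : G.Adj v (p v) := (hp.adj_iff _ _).2 ⟨(hp.ne hv).symm, Or.inl rfl⟩

/-- The parent function only depends on the tree and its root. -/
theorem eq_of_isParent {d' : X → ℕ} (hp' : IsParent G r p' d') : p = p' := by
  have h : ∀ k v, d v = k → p v = p' v := by
    intro k
    induction k using Nat.strong_induction_on with
    | _ k ih =>
      rintro v rfl
      by_cases hv : v = r
      · rw [hv, hp.root, hp'.root]
      · rcases ((hp'.adj_iff _ _).1 (hp.adj hv)).2 with h | h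
        · exact h.symm
        · have hw : p v ≠ r := fun h' => hv (by rw [← h, h', hp'.root])
          have h1 := ih _ (hp.lt v hv) (p v) rfl
          have h2 := hp.lt _ (hw)
          have h3 := hp.lt v hv
          rw [h1, h] at h2
          omega
  exact funext fun v => h _ v rfl

theorem iterate_root (k : ℕ) : p^[k] r = r := Function.iterate_fixed hp.root k

theorem iterate_eq_or_lt (k : ℕ) (v : X) : p^[k] v = v ∨ d (p^[k] v) < d v := by
  induction k with
  | zero => exact Or.inl rfl
  | succ k ih =>
    rw [Function.iterate_succ_apply']
    by_cases h : p^[k] v = r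
    · rw [h, hp.root, ← h]; exact ih
    · right
      rcases ih with h' | h'
      · rw [h'] at h ⊢; exact hp.lt v h
      · exact (hp.lt _ h).trans h'

theorem exists_iterate_eq_root (v : X) : ∃ k, p^[k] v = r := by
  obtain ⟨m, hm⟩ : ∃ m, m = d v := ⟨_, rfl⟩
  induction m using Nat.strong_induction_on generalizing v with
  | _ m ih =>
    by_cases hv : v = r
    · exact ⟨0, hv⟩
    · obtain ⟨k, hk⟩ := ih _ (hm ▸ hp.lt v hv) (p v) rfl
      exact ⟨k + 1, hk⟩

theorem isTree [Finite X] : G.IsTree := by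
  classical
  have := Fintype.ofFinite X
  have hreach : ∀ k v, G.Reachable v (p^[k] v) := by
    intro k
    induction k with
    | zero => exact fun v => SimpleGraph.Reachable.rfl
    | succ k ih =>
      intro v
      rw [Function.iterate_succ_apply]
      refine SimpleGraph.Reachable.trans ?_ (ih (p v))
      by_cases hv : v = r
      · rw [hv, hp.root]
      · exact (hp.adj hv).reachable
  have hconn : G.Connected := by
    have : Nonempty X := ⟨r⟩
    refine ⟨fun v w => ?_⟩
    obtain ⟨k, hk⟩ := hp.exists_iterate_eq_root v
    obtain ⟨m, hm⟩ := hp.exists_iterate_eq_root w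
    exact (hk ▸ hreach k v).trans (hm ▸ hreach m w).symm
  refine SimpleGraph.isTree_iff_connected_and_card.2
    ⟨hconn, le_antisymm ?_ hconn.card_vert_le_card_edgeSet_add_one⟩
  have hsub : G.edgeFinset ⊆ (Finset.univ.erase r).image fun v => s(v, p v) := by
    intro z
    induction z using Sym2.ind with
    | _ v w =>
      intro h
      rw [SimpleGraph.mem_edgeFinset, SimpleGraph.mem_edgeSet, hp.adj_iff] at h
      rcases h with ⟨hne, h | h⟩
      · refine Finset.mem_image.2 ⟨v, ?_, by rw [h]⟩
        simp only [Finset.mem_erase, Finset.mem_univ, and_true]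
        rintro rfl
        exact hne (by rw [← h, hp.root])
      · refine Finset.mem_image.2 ⟨w, ?_, by rw [h, Sym2.eq_swap]⟩
        simp only [Finset.mem_erase, Finset.mem_univ, and_true]
        rintro rfl
        exact hne (by rw [← h, hp.root])
  have h1 := (Finset.card_le_card hsub).trans Finset.card_image_le
  rw [Finset.card_erase_of_mem (Finset.mem_univ r), Finset.card_univ] at h1
  have h2 : 0 < Fintype.card X := Fintype.card_pos_iff.2 ⟨r⟩
  rw [Nat.card_eq_fintype_card, Nat.card_eq_fintype_card, ← SimpleGraph.edgeFinset_card]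
  omega

end IsParent

/-- `w` is on the way from `v` to the root. -/
def Below (p : X → X) (v w : X) : Prop := ∃ k, p^[k] v = w

theorem Below.refl (v : X) : Below p v v := ⟨0, rfl⟩

theorem Below.trans {u v w : X} (h : Below p u v) (h' : Below p v w) : Below p u w := by
  obtain ⟨k, rfl⟩ := h
  obtain ⟨m, rfl⟩ := h'
  exact ⟨m + k, Function.iterate_add_apply _ _ _ _⟩

theorem below_parent (v : X) : Below p v (p v) := ⟨1, rfl⟩

theorem Below.total {u v w : X} (h : Below p u v) (h' : Below p u w) :
    Below p v w ∨ Below p w v := by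
  obtain ⟨k, rfl⟩ := h
  obtain ⟨m, rfl⟩ := h'
  rcases le_total k m with hkm | hkm
  · left
    exact ⟨m - k, by rw [← Function.iterate_add_apply, Nat.sub_add_cancel hkm]⟩
  · right
    exact ⟨k - m, by rw [← Function.iterate_add_apply, Nat.sub_add_cancel hkm]⟩

theorem Below.eq_or_parent {v w : X} (h : Below p v w) : v = w ∨ Below p (p v) w := by
  obtain ⟨k, rfl⟩ := h
  cases k with
  | zero => exact Or.inl rfl
  | succ k => exact Or.inr ⟨k, rfl⟩

/-- A vertex strictly below `w` is below a child of `w`. -/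
theorem Below.exists_child {v w : X} (h : Below p v w) (hne : v ≠ w) :
    ∃ u, Below p v u ∧ p u = w ∧ u ≠ w := by
  obtain ⟨k, hk⟩ := h
  classical
  have hex : ∃ k, p^[k] v = w := ⟨k, hk⟩
  have hm := Nat.find_spec hex
  have hmin := fun m => Nat.find_min hex (m := m)
  obtain ⟨m, hm'⟩ : ∃ m, Nat.find hex = m + 1 := by
    refine Nat.exists_eq_succ_of_ne_zero fun h0 => hne ?_
    rw [h0] at hm
    exact hm
  rw [hm', Function.iterate_succ_apply'] at hm
  exact ⟨p^[m] v, ⟨m, rfl⟩, hm, hmin m (by omega)⟩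

namespace IsParent

variable (hp : IsParent G r p d)

include hp

theorem below_root (v : X) : Below p v r := hp.exists_iterate_eq_root v

theorem eq_or_lt_of_below {v w : X} (h : Below p v w) : w = v ∨ d w < d v := by
  obtain ⟨k, rfl⟩ := h
  exact hp.iterate_eq_or_lt k v

theorem below_antisymm {v w : X} (h : Below p v w) (h' : Below p w v) : v = w := by
  rcases hp.eq_or_lt_of_below h with h1 | h1
  · exact h1.symm
  · rcases hp.eq_or_lt_of_below h' with h2 | h2
    · exact h2
    · omega

theorem not_below_child {u w : X} (hu : p u = w) (hne : u ≠ w) : ¬ Below p w u := fun h =>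
  hne (hp.below_antisymm (hu ▸ below_parent u) h)

theorem eq_of_child {u v w : X} (hu : p u = w) (hv : p v = w) (hv' : v ≠ w)
    (h : Below p u v) : u = v := by
  rcases h.eq_or_parent with h | h
  · exact h
  · rw [hu] at h
    exact absurd h (hp.not_below_child hv hv')

theorem ne_root_of_child {u w : X} (hu : p u = w) (hne : u ≠ w) : u ≠ r := by
  rintro rfl
  exact hne (by rw [← hu, hp.root])

theorem below_root_left {w : X} (h : Below p r w) : w = r := by
  obtain ⟨k, rfl⟩ := h
  exact hp.iterate_root k

end IsParent

end parent

/-! ### Clades of a tropical curve -/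

/-- The labels of the ends other than `e₀`, which is considered as the root. -/
abbrev Leaf {E : Type*} (e₀ : E) : Type _ := {e : E // e ≠ e₀}

namespace AbstractCurve

variable {E : Type*} (Γ : AbstractCurve E) (e₀ : E)

/-- The next vertex on the way to the end `e₀`. -/
def parent : Fin Γ.numVert → Fin Γ.numVert :=
  (exists_isParent Γ.isTree (Γ.endVert e₀)).choose

theorem isParent : IsParent Γ.graph (Γ.endVert e₀) (Γ.parent e₀)
    fun v => Γ.graph.dist v (Γ.endVert e₀) :=
  (exists_isParent Γ.isTree (Γ.endVert e₀)).choose_spec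

/-- The edge at `v` which leads to the end `e₀`. -/
def up (v : Fin Γ.numVert) : Γ.Star v :=
  if h : v = Γ.endVert e₀ then Sum.inr ⟨e₀, h.symm⟩
  else Sum.inl ⟨Γ.parent e₀ v, (Γ.isParent e₀).adj h⟩

variable {Γ e₀} in
theorem child_of_ne_up {v : Fin Γ.numVert} {w : {w // Γ.graph.Adj v w}}
    (h : Sum.inl w ≠ Γ.up e₀ v) : Γ.parent e₀ w = v ∧ w.1 ≠ v := by
  have hp := Γ.isParent e₀
  have hw := (hp.adj_iff _ _).1 w.2
  refine ⟨hw.2.resolve_left fun h' => h ?_, hw.1.symm⟩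
  have hv : v ≠ Γ.endVert e₀ := by
    rintro rfl
    exact hw.1 (by rw [← h', hp.root])
  rw [up, dif_neg hv]
  exact congrArg Sum.inl (Subtype.ext h'.symm)

variable {Γ e₀} in
theorem end_ne_of_ne_up {v : Fin Γ.numVert} {e : {e // Γ.endVert e = v}}
    (h : Sum.inr e ≠ Γ.up e₀ v) : e.1 ≠ e₀ := by
  intro h'
  refine h ?_
  have hv : v = Γ.endVert e₀ := by rw [← h', e.2]
  rw [up, dif_pos hv]
  exact congrArg Sum.inr (Subtype.ext h')

variable {Γ e₀} in
theorem inl_ne_up {v w : Fin Γ.numVert} (h : Γ.parent e₀ w = v) (hne : w ≠ v)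
    (hadj : Γ.graph.Adj v w) : Sum.inl ⟨w, hadj⟩ ≠ Γ.up e₀ v := by
  have hp := Γ.isParent e₀
  rw [up]
  split_ifs with hv
  · exact Sum.inl_ne_inr
  · intro h'
    have h2 : w = Γ.parent e₀ v := congrArg Subtype.val (Sum.inl.inj h')
    have hw := hp.ne_root_of_child h hne
    have h3 := hp.lt w hw
    have h4 := hp.lt v hv
    rw [h] at h3
    rw [← h2] at h4
    omega

variable {Γ e₀} in
theorem inr_ne_up {v : Fin Γ.numVert} {e : E} (h : e ≠ e₀) (he : Γ.endVert e = v) :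
    Sum.inr ⟨e, he⟩ ≠ Γ.up e₀ v := by
  rw [up]
  split_ifs with hv
  · exact fun h' => h (congrArg Subtype.val (Sum.inr.inj h'))
  · exact Sum.inr_ne_inl

theorem nontrivial_ne_up [Finite E] {v : Fin Γ.numVert} (x : Γ.Star v) :
    ∃ y, y ≠ Γ.up e₀ v ∧ y ≠ x := by
  classical
  have hf : Finite (Γ.Star v) := by unfold Star; infer_instance
  have := Fintype.ofFinite (Γ.Star v)
  have h := Γ.valency v
  change 3 ≤ Nat.card (Γ.Star v) at h
  rw [Nat.card_eq_fintype_card] at h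
  by_contra! hcon
  have h1 : (Finset.univ : Finset (Γ.Star v)) ⊆ {Γ.up e₀ v, x} := fun y _ => by
    by_cases hy : y = Γ.up e₀ v
    · simp [hy]
    · simp [hcon y hy]
  have h2 := (Finset.card_le_card h1).trans Finset.card_le_two
  rw [Finset.card_univ] at h2
  omega

variable [Fintype E] [DecidableEq E]

open scoped Classical in
/-- The ends other than `e₀` whose path to `e₀` passes through `v`. -/
def clade (v : Fin Γ.numVert) : Finset (Leaf e₀) :=
  Finset.univ.filter fun e => Below (Γ.parent e₀) (Γ.endVert e) v

variable {Γ e₀} in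
theorem mem_clade {v : Fin Γ.numVert} {e : Leaf e₀} :
    e ∈ Γ.clade e₀ v ↔ Below (Γ.parent e₀) (Γ.endVert e) v := by simp [clade]

/-- The ends other than `e₀` beyond an edge at `v`, if this edge does not lead to `e₀`. -/
def block (v : Fin Γ.numVert) : Γ.Star v → Finset (Leaf e₀) :=
  Sum.elim (fun w => Γ.clade e₀ w) fun e => if h : e.1 ≠ e₀ then {⟨e.1, h⟩} else ∅

variable {Γ e₀}

theorem mem_block_inr {v : Fin Γ.numVert} {e : {e // Γ.endVert e = v}} {e' : Leaf e₀} :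
    e' ∈ Γ.block e₀ v (Sum.inr e) ↔ e'.1 = e.1 := by
  simp only [block, Sum.elim_inr]
  split_ifs with h
  · simp [Subtype.ext_iff]
  · push Not at h
    simp [h, e'.2]

theorem clade_mono {v w : Fin Γ.numVert} (h : Below (Γ.parent e₀) v w) :
    Γ.clade e₀ v ⊆ Γ.clade e₀ w := fun _ he => mem_clade.2 ((mem_clade.1 he).trans h)

theorem block_subset {v : Fin Γ.numVert} {x : Γ.Star v} (hx : x ≠ Γ.up e₀ v) :
    Γ.block e₀ v x ⊆ Γ.clade e₀ v := by
  rcases x with w | e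
  · have h := below_parent (p := Γ.parent e₀) w.1
    rw [(child_of_ne_up hx).1] at h
    exact clade_mono h
  · intro e' he'
    rw [mem_block_inr] at he'
    rw [mem_clade, he', e.2]
    exact Below.refl _

theorem exists_mem_block {v : Fin Γ.numVert} {e : Leaf e₀} (he : e ∈ Γ.clade e₀ v) :
    ∃ x, x ≠ Γ.up e₀ v ∧ e ∈ Γ.block e₀ v x := by
  have hp := Γ.isParent e₀
  rw [mem_clade] at he
  by_cases h : Γ.endVert e = v
  · exact ⟨Sum.inr ⟨e, h⟩, inr_ne_up e.2 h, mem_block_inr.2 rfl⟩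
  · obtain ⟨u, h1, h2, h3⟩ := he.exists_child h
    have hadj : Γ.graph.Adj v u := (hp.adj_iff _ _).2 ⟨h3.symm, Or.inr h2⟩
    exact ⟨Sum.inl ⟨u, hadj⟩, inl_ne_up h2 h3 hadj, mem_clade.2 h1⟩

theorem eq_of_mem_block {v : Fin Γ.numVert} {x y : Γ.Star v} (hx : x ≠ Γ.up e₀ v)
    (hy : y ≠ Γ.up e₀ v) {e : Leaf e₀} (hex : e ∈ Γ.block e₀ v x) (hey : e ∈ Γ.block e₀ v y) :
    x = y := by
  have hp := Γ.isParent e₀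
  rcases x with w | a <;> rcases y with w' | b
  · obtain ⟨h1, h2⟩ := child_of_ne_up hx
    obtain ⟨h3, h4⟩ := child_of_ne_up hy
    have h5 := mem_clade.1 hex
    have h6 := mem_clade.1 hey
    refine congrArg Sum.inl (Subtype.ext ?_)
    rcases h5.total h6 with h | h
    · exact hp.eq_of_child h1 h3 h4 h
    · exact (hp.eq_of_child h3 h1 h2 h).symm
  · obtain ⟨h1, h2⟩ := child_of_ne_up hx
    have h5 := mem_clade.1 hex
    rw [mem_block_inr] at hey
    rw [hey, b.2] at h5
    exact absurd h5 (hp.not_below_child h1 h2)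
  · obtain ⟨h1, h2⟩ := child_of_ne_up hy
    have h5 := mem_clade.1 hey
    rw [mem_block_inr] at hex
    rw [hex, a.2] at h5
    exact absurd h5 (hp.not_below_child h1 h2)
  · rw [mem_block_inr] at hex hey
    exact congrArg Sum.inr (Subtype.ext (hex.symm.trans hey))

/-- Induction from the ends of a curve towards the root. -/
theorem child_induction {P : Fin Γ.numVert → Prop}
    (h : ∀ v, (∀ w, Γ.parent e₀ w = v → w ≠ v → P w) → P v) (v : Fin Γ.numVert) : P v := by
  have hp := Γ.isParent e₀
  set d : Fin Γ.numVert → ℕ := fun v => Γ.graph.dist v (Γ.endVert e₀) with hd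
  obtain ⟨k, hk⟩ : ∃ k, k = Finset.univ.sup d - d v := ⟨_, rfl⟩
  induction k using Nat.strong_induction_on generalizing v with
  | _ k ih =>
    refine h v fun w hw hne => ih _ ?_ w rfl
    have h1 : d v < d w := hw ▸ hp.lt w (hp.ne_root_of_child hw hne)
    have h2 : d w ≤ Finset.univ.sup d := Finset.le_sup (Finset.mem_univ w)
    omega

theorem clade_nonempty (v : Fin Γ.numVert) : (Γ.clade e₀ v).Nonempty := by
  refine child_induction (e₀ := e₀) (P := fun v => (Γ.clade e₀ v).Nonempty) (fun v ih => ?_) v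
  obtain ⟨x, hx, -⟩ := Γ.nontrivial_ne_up e₀ (Γ.up e₀ v)
  rcases x with w | e
  · obtain ⟨h1, h2⟩ := child_of_ne_up hx
    exact (ih w h1 h2).mono (block_subset hx)
  · exact ⟨⟨e.1, end_ne_of_ne_up hx⟩, block_subset hx (mem_block_inr.2 rfl)⟩

theorem block_nonempty {v : Fin Γ.numVert} {x : Γ.Star v} (hx : x ≠ Γ.up e₀ v) :
    (Γ.block e₀ v x).Nonempty := by
  rcases x with w | e
  · exact clade_nonempty w.1
  · exact ⟨⟨e.1, end_ne_of_ne_up hx⟩, mem_block_inr.2 rfl⟩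

theorem block_ssubset {v : Fin Γ.numVert} {x : Γ.Star v} (hx : x ≠ Γ.up e₀ v) :
    Γ.block e₀ v x ⊂ Γ.clade e₀ v := by
  refine (block_subset hx).ssubset_of_ne fun h => ?_
  obtain ⟨y, hy, hyx⟩ := Γ.nontrivial_ne_up e₀ x
  obtain ⟨e, he⟩ := block_nonempty hy
  exact hyx (eq_of_mem_block hy hx he (h ▸ block_subset hy he))

theorem clade_child_ssubset {v w : Fin Γ.numVert} (h : Γ.parent e₀ w = v) (hne : w ≠ v) :
    Γ.clade e₀ w ⊂ Γ.clade e₀ v := by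
  have hadj : Γ.graph.Adj v w := ((Γ.isParent e₀).adj_iff _ _).2 ⟨hne.symm, Or.inr h⟩
  exact block_ssubset (inl_ne_up h hne hadj)

theorem clade_ssubset {v w : Fin Γ.numVert} (h : Below (Γ.parent e₀) v w) (hne : v ≠ w) :
    Γ.clade e₀ v ⊂ Γ.clade e₀ w := by
  obtain ⟨u, h1, h2, h3⟩ := h.exists_child hne
  exact (clade_mono h1).trans_ssubset (clade_child_ssubset h2 h3)

theorem below_of_clade_subset {v w : Fin Γ.numVert} (h : Γ.clade e₀ v ⊆ Γ.clade e₀ w) :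
    Below (Γ.parent e₀) v w := by
  obtain ⟨e, he⟩ := clade_nonempty (Γ := Γ) (e₀ := e₀) v
  rcases (mem_clade.1 he).total (mem_clade.1 (h he)) with h' | h'
  · exact h'
  · by_cases hvw : w = v
    · rw [hvw]; exact Below.refl _
    · exact absurd h (clade_ssubset h' hvw).2

theorem clade_subset_iff {v w : Fin Γ.numVert} :
    Γ.clade e₀ v ⊆ Γ.clade e₀ w ↔ Below (Γ.parent e₀) v w := ⟨below_of_clade_subset, clade_mono⟩

theorem clade_injective : Function.Injective (Γ.clade e₀) := fun _ _ h =>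
  (Γ.isParent e₀).below_antisymm (below_of_clade_subset h.subset)
    (below_of_clade_subset h.symm.subset)

theorem clade_root : Γ.clade e₀ (Γ.endVert e₀) = Finset.univ :=
  Finset.eq_univ_iff_forall.2 fun _ => mem_clade.2 ((Γ.isParent e₀).below_root _)

theorem two_le_card_clade (v : Fin Γ.numVert) : 2 ≤ (Γ.clade e₀ v).card := by
  obtain ⟨x, hx, -⟩ := Γ.nontrivial_ne_up e₀ (Γ.up e₀ v)
  have h1 := Finset.card_lt_card (block_ssubset hx)
  have h2 := Finset.card_pos.2 (block_nonempty hx)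
  omega

theorem clade_laminar (v w : Fin Γ.numVert) :
    Γ.clade e₀ v ⊆ Γ.clade e₀ w ∨ Γ.clade e₀ w ⊆ Γ.clade e₀ v ∨
      Disjoint (Γ.clade e₀ v) (Γ.clade e₀ w) := by
  by_cases h : Disjoint (Γ.clade e₀ v) (Γ.clade e₀ w)
  · exact Or.inr (Or.inr h)
  · obtain ⟨e, h1, h2⟩ := Finset.not_disjoint_iff.1 h
    rcases (mem_clade.1 h1).total (mem_clade.1 h2) with h' | h'
    · exact Or.inl (clade_mono h')
    · exact Or.inr (Or.inl (clade_mono h'))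

variable (Γ e₀) in
/-- The hierarchy of the clades of the vertices. -/
def clades : Finset (Finset (Leaf e₀)) := Finset.univ.image (Γ.clade e₀)

theorem mem_clades {H : Finset (Leaf e₀)} : H ∈ Γ.clades e₀ ↔ ∃ v, Γ.clade e₀ v = H := by
  simp [clades]

theorem card_clades : (Γ.clades e₀).card = Γ.numVert := by
  rw [clades, Finset.card_image_of_injective _ clade_injective, Finset.card_univ, Fintype.card_fin]

theorem sum_clade {M : Type*} [AddCommMonoid M] (v : Fin Γ.numVert) [Fintype (Γ.Star v)]
    [DecidableEq (Γ.Star v)] (g : Leaf e₀ → M) :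
    ∑ x ∈ Finset.univ.erase (Γ.up e₀ v), ∑ e ∈ Γ.block e₀ v x, g e = ∑ e ∈ Γ.clade e₀ v, g e := by
  rw [← Finset.sum_biUnion]
  · refine Finset.sum_congr ?_ fun _ _ => rfl
    ext e
    simp only [Finset.mem_biUnion, Finset.mem_erase, Finset.mem_univ, and_true]
    exact ⟨fun ⟨x, hx, h⟩ => block_subset hx h, fun h => exists_mem_block h⟩
  · intro x hx y hy hxy
    refine Finset.disjoint_left.2 fun e h1 h2 => hxy ?_
    exact eq_of_mem_block (Finset.mem_erase.1 hx).1 (Finset.mem_erase.1 hy).1 h1 h2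

/-- `clade w` is the smallest clade larger than `clade v` exactly if `w` is the parent of `v`. -/
theorem parent_eq_iff {v w : Fin Γ.numVert} (hne : v ≠ w) : Γ.parent e₀ v = w ↔
    Γ.clade e₀ v ⊂ Γ.clade e₀ w ∧
      ∀ u, Γ.clade e₀ v ⊂ Γ.clade e₀ u → Γ.clade e₀ w ⊆ Γ.clade e₀ u := by
  constructor
  · intro h
    refine ⟨clade_child_ssubset h hne, fun u hu => ?_⟩
    have h1 := below_of_clade_subset hu.1
    rcases h1.eq_or_parent with h' | h'
    · exact absurd hu (h' ▸ fun h => h.2 subset_rfl)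
    · exact clade_mono (h ▸ h')
  · rintro ⟨h1, h2⟩
    rcases (below_of_clade_subset h1.1).eq_or_parent with h' | h'
    · exact absurd h' hne
    · have h3 : v ≠ Γ.parent e₀ v := fun h3 => by
        have h4 : v = Γ.endVert e₀ := by
          by_contra h4
          exact (Γ.isParent e₀).ne h4 h3.symm
        rw [← h3, h4] at h'
        exact hne (h4.trans ((Γ.isParent e₀).below_root_left h').symm)
      have h4 := h2 _ (clade_ssubset (below_parent v) h3)
      exact (Γ.isParent e₀).below_antisymm h' (below_of_clade_subset h4)

/-- Two curves with the same clades are of the same combinatorial type. -/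
theorem exists_iso_of_clades_eq {Γ' : AbstractCurve E} (h : Γ.clades e₀ = Γ'.clades e₀) :
    ∃ φ : Γ.graph ≃g Γ'.graph, (∀ e, φ (Γ.endVert e) = Γ'.endVert e) ∧
      ∀ v, Γ'.clade e₀ (φ v) = Γ.clade e₀ v := by
  have h1 : ∀ v, ∃ w, Γ'.clade e₀ w = Γ.clade e₀ v := fun v =>
    mem_clades.1 (h ▸ mem_clades.2 ⟨v, rfl⟩)
  have h2 : ∀ v, ∃ w, Γ.clade e₀ w = Γ'.clade e₀ v := fun v =>
    mem_clades.1 (h.symm ▸ mem_clades.2 ⟨v, rfl⟩)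
  choose φ hφ using h1
  choose ψ hψ using h2
  let φ' : Fin Γ.numVert ≃ Fin Γ'.numVert :=
    { toFun := φ
      invFun := ψ
      left_inv := fun v => clade_injective (e₀ := e₀) (by rw [hψ, hφ])
      right_inv := fun v => clade_injective (e₀ := e₀) (by rw [hφ, hψ]) }
  have hpar : ∀ v w, v ≠ w → (Γ'.parent e₀ (φ v) = φ w ↔ Γ.parent e₀ v = w) := by
    intro v w hne
    have hne' : φ v ≠ φ w := fun h' => hne (φ'.injective h')
    rw [parent_eq_iff hne, parent_eq_iff hne', hφ, hφ]
    refine and_congr_right fun _ => ⟨fun h u => ?_, fun h u => ?_⟩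
    · have := h (φ u)
      rwa [hφ] at this
    · have := h (ψ u)
      rwa [hψ] at this
  refine ⟨⟨φ', fun {v w} => ?_⟩, fun e => ?_, hφ⟩
  · change Γ'.graph.Adj (φ v) (φ w) ↔ _
    rw [(Γ.isParent e₀).adj_iff, (Γ'.isParent e₀).adj_iff]
    have e1 : φ v ≠ φ w ↔ v ≠ w := φ'.injective.ne_iff
    rw [e1]
    exact and_congr_right fun hne => or_congr (hpar v w hne) (hpar w v hne.symm)
  · change φ (Γ.endVert e) = _
    by_cases he : e = e₀
    · subst he
      exact clade_injective (e₀ := e) (by rw [hφ, clade_root, clade_root])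
    · have m1 : (⟨e, he⟩ : Leaf e₀) ∈ Γ.clade e₀ (Γ.endVert e) := mem_clade.2 (Below.refl _)
      have m2 : (⟨e, he⟩ : Leaf e₀) ∈ Γ'.clade e₀ (Γ'.endVert e) := mem_clade.2 (Below.refl _)
      rw [← hφ, mem_clade] at m1
      rw [← hψ, mem_clade] at m2
      refine clade_injective (e₀ := e₀) (Finset.Subset.antisymm ?_ (clade_mono m1))
      rw [hφ, ← hψ]
      exact clade_mono m2

/-- An isomorphism of labelled graphs preserves the clades. -/
theorem clade_of_iso {Γ' : AbstractCurve E} (φ : Γ.graph ≃g Γ'.graph)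
    (hφ : ∀ e, φ (Γ.endVert e) = Γ'.endVert e) (v : Fin Γ.numVert) :
    Γ'.clade e₀ (φ v) = Γ.clade e₀ v := by
  have hp := Γ.isParent e₀
  have hp2 : IsParent Γ'.graph (Γ'.endVert e₀) (fun w => φ (Γ.parent e₀ (φ.symm w)))
      fun w => Γ.graph.dist (φ.symm w) (Γ.endVert e₀) := by
    refine ⟨fun v w => ?_, ?_, fun v hv => ?_⟩
    · rw [← φ.symm.map_adj_iff, hp.adj_iff]
      have e1 : ∀ a b, φ a = b ↔ a = φ.symm b := fun a b => φ.toEquiv.eq_symm_apply.symm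
      rw [e1, e1]
      exact and_congr φ.symm.injective.ne_iff Iff.rfl
    · rw [← hφ, φ.symm_apply_apply, hp.root]
    · rw [φ.symm_apply_apply]
      refine hp.lt _ fun h => hv ?_
      rw [← hφ, ← h, φ.apply_symm_apply]
  have hpar : ∀ w, Γ'.parent e₀ (φ w) = φ (Γ.parent e₀ w) := fun w => by
    rw [(Γ'.isParent e₀).eq_of_isParent hp2]
    change φ (Γ.parent e₀ (φ.symm (φ w))) = φ (Γ.parent e₀ w)
    rw [φ.symm_apply_apply]
  have hiter : ∀ k w, (Γ'.parent e₀)^[k] (φ w) = φ ((Γ.parent e₀)^[k] w) := by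
    intro k
    induction k with
    | zero => exact fun w => rfl
    | succ k ih =>
      intro w
      rw [Function.iterate_succ_apply, Function.iterate_succ_apply, hpar, ih]
  ext e
  rw [mem_clade, mem_clade, ← hφ]
  refine exists_congr fun k => ?_
  rw [hiter]
  exact φ.injective.eq_iff

theorem clades_of_iso {Γ' : AbstractCurve E} (φ : Γ.graph ≃g Γ'.graph)
    (hφ : ∀ e, φ (Γ.endVert e) = Γ'.endVert e) : Γ'.clades e₀ = Γ.clades e₀ := by
  ext H
  rw [mem_clades, mem_clades]
  constructor
  · rintro ⟨v, rfl⟩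
    exact ⟨φ.symm v, by rw [← clade_of_iso φ hφ, φ.apply_symm_apply]⟩
  · rintro ⟨v, rfl⟩
    exact ⟨φ v, clade_of_iso φ hφ v⟩

end AbstractCurve

/-! ### Slopes, positions and moments of a tropical curve -/

namespace AbstractCurve

variable {E : Type*} [Fintype E] (Γ : AbstractCurve E)

theorem sum_card_star : ∑ v, Nat.card (Γ.Star v) + 2 = 2 * Γ.numVert + Fintype.card E := by
  classical
  have h1 : ∀ v, Nat.card (Γ.Star v) =
      Γ.graph.degree v + (Finset.univ.filter fun e => Γ.endVert e = v).card := by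
    intro v
    have : Nat.card (Γ.Star v) =
        Nat.card {w // Γ.graph.Adj v w} + Nat.card {e // Γ.endVert e = v} :=
      Nat.card_sum
    rw [this, Nat.card_eq_fintype_card, Nat.card_eq_fintype_card, Fintype.card_subtype,
      Fintype.card_subtype, ← SimpleGraph.card_neighborFinset_eq_degree,
      SimpleGraph.neighborFinset_eq_filter]
  have h2 := Γ.isTree.card_edgeFinset
  rw [Fintype.card_fin] at h2
  have h3 := Γ.graph.sum_degrees_eq_twice_card_edges
  have h4 : ∑ v, (Finset.univ.filter fun e => Γ.endVert e = v).card = Fintype.card E := by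
    rw [← Finset.card_univ, ← Finset.card_eq_sum_card_fiberwise fun _ _ => Finset.mem_univ _]
  rw [Finset.sum_congr rfl fun v _ => h1 v, Finset.sum_add_distrib, h3, h4]
  omega

theorem numVert_add_two_le : Γ.numVert + 2 ≤ Fintype.card E := by
  have h1 := Γ.sum_card_star
  have h2 : ∑ _v : Fin Γ.numVert, 3 ≤ ∑ v, Nat.card (Γ.Star v) :=
    Finset.sum_le_sum fun v _ => Γ.valency v
  simp only [Finset.sum_const, Finset.card_univ, Fintype.card_fin, smul_eq_mul] at h2
  omega

/-- Trivalent curves are those with the maximal number of vertices. -/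
theorem trivalent_iff : (∀ v, Nat.card (Γ.Star v) = 3) ↔ Γ.numVert + 2 = Fintype.card E := by
  have h1 := Γ.sum_card_star
  have h2 : ∀ v ∈ (Finset.univ : Finset (Fin Γ.numVert)), 3 ≤ Nat.card (Γ.Star v) :=
    fun v _ => Γ.valency v
  have h3 := Finset.sum_eq_sum_iff_of_le h2
  simp only [Finset.sum_const, Finset.card_univ, Fintype.card_fin, smul_eq_mul,
    Finset.mem_univ, true_implies] at h3
  constructor
  · intro h
    have h4 := h3.2 fun v => (h v).symm
    omega
  · intro h v
    exact (h3.1 (by omega) v).symm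

end AbstractCurve

section form

variable {V : Type*} [NormedAddCommGroup V] [NormedSpace ℝ V]

theorem update_pair_zero {X : Type*} (a b x : X) : Function.update ![a, b] 0 x = ![x, b] := by
  ext i; fin_cases i <;> rfl

theorem update_pair_one {X : Type*} (a b x : X) : Function.update ![a, b] 1 x = ![a, x] := by
  ext i; fin_cases i <;> rfl

/-- A two-form as a bilinear map. -/
def formBilin (ω : Form V) : V →ₗ[ℝ] V →ₗ[ℝ] ℝ :=
  LinearMap.mk₂ ℝ (fun a b => ω ![a, b])
    (fun a a' b => by
      have := ω.map_update_add ![a, b] 0 a a'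
      rwa [update_pair_zero, update_pair_zero, update_pair_zero] at this)
    (fun c a b => by
      have := ω.map_update_smul ![a, b] 0 c a
      rwa [update_pair_zero, update_pair_zero] at this)
    (fun a b b' => by
      have := ω.map_update_add ![a, b] 1 b b'
      rwa [update_pair_one, update_pair_one, update_pair_one] at this)
    (fun c a b => by
      have := ω.map_update_smul ![a, b] 1 c b
      rwa [update_pair_one, update_pair_one] at this)

theorem formBilin_apply (ω : Form V) (a b : V) : formBilin ω a b = ω ![a, b] := rfl

theorem formBilin_self (ω : Form V) (a : V) : formBilin ω a a = 0 :=
  ω.map_eq_zero_of_eq ![a, a] (i := 0) (j := 1) rfl (by simp)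

theorem formBilin_swap (ω : Form V) (a b : V) : formBilin ω a b = -formBilin ω b a := by
  have h := formBilin_self ω (a + b)
  simp only [map_add, LinearMap.add_apply, formBilin_self] at h
  linarith

variable {N : Submodule ℤ V} {E : Type*} (n : E → N) (e₀ : E)

/-- The slope of an edge which separates `e₀` from the ends in `S`. -/
def slopeSum (S : Finset (Leaf e₀)) : N := ∑ e ∈ S, n e

/-- The matrix of the values of a two-form on the slopes of the ends. -/
def formMatrix (ω : Form V) (a b : Leaf e₀) : ℝ := formBilin ω (n a) (n b)

variable {n e₀}

theorem coe_slopeSum (S : Finset (Leaf e₀)) : (slopeSum n e₀ S : V) = ∑ e ∈ S, (n e : V) := by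
  simp [slopeSum]

theorem formMatrix_antisymm (ω : Form V) (a b : Leaf e₀) :
    formMatrix n e₀ ω a b = -formMatrix n e₀ ω b a := formBilin_swap ω _ _

theorem sum_formMatrix (ω : Form V) (e : Leaf e₀) (S : Finset (Leaf e₀)) :
    ∑ a ∈ S, formMatrix n e₀ ω e a = formBilin ω (n e) (slopeSum n e₀ S) := by
  rw [coe_slopeSum, map_sum]
  rfl

theorem blockSum_formMatrix (ω : Form V) (B C : Finset (Leaf e₀)) :
    blockSum (formMatrix n e₀ ω) B C = formBilin ω (slopeSum n e₀ B) (slopeSum n e₀ C) := by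
  rw [blockSum, Finset.sum_congr rfl fun b _ => sum_formMatrix ω b C]
  rw [coe_slopeSum B, map_sum, LinearMap.sum_apply]

theorem slopeSum_univ [Fintype E] [DecidableEq E] (hsum : ∑ e, n e = 0) :
    slopeSum n e₀ Finset.univ = -n e₀ := by
  rw [slopeSum, eq_neg_iff_add_eq_zero, ← hsum]
  rw [← Finset.add_sum_erase _ _ (Finset.mem_univ e₀), add_comm]
  congr 1
  rw [Finset.sum_subtype (Finset.univ.erase e₀) (p := fun e => e ≠ e₀) (by simp)]

end form

namespace Curve

variable {V : Type*} [NormedAddCommGroup V] [NormedSpace ℝ V] {N : Submodule ℤ V} {E : Type*}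
  {n : E → N} {e₀ : E}

theorem slope_swap (Γ : Curve n) {v w : Fin Γ.numVert} (h : Γ.graph.Adj v w) :
    Γ.slope v w = -Γ.slope w v := by
  have h1 := Γ.affine v w h
  have h2 := Γ.affine w v h.symm
  rw [Sym2.eq_swap] at h2
  have hl := Γ.len_pos s(v, w) h
  have h3 : Γ.len s(v, w) • ((Γ.slope v w : V) + Γ.slope w v) = 0 := by
    rw [smul_add]
    have : Γ.pos w = Γ.pos w + (Γ.len s(v, w) • (Γ.slope w v : V) +
        Γ.len s(v, w) • (Γ.slope v w : V)) := by
      nth_rewrite 1 [h1, h2]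
      abel
    rw [add_comm]
    exact left_eq_add.1 this
  rw [eq_neg_iff_add_eq_zero]
  exact Subtype.ext ((smul_eq_zero.1 h3).resolve_left hl.ne')

variable [Fintype E] [DecidableEq E]

/-- By balancing, the slope of an edge is the sum of the slopes of the ends beyond it; this is the
inductive step. -/
theorem sum_outSlope_ne_up (Γ : Curve n) (v : Fin Γ.numVert) [Fintype (Γ.Star v)]
    [DecidableEq (Γ.Star v)]
    (h : ∀ w, Γ.parent e₀ w = v → w ≠ v → Γ.slope v w = slopeSum n e₀ (Γ.clade e₀ w)) :
    ∑ x ∈ Finset.univ.erase (Γ.up e₀ v), outSlope n Γ.toAbstractCurve Γ.slope v x =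
      slopeSum n e₀ (Γ.clade e₀ v) := by
  rw [slopeSum, ← AbstractCurve.sum_clade]
  refine Finset.sum_congr rfl fun x hx => ?_
  have hx := (Finset.mem_erase.1 hx).1
  rcases x with w | e
  · obtain ⟨h1, h2⟩ := AbstractCurve.child_of_ne_up hx
    exact h w h1 h2
  · have he := AbstractCurve.end_ne_of_ne_up hx
    simp [AbstractCurve.block, outSlope, he]

theorem outSlope_up (Γ : Curve n) (v : Fin Γ.numVert)
    (h : ∀ w, Γ.parent e₀ w = v → w ≠ v → Γ.slope v w = slopeSum n e₀ (Γ.clade e₀ w)) :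
    outSlope n Γ.toAbstractCurve Γ.slope v (Γ.up e₀ v) = -slopeSum n e₀ (Γ.clade e₀ v) := by
  classical
  have hf : Finite (Γ.Star v) := by unfold AbstractCurve.Star; infer_instance
  have := Fintype.ofFinite (Γ.Star v)
  have hb := Γ.balanced v
  rw [finsum_eq_sum_of_fintype, ← Finset.add_sum_erase _ _ (Finset.mem_univ (Γ.up e₀ v)),
    sum_outSlope_ne_up Γ v h] at hb
  exact eq_neg_of_add_eq_zero_left hb

/-- The slope of an edge is the sum of the slopes of the ends beyond this edge. -/
theorem slope_parent (Γ : Curve n) (v : Fin Γ.numVert) :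
    v ≠ Γ.endVert e₀ → Γ.slope (Γ.parent e₀ v) v = slopeSum n e₀ (Γ.clade e₀ v) := by
  refine AbstractCurve.child_induction (e₀ := e₀) (P := fun v => v ≠ Γ.endVert e₀ →
    Γ.slope (Γ.parent e₀ v) v = slopeSum n e₀ (Γ.clade e₀ v)) (fun v ih hv => ?_) v
  have hp := Γ.isParent e₀
  have h1 := outSlope_up Γ v fun w hw hne => by
    have := ih w hw hne (hp.ne_root_of_child hw hne)
    rwa [hw] at this
  rw [AbstractCurve.up, dif_neg hv] at h1
  have h2 : Γ.slope v (Γ.parent e₀ v) = -slopeSum n e₀ (Γ.clade e₀ v) := h1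
  rw [Γ.slope_swap (hp.adj hv).symm, h2, neg_neg]

theorem outSlope_eq_slopeSum_block (Γ : Curve n) {v : Fin Γ.numVert} {x : Γ.Star v}
    (hx : x ≠ Γ.up e₀ v) :
    outSlope n Γ.toAbstractCurve Γ.slope v x = slopeSum n e₀ (Γ.block e₀ v x) := by
  rcases x with w | e
  · obtain ⟨h1, h2⟩ := AbstractCurve.child_of_ne_up hx
    have := slope_parent (e₀ := e₀) Γ w ((Γ.isParent e₀).ne_root_of_child h1 h2)
    rw [h1] at this
    exact this
  · have he := AbstractCurve.end_ne_of_ne_up hx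
    simp [AbstractCurve.block, outSlope, slopeSum, he]

theorem outSlope_up_eq (Γ : Curve n) (v : Fin Γ.numVert) :
    outSlope n Γ.toAbstractCurve Γ.slope v (Γ.up e₀ v) = -slopeSum n e₀ (Γ.clade e₀ v) :=
  outSlope_up Γ v fun w hw hne => by
    have := slope_parent (e₀ := e₀) Γ w ((Γ.isParent e₀).ne_root_of_child hw hne)
    rwa [hw] at this

open scoped Classical in
variable (e₀) in
/-- The length of the edge from the vertex with clade `H` to its parent. It is meaningless for the
clade of the root, which has no parent, and zero if `H` is not a clade. -/
def edgeLength (Γ : Curve n) (H : Finset (Leaf e₀)) : ℝ :=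
  if h : ∃ v, Γ.clade e₀ v = H then Γ.len s(Γ.parent e₀ h.choose, h.choose) else 0

theorem edgeLength_clade (Γ : Curve n) (v : Fin Γ.numVert) :
    Γ.edgeLength e₀ (Γ.clade e₀ v) = Γ.len s(Γ.parent e₀ v, v) := by
  have h : ∃ w, Γ.clade e₀ w = Γ.clade e₀ v := ⟨v, rfl⟩
  rw [edgeLength, dif_pos h, AbstractCurve.clade_injective h.choose_spec]

theorem edgeLength_pos (Γ : Curve n) {H : Finset (Leaf e₀)} (hH : H ∈ Γ.clades e₀)
    (hne : H ≠ Finset.univ) : 0 < Γ.edgeLength e₀ H := by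
  obtain ⟨v, rfl⟩ := AbstractCurve.mem_clades.1 hH
  have hv : v ≠ Γ.endVert e₀ := by
    rintro rfl
    exact hne AbstractCurve.clade_root
  rw [edgeLength_clade]
  exact Γ.len_pos _ ((Γ.isParent e₀).adj hv).symm

/-- The position of a vertex in terms of the lengths and the clades. -/
theorem pos_eq (Γ : Curve n) (x : Fin Γ.numVert) :
    Γ.pos x = Γ.pos (Γ.endVert e₀) + ∑ H ∈ Γ.clades e₀ with (H ≠ Finset.univ ∧ Γ.clade e₀ x ⊆ H),
      Γ.edgeLength e₀ H • (slopeSum n e₀ H : V) := by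
  have hp := Γ.isParent e₀
  obtain ⟨k, hk⟩ : ∃ k, k = Γ.graph.dist x (Γ.endVert e₀) := ⟨_, rfl⟩
  induction k using Nat.strong_induction_on generalizing x with
  | _ k ih =>
    by_cases hx : x = Γ.endVert e₀
    · rw [Finset.sum_eq_zero, add_zero, hx]
      intro H hH
      obtain ⟨-, h1, h2⟩ := Finset.mem_filter.1 hH
      rw [hx, AbstractCurve.clade_root] at h2
      exact absurd (Finset.univ_subset_iff.1 h2) h1
    · have h1 : (Γ.clades e₀).filter (fun H => H ≠ Finset.univ ∧ Γ.clade e₀ x ⊆ H) =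
          insert (Γ.clade e₀ x) ((Γ.clades e₀).filter fun H =>
            H ≠ Finset.univ ∧ Γ.clade e₀ (Γ.parent e₀ x) ⊆ H) := by
        ext H
        simp only [Finset.mem_filter, Finset.mem_insert, AbstractCurve.mem_clades]
        constructor
        · rintro ⟨⟨v, rfl⟩, h1, h2⟩
          rcases (AbstractCurve.below_of_clade_subset h2).eq_or_parent with rfl | h
          · exact Or.inl rfl
          · exact Or.inr ⟨⟨v, rfl⟩, h1, AbstractCurve.clade_mono h⟩
        · rintro (rfl | ⟨⟨v, rfl⟩, h1, h2⟩)
          · refine ⟨⟨x, rfl⟩, fun h => hx ?_, subset_rfl⟩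
            rw [← AbstractCurve.clade_root (Γ := Γ.toAbstractCurve) (e₀ := e₀)] at h
            exact AbstractCurve.clade_injective h
          · exact ⟨⟨v, rfl⟩, h1, (AbstractCurve.clade_mono (below_parent x)).trans h2⟩
      have h2 : Γ.clade e₀ x ∉ (Γ.clades e₀).filter fun H =>
            H ≠ Finset.univ ∧ Γ.clade e₀ (Γ.parent e₀ x) ⊆ H := fun h =>
        (AbstractCurve.clade_child_ssubset rfl (hp.ne hx).symm).2 (Finset.mem_filter.1 h).2.2
      rw [h1, Finset.sum_insert h2, Γ.affine (Γ.parent e₀ x) x (hp.adj hx).symm,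
        ih _ (hk ▸ hp.lt x hx) _ rfl, edgeLength_clade, slope_parent Γ x hx]
      abel

theorem moment_leaf (Γ : Curve n) (ω : Form V) (e : Leaf e₀) :
    Γ.moment ω e = formBilin ω (n e) (Γ.pos (Γ.endVert e₀)) +
      ∑ H ∈ Γ.clades e₀ with (H ≠ Finset.univ ∧ e ∈ H),
        Γ.edgeLength e₀ H * ∑ a ∈ H, formMatrix n e₀ ω e a := by
  have h1 : Γ.moment ω e = formBilin ω (n e) (Γ.pos (Γ.endVert e)) := rfl
  rw [h1, pos_eq (e₀ := e₀) Γ (Γ.endVert e), map_add, map_sum]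
  congr 1
  refine Finset.sum_congr (Finset.filter_congr fun H hH => and_congr_right fun _ => ?_)
    fun H _ => ?_
  · obtain ⟨v, rfl⟩ := AbstractCurve.mem_clades.1 hH
    rw [AbstractCurve.mem_clade, AbstractCurve.clade_subset_iff]
  · rw [map_smul, smul_eq_mul, sum_formMatrix]

/-- The variation of the moments of the leaves when the edge from the vertex with clade `H` to its
parent is stretched by one. -/
def _root_.RefinedTropical.ray {I : Type*} [DecidableEq I] (W : I → I → ℝ) (H : Finset I) :
    I → ℝ := fun e => if e ∈ H then ∑ a ∈ H, W e a else 0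

theorem iso_of_clades_eq {Γ Γ' : Curve n} (h : Γ.clades e₀ = Γ'.clades e₀)
    (hl : ∀ H ∈ Γ.clades e₀, H ≠ Finset.univ → Γ.edgeLength e₀ H = Γ'.edgeLength e₀ H)
    (hr : Γ.pos (Γ.endVert e₀) = Γ'.pos (Γ'.endVert e₀)) : Iso Γ Γ' := by
  obtain ⟨φ, h1, h2⟩ := AbstractCurve.exists_iso_of_clades_eq h
  have hp := Γ.isParent e₀
  have key : ∀ v w, Γ.parent e₀ v = w → v ≠ w → Γ'.parent e₀ (φ v) = φ w := by
    intro v w hvw hne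
    have hne' : φ v ≠ φ w := fun h => hne (φ.injective h)
    rw [AbstractCurve.parent_eq_iff hne', h2, h2]
    rw [AbstractCurve.parent_eq_iff hne] at hvw
    refine ⟨hvw.1, fun u => ?_⟩
    have := hvw.2 (φ.symm u)
    rwa [← h2 (φ.symm u), φ.apply_symm_apply] at this
  have hlen : ∀ v w, Γ.parent e₀ v = w → v ≠ w → Γ'.len s(φ v, φ w) = Γ.len s(v, w) := by
    intro v w hvw hne
    have e1 := edgeLength_clade (e₀ := e₀) Γ v
    have e2 := edgeLength_clade (e₀ := e₀) Γ' (φ v)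
    rw [key v w hvw hne, h2, Sym2.eq_swap] at e2
    rw [hvw, Sym2.eq_swap] at e1
    rw [← e1, ← e2]
    refine (hl _ (AbstractCurve.mem_clades.2 ⟨v, rfl⟩) fun hu => ?_).symm
    rw [← AbstractCurve.clade_root (Γ := Γ.toAbstractCurve) (e₀ := e₀)] at hu
    have := AbstractCurve.clade_injective hu
    exact hp.ne_root_of_child hvw hne this
  refine ⟨φ, h1, fun v w hvw => ?_, fun v => ?_⟩
  · obtain ⟨hne, h3 | h3⟩ := (hp.adj_iff v w).1 hvw
    · exact hlen v w h3 hne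
    · rw [Sym2.eq_swap, Sym2.eq_swap (a := v)]
      exact hlen w v h3 hne.symm
  · rw [pos_eq (e₀ := e₀) Γ v, pos_eq (e₀ := e₀) Γ' (φ v), hr, h, h2]
    congr 1
    refine Finset.sum_congr rfl fun H hH => ?_
    obtain ⟨h3, h4, -⟩ := Finset.mem_filter.1 hH
    rw [hl H (h ▸ h3) h4]

end Curve

/-! ### Construction of tropical curves -/

/-- A family of sets of leaves which are the clades of a rooted tree. -/
structure IsHierarchy {I : Type*} [Fintype I] (𝓗 : Finset (Finset I)) : Prop where
  univ_mem : Finset.univ ∈ 𝓗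
  two_le : ∀ H ∈ 𝓗, 2 ≤ H.card
  laminar : ∀ H ∈ 𝓗, ∀ H' ∈ 𝓗, H ⊆ H' ∨ H' ⊆ H ∨ Disjoint H H'

section construction

variable {E : Type*} [Fintype E] [DecidableEq E] {e₀ : E} {𝓗 : Finset (Finset (Leaf e₀))}

theorem IsHierarchy.exists_least {I : Type*} [Fintype I] [DecidableEq I] {𝓗 : Finset (Finset I)}
    (h : IsHierarchy 𝓗) (P : Finset I → Prop) (hP : P Finset.univ)
    (hdisj : ∀ H ∈ 𝓗, ∀ H' ∈ 𝓗, P H → P H' → ¬ Disjoint H H') :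
    ∃ H ∈ 𝓗, P H ∧ ∀ H' ∈ 𝓗, P H' → H ⊆ H' := by
  classical
  obtain ⟨H, hH, hmin⟩ := Finset.exists_min_image (𝓗.filter P) Finset.card
    ⟨Finset.univ, Finset.mem_filter.2 ⟨h.univ_mem, hP⟩⟩
  obtain ⟨h1, h2⟩ := Finset.mem_filter.1 hH
  refine ⟨H, h1, h2, fun H' h3 h4 => ?_⟩
  rcases h.laminar H h1 H' h3 with h5 | h5 | h5
  · exact h5
  · exact (Finset.eq_of_subset_of_card_le h5 (hmin H' (Finset.mem_filter.2 ⟨h3, h4⟩))).symm.subset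
  · exact absurd h5 (hdisj H h1 H' h3 h2 h4)

theorem AbstractCurve.clade_eq_of_isParent {Γ : AbstractCurve E}
    {p : Fin Γ.numVert → Fin Γ.numVert} {d : Fin Γ.numVert → ℕ}
    {s : Fin Γ.numVert → Finset (Leaf e₀)} (hp : IsParent Γ.graph (Γ.endVert e₀) p d)
    (hs : ∀ (e : Leaf e₀) v, Below p (Γ.endVert e) v ↔ e ∈ s v) : Γ.clade e₀ = s := by
  funext v
  ext e
  rw [AbstractCurve.mem_clade, (Γ.isParent e₀).eq_of_isParent hp, hs]

/-- Every hierarchy is the family of clades of an abstract curve with arbitrary lengths. -/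
theorem IsHierarchy.exists_abstractCurve (h : IsHierarchy 𝓗) (l : Finset (Leaf e₀) → ℝ)
    (hl : ∀ H ∈ 𝓗, H ≠ Finset.univ → 0 < l H) :
    ∃ Γ : AbstractCurve E, Γ.clades e₀ = 𝓗 ∧
      ∀ v w, Γ.len s(v, w) = l (Γ.clade e₀ v ∩ Γ.clade e₀ w) := by
  classical
  set k := 𝓗.card with hk
  let s : Fin k → Finset (Leaf e₀) := fun i => (𝓗.equivFin.symm i).1
  have hs : ∀ i, s i ∈ 𝓗 := fun i => (𝓗.equivFin.symm i).2
  have hsinj : Function.Injective s := fun i j hij => 𝓗.equivFin.symm.injective (Subtype.ext hij)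
  have hssurj : ∀ H ∈ 𝓗, ∃ i, s i = H := fun H hH =>
    ⟨𝓗.equivFin ⟨H, hH⟩, by simp [s]⟩
  have hsne : ∀ i, (s i).Nonempty := fun i => Finset.card_pos.1 (by
    have := h.two_le _ (hs i); omega)
  obtain ⟨r, hr⟩ := hssurj _ h.univ_mem
  have hpar : ∀ i, i ≠ r → ∃ j, s i ⊂ s j ∧ ∀ m, s i ⊂ s m → s j ⊆ s m := by
    intro i hi
    obtain ⟨H, h1, h2, h3⟩ := h.exists_least (fun H => s i ⊂ H)
      ((Finset.subset_univ _).ssubset_of_ne fun h' => hi (hsinj (h'.trans hr.symm)))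
      (fun H _ H' _ hH hH' => by
        obtain ⟨x, hx⟩ := hsne i
        exact Finset.not_disjoint_iff.2 ⟨x, hH.1 hx, hH'.1 hx⟩)
    obtain ⟨j, rfl⟩ := hssurj H h1
    exact ⟨j, h2, fun m => h3 _ (hs m)⟩
  choose! p₀ hp₁ hp₂ using hpar
  let p : Fin k → Fin k := fun i => if i = r then r else p₀ i
  have hpr : p r = r := if_pos rfl
  have hpne : ∀ i, i ≠ r → p i = p₀ i := fun i hi => if_neg hi
  have hp1 : ∀ i, i ≠ r → s i ⊂ s (p i) := fun i hi => by rw [hpne i hi]; exact hp₁ i hi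
  have hp2 : ∀ i, i ≠ r → ∀ m, s i ⊂ s m → s (p i) ⊆ s m := fun i hi => by
    rw [hpne i hi]; exact hp₂ i hi
  have hend : ∀ e : E, ∃ i, (e = e₀ → i = r) ∧
      ∀ he : e ≠ e₀, ⟨e, he⟩ ∈ s i ∧ ∀ j, ⟨e, he⟩ ∈ s j → s i ⊆ s j := by
    intro e
    by_cases he : e = e₀
    · exact ⟨r, fun _ => rfl, fun h => absurd he h⟩
    · obtain ⟨H, h1, h2, h3⟩ := h.exists_least (fun H => ⟨e, he⟩ ∈ H) (Finset.mem_univ _)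
        (fun H _ H' _ hH hH' => Finset.not_disjoint_iff.2 ⟨_, hH, hH'⟩)
      obtain ⟨j, rfl⟩ := hssurj H h1
      exact ⟨j, fun h => absurd h he, fun _ => ⟨h2, fun m => h3 _ (hs m)⟩⟩
  choose endV hend₁ hend₂ using hend
  let G : SimpleGraph (Fin k) :=
    { Adj := fun v w => v ≠ w ∧ (p v = w ∨ p w = v)
      symm := ⟨fun v w h => ⟨h.1.symm, h.2.symm⟩⟩
      loopless := ⟨fun v h => h.1 rfl⟩ }
  have hparent : IsParent G r p fun i => (Finset.univ : Finset (Leaf e₀)).card - (s i).card := by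
    refine ⟨fun _ _ => Iff.rfl, hpr, fun v hv => ?_⟩
    have h1 := Finset.card_lt_card (hp1 v hv)
    have h2 := Finset.card_le_univ (s (p v))
    rw [← Finset.card_univ] at h2
    omega
  have hbelow : ∀ v w, Below p v w ↔ s v ⊆ s w := by
    intro v w
    constructor
    · rintro ⟨m, rfl⟩
      induction m with
      | zero => exact subset_rfl
      | succ m ih =>
        rw [Function.iterate_succ_apply']
        refine ih.trans ?_
        by_cases hv : p^[m] v = r
        · rw [hv, hpr]
        · exact (hp1 _ hv).1
    · obtain ⟨m, hm⟩ : ∃ m, m = (Finset.univ : Finset (Leaf e₀)).card - (s v).card := ⟨_, rfl⟩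
      induction m using Nat.strong_induction_on generalizing v with
      | _ m ih =>
        intro hvw
        by_cases hv : v = w
        · rw [hv]; exact Below.refl _
        have hss : s v ⊂ s w := hvw.ssubset_of_ne fun h' => hv (hsinj h')
        have hvr : v ≠ r := by
          rintro rfl
          rw [hr] at hss
          exact hss.2 (Finset.subset_univ _)
        exact (below_parent v).trans
          (ih _ (hm ▸ hparent.lt v hvr) (p v) rfl (hp2 v hvr w hss))
  have hmem : ∀ (e : Leaf e₀) v, Below p (endV e) v ↔ e ∈ s v := fun e v => by
    rw [hbelow]
    exact ⟨fun h' => h' (hend₂ e e.2).1, fun h' => (hend₂ e e.2).2 v h'⟩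
  -- the vertices are at least trivalent
  let blk (v : Fin k) : ({w // G.Adj v w} ⊕ {e // endV e = v}) → Finset (Leaf e₀) :=
    Sum.elim (fun w => s w) fun e => Finset.univ.filter fun e' => e'.1 = e.1
  have hbranch : ∀ v, ∀ e ∈ s v, ∃ x, e ∈ blk v x ∧ blk v x ⊂ s v := by
    intro v e he
    by_cases hev : endV e = v
    · refine ⟨Sum.inr ⟨e, hev⟩, by simp [blk], ?_⟩
      have h1 : blk v (Sum.inr ⟨e, hev⟩) = {e} := by
        ext e'
        simp [blk, Subtype.ext_iff]
      rw [h1]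
      refine (Finset.singleton_subset_iff.2 he).ssubset_of_ne fun h' => ?_
      have := h.two_le _ (hs v)
      rw [← h'] at this
      simp at this
    · obtain ⟨u, h1, h2, h3⟩ := ((hmem e v).2 he).exists_child hev
      refine ⟨Sum.inl ⟨u, h3.symm, Or.inr h2⟩, (hmem e u).1 h1, ?_⟩
      change s u ⊂ s v
      rw [← h2]
      exact hp1 u (hparent.ne_root_of_child h2 h3)
  have hup : ∀ v, ∃ x, ¬ ∃ e, e ∈ blk v x ∧ blk v x ⊂ s v := by
    intro v
    by_cases hv : v = r
    · refine ⟨Sum.inr ⟨e₀, by rw [hend₁ e₀ rfl, hv]⟩, ?_⟩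
      rintro ⟨e, h1, -⟩
      have : e.1 = e₀ := by simpa [blk] using h1
      exact e.2 this
    · refine ⟨Sum.inl ⟨p v, (hparent.ne hv).symm, Or.inl rfl⟩, ?_⟩
      rintro ⟨e, -, h2⟩
      exact h2.2 (hp1 v hv).1
  have hval : ∀ v, 3 ≤ Nat.card ({w // G.Adj v w} ⊕ {e // endV e = v}) := by
    intro v
    obtain ⟨y, hy⟩ := hup v
    obtain ⟨e, he⟩ := hsne v
    obtain ⟨x, hx1, hx2⟩ := hbranch v e he
    obtain ⟨e', he', hne⟩ := Finset.exists_of_ssubset hx2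
    obtain ⟨x', hx1', hx2'⟩ := hbranch v e' he'
    have h1 : y ≠ x := fun h' => hy ⟨e, h' ▸ hx1, h' ▸ hx2⟩
    have h2 : y ≠ x' := fun h' => hy ⟨e', h' ▸ hx1', h' ▸ hx2'⟩
    have h3 : x ≠ x' := fun h' => hne (h' ▸ hx1')
    rw [Nat.card_eq_fintype_card]
    have h4 : ({y, x, x'} : Finset _).card = 3 := Finset.card_eq_three.2 ⟨y, x, x', h1, h2, h3, rfl⟩
    rw [← h4]
    exact Finset.card_le_univ _
  have hinter : ∀ i, i ≠ r → s i ∩ s (p i) = s i := fun i hi =>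
    Finset.inter_eq_left.2 (hp1 i hi).1
  have hrne : ∀ i, i ≠ r → s i ≠ Finset.univ := fun i hi h' => hi (hsinj (h'.trans hr.symm))
  have hlen : ∀ z ∈ G.edgeSet, 0 < Sym2.lift
      ⟨fun v w => l (s v ∩ s w), fun _ _ => congrArg l (Finset.inter_comm _ _)⟩ z := by
    intro z
    induction z using Sym2.ind with
    | _ v w =>
      intro hz
      rw [SimpleGraph.mem_edgeSet] at hz
      rw [Sym2.lift_mk]
      rcases hz with ⟨hne, h' | h'⟩
      · have hv : v ≠ r := hparent.ne_root_of_child h' hne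
        change 0 < l (s v ∩ s w)
        rw [← h', hinter v hv]
        exact hl _ (hs v) (hrne v hv)
      · have hw : w ≠ r := hparent.ne_root_of_child h' hne.symm
        change 0 < l (s v ∩ s w)
        rw [← h', Finset.inter_comm, hinter w hw]
        exact hl _ (hs w) (hrne w hw)
  let Γ : AbstractCurve E :=
    { numVert := k
      graph := G
      isTree := hparent.isTree
      len := Sym2.lift ⟨fun v w => l (s v ∩ s w), fun _ _ => congrArg l (Finset.inter_comm _ _)⟩
      len_pos := hlen
      endVert := endV
      valency := hval }
  have hparent' : IsParent Γ.graph (Γ.endVert e₀) p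
      fun i => (Finset.univ : Finset (Leaf e₀)).card - (s i).card := by
    change IsParent G (endV e₀) p _
    rw [hend₁ e₀ rfl]
    exact hparent
  have hclade : Γ.clade e₀ = s := AbstractCurve.clade_eq_of_isParent hparent' hmem
  refine ⟨Γ, ?_, fun v w => ?_⟩
  · ext H
    rw [AbstractCurve.mem_clades, hclade]
    exact ⟨fun ⟨v, hv⟩ => hv ▸ hs v, hssurj H⟩
  · rw [hclade]
    rfl

variable {V : Type*} [NormedAddCommGroup V] [NormedSpace ℝ V] {N : Submodule ℤ V} {n : E → N}

/-- Every hierarchy is the family of clades of a parametrized curve with arbitrary lengths and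
position. -/
theorem IsHierarchy.exists_curve (h : IsHierarchy 𝓗) (hsum : ∑ e, n e = 0)
    (l : Finset (Leaf e₀) → ℝ) (hl : ∀ H ∈ 𝓗, H ≠ Finset.univ → 0 < l H) (x₀ : V) :
    ∃ Γ : Curve n, Γ.clades e₀ = 𝓗 ∧ Γ.pos (Γ.endVert e₀) = x₀ ∧
      ∀ H ∈ 𝓗, H ≠ Finset.univ → Γ.edgeLength e₀ H = l H := by
  classical
  obtain ⟨Γ, hΓ, hlen⟩ := h.exists_abstractCurve l hl
  have hp := Γ.isParent e₀
  let slope : Fin Γ.numVert → Fin Γ.numVert → N := fun v w =>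
    if Γ.clade e₀ w ⊂ Γ.clade e₀ v then slopeSum n e₀ (Γ.clade e₀ w)
    else -slopeSum n e₀ (Γ.clade e₀ v)
  let pos : Fin Γ.numVert → V := fun v => x₀ +
    ∑ H ∈ 𝓗 with (H ≠ Finset.univ ∧ Γ.clade e₀ v ⊆ H), l H • (slopeSum n e₀ H : V)
  have hss : ∀ v, v ≠ Γ.endVert e₀ → Γ.clade e₀ v ⊂ Γ.clade e₀ (Γ.parent e₀ v) := fun v hv =>
    AbstractCurve.clade_child_ssubset rfl (hp.ne hv).symm
  have hpos : ∀ v, v ≠ Γ.endVert e₀ → pos v = pos (Γ.parent e₀ v) +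
      l (Γ.clade e₀ v) • (slopeSum n e₀ (Γ.clade e₀ v) : V) := by
    intro v hv
    have h1 : 𝓗.filter (fun H => H ≠ Finset.univ ∧ Γ.clade e₀ v ⊆ H) =
        insert (Γ.clade e₀ v) (𝓗.filter fun H =>
          H ≠ Finset.univ ∧ Γ.clade e₀ (Γ.parent e₀ v) ⊆ H) := by
      ext H
      simp only [Finset.mem_filter, Finset.mem_insert]
      constructor
      · rintro ⟨h0, h1, h2⟩
        obtain ⟨w, rfl⟩ := AbstractCurve.mem_clades.1 (hΓ ▸ h0)
        rcases (AbstractCurve.below_of_clade_subset h2).eq_or_parent with rfl | h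
        · exact Or.inl rfl
        · exact Or.inr ⟨h0, h1, AbstractCurve.clade_mono h⟩
      · rintro (rfl | ⟨h0, h1, h2⟩)
        · refine ⟨hΓ ▸ AbstractCurve.mem_clades.2 ⟨v, rfl⟩, fun h => hv ?_, subset_rfl⟩
          rw [← AbstractCurve.clade_root (Γ := Γ) (e₀ := e₀)] at h
          exact AbstractCurve.clade_injective h
        · exact ⟨h0, h1, (hss v hv).1.trans h2⟩
    have h2 : Γ.clade e₀ v ∉ 𝓗.filter fun H =>
        H ≠ Finset.univ ∧ Γ.clade e₀ (Γ.parent e₀ v) ⊆ H := fun h =>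
      (hss v hv).2 (Finset.mem_filter.1 h).2.2
    simp only [pos]
    rw [h1, Finset.sum_insert h2]
    abel
  have hlen' : ∀ v, v ≠ Γ.endVert e₀ → Γ.len s(Γ.parent e₀ v, v) = l (Γ.clade e₀ v) :=
      fun v hv => by
    rw [hlen, Finset.inter_eq_right.2 (hss v hv).1]
  have haff : ∀ v w, Γ.graph.Adj v w → pos w = pos v + Γ.len s(v, w) • (slope v w : V) := by
    intro v w hvw
    obtain ⟨hne, h1 | h1⟩ := (hp.adj_iff v w).1 hvw
    · have hv := hp.ne_root_of_child h1 hne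
      subst h1
      have h2 : slope v (Γ.parent e₀ v) = -slopeSum n e₀ (Γ.clade e₀ v) :=
        if_neg fun h' => h'.2 (hss v hv).1
      rw [h2, Sym2.eq_swap, hlen' v hv, hpos v hv]
      simp
    · have hw := hp.ne_root_of_child h1 hne.symm
      subst h1
      have h2 : slope (Γ.parent e₀ w) w = slopeSum n e₀ (Γ.clade e₀ w) := if_pos (hss w hw)
      rw [h2, hlen' w hw, hpos w hw]
  have hbal : ∀ v, ∑ᶠ f, outSlope n Γ slope v f = 0 := by
    intro v
    have hf : Finite (Γ.Star v) := by unfold AbstractCurve.Star; infer_instance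
    have := Fintype.ofFinite (Γ.Star v)
    rw [finsum_eq_sum_of_fintype, ← Finset.add_sum_erase _ _ (Finset.mem_univ (Γ.up e₀ v))]
    have h1 : ∑ x ∈ Finset.univ.erase (Γ.up e₀ v), outSlope n Γ slope v x =
        slopeSum n e₀ (Γ.clade e₀ v) := by
      rw [slopeSum, ← AbstractCurve.sum_clade]
      refine Finset.sum_congr rfl fun x hx => ?_
      have hx := (Finset.mem_erase.1 hx).1
      rcases x with w | e
      · obtain ⟨h1, h2⟩ := AbstractCurve.child_of_ne_up hx
        have h3 := hss w.1 (hp.ne_root_of_child h1 h2)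
        rw [h1] at h3
        exact if_pos h3
      · have he := AbstractCurve.end_ne_of_ne_up hx
        simp [AbstractCurve.block, outSlope, he]
    rw [h1, AbstractCurve.up]
    split_ifs with hv
    · change n e₀ + _ = 0
      rw [hv, AbstractCurve.clade_root, slopeSum_univ hsum, add_neg_cancel]
    · change slope v (Γ.parent e₀ v) + _ = 0
      have h2 : slope v (Γ.parent e₀ v) = -slopeSum n e₀ (Γ.clade e₀ v) :=
        if_neg fun h' => h'.2 (hss v hv).1
      rw [h2, neg_add_cancel]
  refine ⟨{ toAbstractCurve := Γ, pos := pos, slope := slope, affine := haff, balanced := hbal },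
    hΓ, ?_, fun H hH hne => ?_⟩
  · change pos (Γ.endVert e₀) = x₀
    simp only [pos]
    rw [Finset.sum_eq_zero, add_zero]
    intro H hH
    obtain ⟨-, h1, h2⟩ := Finset.mem_filter.1 hH
    rw [AbstractCurve.clade_root] at h2
    exact absurd (Finset.univ_subset_iff.1 h2) h1
  · obtain ⟨v, rfl⟩ := AbstractCurve.mem_clades.1 (hΓ ▸ hH)
    refine (Curve.edgeLength_clade
      { toAbstractCurve := Γ, pos := pos, slope := slope, affine := haff,
        balanced := hbal } v).trans ?_
    refine hlen' v fun hv => hne ?_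
    rw [hv, AbstractCurve.clade_root]

end construction

/-! ### Weights of the vertices -/

section wedge

variable {V : Type*} [NormedAddCommGroup V] [NormedSpace ℝ V] {N : Submodule ℤ V}

theorem wedge_add_left (a a' b : N) : wedge (a + a') b = wedge a b + wedge a' b := by
  have := (exteriorPower.ιMulti ℤ 2 (M := N)).map_update_add ![a, b] 0 a a'
  rwa [update_pair_zero, update_pair_zero, update_pair_zero] at this

theorem wedge_add_right (a b b' : N) : wedge a (b + b') = wedge a b + wedge a b' := by
  have := (exteriorPower.ιMulti ℤ 2 (M := N)).map_update_add ![a, b] 1 b b'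
  rwa [update_pair_one, update_pair_one, update_pair_one] at this

theorem wedge_self (a : N) : wedge a a = 0 :=
  (exteriorPower.ιMulti ℤ 2 (M := N)).map_eq_zero_of_eq ![a, a] (i := 0) (j := 1) rfl (by simp)

theorem wedge_swap (a b : N) : wedge a b = -wedge b a := by
  have h := wedge_self (a + b)
  rw [wedge_add_left, wedge_add_right, wedge_add_right, wedge_self, wedge_self, zero_add,
    add_zero] at h
  exact eq_neg_of_add_eq_zero_left h

theorem wedge_zero_left (b : N) : wedge 0 b = 0 := by
  have := wedge_add_left 0 0 b
  rwa [add_zero, left_eq_add] at this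

theorem wedge_zero_right (a : N) : wedge a 0 = 0 := by
  rw [wedge_swap, wedge_zero_left, neg_zero]

theorem wedge_neg_left (a b : N) : wedge (-a) b = -wedge a b := by
  rw [eq_neg_iff_add_eq_zero, ← wedge_add_left, neg_add_cancel, wedge_zero_left]

theorem wedge_neg_right (a b : N) : wedge a (-b) = -wedge a b := by
  rw [wedge_swap, wedge_neg_left, neg_neg, wedge_swap]

variable {K : Submodule ℤ (Bivector N)}

theorem qpow_add (a b : Bivector N) : qpow K (a + b) = qpow K a * qpow K b := by
  simp [qpow, AddMonoidAlgebra.single_mul_single]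

theorem qpow_eq_one {a : Bivector N} (h : a ∈ K) : qpow K a = 1 := by
  rw [qpow, Submodule.mkQ_apply, (Submodule.Quotient.mk_eq_zero K).2 h]
  rfl

theorem qpow_zero : qpow K 0 = 1 := qpow_eq_one K.zero_mem

theorem proj_proj {K K' K'' : Submodule ℤ (Bivector N)} (h : K ≤ K') (h' : K' ≤ K'')
    (x : LaurentMod K) : proj h' (proj h x) = proj (h.trans h') x := by
  have : (proj h').comp (proj h) = proj (h.trans h') := by
    refine AddMonoidAlgebra.ringHom_ext (fun r => ?_) fun m => ?_
    · simp [proj]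
    · obtain ⟨m, rfl⟩ := K.mkQ_surjective m
      change proj h' (proj h (qpow K m)) = proj _ (qpow K m)
      rw [proj_qpow, proj_qpow, proj_qpow]
  exact DFunLike.congr_fun this x

theorem proj_self {K : Submodule ℤ (Bivector N)} (h : K ≤ K) (x : LaurentMod K) :
    proj h x = x := by
  have : proj h = RingHom.id (LaurentMod K) := by
    refine AddMonoidAlgebra.ringHom_ext (fun r => ?_) fun m => ?_
    · simp [proj]
    · obtain ⟨m, rfl⟩ := K.mkQ_surjective m
      exact proj_qpow h m
  exact DFunLike.congr_fun this x

variable {E : Type*} (n : E → N) (e₀ : E)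

/-- The monomial `q ^ (n_B ∧ n_C)`, where `n_B` and `n_C` are the sums of the slopes of the ends in
`B` and in `C`. -/
def wedgeWeight (K : Submodule ℤ (Bivector N)) (B C : Finset (Leaf e₀)) : LaurentMod K :=
  qpow K (wedge (slopeSum n e₀ B) (slopeSum n e₀ C))

variable {n e₀}

theorem slopeSum_empty : slopeSum n e₀ ∅ = 0 := rfl

theorem slopeSum_union [DecidableEq E] {B C : Finset (Leaf e₀)} (h : Disjoint B C) :
    slopeSum n e₀ (B ∪ C) = slopeSum n e₀ B + slopeSum n e₀ C := by
  rw [slopeSum, Finset.sum_union h]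
  rfl

variable (n e₀) in
theorem isBichar_wedgeWeight [DecidableEq E] (K : Submodule ℤ (Bivector N)) :
    IsBichar (wedgeWeight n e₀ K) where
  empty_left C := by rw [wedgeWeight, slopeSum_empty, wedge_zero_left, qpow_zero]
  empty_right B := by rw [wedgeWeight, slopeSum_empty, wedge_zero_right, qpow_zero]
  union_left A B C h := by
    rw [wedgeWeight, slopeSum_union h, wedge_add_left, qpow_add]
    rfl
  union_right A B C h := by
    rw [wedgeWeight, slopeSum_union h, wedge_add_right, qpow_add]
    rfl

theorem pairing_wedge_slopeSum (ω : Form V) (B C : Finset (Leaf e₀)) :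
    pairing N ω (wedge (slopeSum n e₀ B) (slopeSum n e₀ C)) =
      blockSum (formMatrix n e₀ ω) B C := by
  rw [blockSum_formMatrix, pairing_wedge, formBilin_apply]

theorem wedge_slopeSum_mem_vertexBivectors [Fintype E] {B C : Finset (Leaf e₀)} (hB : B ≠ ∅)
    (hC : C ≠ ∅) (hBC : Disjoint B C) :
    wedge (slopeSum n e₀ B) (slopeSum n e₀ C) ∈ vertexBivectors n := by
  classical
  have hsum : ∀ S : Finset (Leaf e₀), slopeSum n e₀ S =
      ∑ e ∈ S.map (Function.Embedding.subtype _), n e := fun S => by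
    rw [Finset.sum_map]
    rfl
  have hne : ∀ S : Finset (Leaf e₀), e₀ ∉ S.map (Function.Embedding.subtype _) := fun S h => by
    obtain ⟨x, -, hx⟩ := Finset.mem_map.1 h
    exact x.2 hx
  refine ⟨B.map (Function.Embedding.subtype _), C.map (Function.Embedding.subtype _),
    (B.map (Function.Embedding.subtype _) ∪ C.map (Function.Embedding.subtype _))ᶜ,
    (Finset.nonempty_iff_ne_empty.2 hB).map, (Finset.nonempty_iff_ne_empty.2 hC).map, ⟨e₀, ?_⟩,
    (Finset.disjoint_map _).2 hBC, ?_, ?_, fun e => ?_, by rw [hsum, hsum]⟩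
  · rw [Finset.mem_compl, Finset.mem_union, not_or]
    exact ⟨hne B, hne C⟩
  · exact disjoint_compl_right.mono_left Finset.subset_union_left
  · exact disjoint_compl_right.mono_left Finset.subset_union_right
  · simp only [Finset.mem_compl, Finset.mem_union]
    tauto

theorem wedge_mem_kernelLattice [Fintype E] {ω : Form V} {B C : Finset (Leaf e₀)} (hB : B ≠ ∅)
    (hC : C ≠ ∅) (hBC : Disjoint B C) (h : blockSum (formMatrix n e₀ ω) B C = 0) :
    wedge (slopeSum n e₀ B) (slopeSum n e₀ C) ∈ kernelLattice n ω :=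
  Submodule.subset_span ⟨wedge_slopeSum_mem_vertexBivectors hB hC hBC, by
    rw [pairing_wedge_slopeSum, h]⟩

theorem isTrivialOnZeros_wedgeWeight [Fintype E] {ω : Form V} {K : Submodule ℤ (Bivector N)}
    (hK : kernelLattice n ω ≤ K) :
    IsTrivialOnZeros (wedgeWeight n e₀ K) (formMatrix n e₀ ω) where
  antisymm := formMatrix_antisymm ω
  eq_one _ _ hB hC hBC h := qpow_eq_one (hK (wedge_mem_kernelLattice hB hC hBC h))

end wedge

section vertexWeight

variable {I R : Type*} [DecidableEq I] [CommRing R] {W : I → I → ℝ}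
  {q : Finset I → Finset I → R} {𝓗 : Finset (Finset I)} {A B C H : Finset I}

theorem IsBinary.subset_of_isBlock (h : IsBinary A 𝓗) (hHm : H ∈ 𝓗) (hBH : B ⊆ H)
    (hB : IsBlock 𝓗 B) (hC : IsBlock 𝓗 (H \ B)) {D : Finset I} (hDH : D ⊂ H) (hD : IsBlock 𝓗 D) :
    D ⊆ B ∨ D ⊆ H \ B := by
  rcases hD with hD | hD
  · have h1 := (h.filter (B := H) (Or.inl hHm)).eq_or_subset hBH (isBlock_filter hBH hB)
      (isBlock_filter Finset.sdiff_subset hC) (Finset.mem_filter.2 ⟨hD, hDH.1⟩)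
    exact h1.resolve_left hDH.ne
  · obtain ⟨d, rfl⟩ := Finset.card_eq_one.1 hD
    simp only [Finset.singleton_subset_iff, Finset.mem_sdiff]
    have := hDH.1 (Finset.mem_singleton_self d)
    tauto

/-- The splitting of a vertex of a binary tree is unique up to order. -/
theorem IsBinary.eq_or_eq_sdiff (h : IsBinary A 𝓗) (hHm : H ∈ 𝓗) (hBH : B ⊆ H) (hB0 : B ≠ ∅)
    (hC0 : H \ B ≠ ∅) (hB : IsBlock 𝓗 B) (hC : IsBlock 𝓗 (H \ B)) {D : Finset I} (hDH : D ⊆ H)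
    (hD0 : D ≠ ∅) (hD0' : H \ D ≠ ∅) (hD : IsBlock 𝓗 D) (hD' : IsBlock 𝓗 (H \ D)) :
    D = B ∨ D = H \ B := by
  have hss : D ⊂ H := hDH.ssubset_of_ne fun h => hD0' (by rw [h, Finset.sdiff_self])
  have hss' : H \ D ⊂ H := Finset.sdiff_ssubset hDH (Finset.nonempty_iff_ne_empty.2 hD0)
  have hU : D ∪ H \ D = H := Finset.union_sdiff_of_subset hDH
  have hUB : B ∪ H \ B = H := Finset.union_sdiff_of_subset hBH
  rcases h.subset_of_isBlock hHm hBH hB hC hss hD with h1 | h1 <;>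
    rcases h.subset_of_isBlock hHm hBH hB hC hss' hD' with h2 | h2
  · refine absurd (Finset.sdiff_eq_empty_iff_subset.2 ?_) hC0
    rw [← hU]
    exact Finset.union_subset h1 h2
  · left
    refine h1.antisymm fun x hx => ?_
    by_contra hxD
    exact (Finset.mem_sdiff.1 (h2 (Finset.mem_sdiff.2 ⟨hBH hx, hxD⟩))).2 hx
  · right
    refine h1.antisymm fun x hx => ?_
    by_contra hxD
    exact (Finset.mem_sdiff.1 hx).2 (h2 (Finset.mem_sdiff.2 ⟨(Finset.mem_sdiff.1 hx).1, hxD⟩))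
  · refine absurd (Finset.subset_empty.1 fun x hx => ?_) hB0
    have hx' := Finset.union_subset h1 h2
    rw [hU] at hx'
    exact absurd hx (Finset.mem_sdiff.1 (hx' (hBH hx))).2

open scoped Classical in
theorem IsBinary.vertexWeight_eq (h : IsBinary A 𝓗) (hW : ∀ a b, W a b = -W b a)
    (hBC : Disjoint B C) (hHm : B ∪ C ∈ 𝓗) (hB0 : B ≠ ∅) (hC0 : C ≠ ∅) (hB : IsBlock 𝓗 B)
    (hC : IsBlock 𝓗 C) :
    vertexWeight W q 𝓗 (B ∪ C) = if 0 < blockSum W B C then q B C - q C B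
      else if 0 < blockSum W C B then q C B - q B C else 0 := by
  have hs : (B ∪ C) \ B = C := Finset.union_sdiff_cancel_left hBC
  have hs' : (B ∪ C) \ C = B := Finset.union_sdiff_cancel_right hBC
  have hne : B ≠ C := fun h' => hB0 (Finset.disjoint_self_iff_empty _ |>.1 (h' ▸ hBC))
  have hsw := blockSum_swap hW B C
  rw [vertexWeight, Finset.sum_eq_add_of_mem B C (Finset.mem_powerset.2 Finset.subset_union_left)
    (Finset.mem_powerset.2 Finset.subset_union_right) hne, hs, hs']
  · simp only [hB, hC, true_and]
    split_ifs with h1 h2 h2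
    · linarith
    · ring
    · ring
    · ring
  · rintro D hD ⟨hDB, hDC⟩
    rw [if_neg]
    rintro ⟨h1, h2, h3⟩
    have hne := nonempty_of_blockSum_ne_zero h3.ne'
    have := h.eq_or_eq_sdiff hHm Finset.subset_union_left hB0 (by rwa [hs]) hB (by rwa [hs])
      (Finset.mem_powerset.1 hD) hne.1 hne.2 h1 h2
    rw [hs] at this
    tauto

end vertexWeight

/-! ### Solutions and their trees -/

section solutions

variable {V : Type*} [NormedAddCommGroup V] [NormedSpace ℝ V] {N : Submodule ℤ V} {E : Type*}
  [Fintype E] [DecidableEq E] {n : E → N} {ω : Form V} {e₀ : E} {δ : N} {μ : MomentSpace E} {p : V}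

theorem AbstractCurve.isHierarchy_clades (Γ : AbstractCurve E) : IsHierarchy (Γ.clades e₀) where
  univ_mem := mem_clades.2 ⟨_, clade_root⟩
  two_le H hH := by
    obtain ⟨v, rfl⟩ := mem_clades.1 hH
    exact two_le_card_clade v
  laminar H hH H' hH' := by
    obtain ⟨v, rfl⟩ := mem_clades.1 hH
    obtain ⟨w, rfl⟩ := mem_clades.1 hH'
    exact clade_laminar v w

variable (n ω e₀ δ μ p) in
/-- The point of the line of slope `δ` through `p` whose moment with respect to `n e₀` is the
prescribed one. The end `e₀` of a solution lies on the line of slope `n e₀` through this point. -/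
def basePoint : V := p + ((μ.1 e₀ - formBilin ω (n e₀) p) / formBilin ω (n e₀) δ) • (δ : V)

theorem formBilin_basePoint (hδ : ω ![(n e₀ : V), (δ : V)] ≠ 0) :
    formBilin ω (n e₀) (basePoint n ω e₀ δ μ p) = μ.1 e₀ := by
  have hδ' : formBilin ω (n e₀) δ ≠ 0 := hδ
  rw [basePoint, map_add, map_smul, smul_eq_mul, div_mul_cancel₀ _ hδ']
  ring

variable (n ω e₀ δ μ p) in
/-- The prescribed moments, relative to the base point. -/
def relMoment (e : Leaf e₀) : ℝ := μ.1 e - formBilin ω (n e) (basePoint n ω e₀ δ μ p)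

theorem solves_iff (hδ : ω ![(n e₀ : V), (δ : V)] ≠ 0) {Γ : Curve n} :
    Solves ω e₀ δ μ p Γ ↔ (∀ e, Γ.moment ω e = μ.1 e) ∧
      ∃ a : ℝ, Γ.pos (Γ.endVert e₀) = basePoint n ω e₀ δ μ p + a • (n e₀ : V) := by
  refine and_congr_right fun h => ?_
  have h0 : formBilin ω (n e₀) (Γ.pos (Γ.endVert e₀)) = μ.1 e₀ := h e₀
  constructor
  · intro h'
    obtain ⟨a, b, hab⟩ := Submodule.mem_span_pair.1 h'
    refine ⟨a, ?_⟩
    have h1 : Γ.pos (Γ.endVert e₀) = p + (a • (n e₀ : V) + b • (δ : V)) := by rw [hab]; abel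
    rw [h1, map_add, map_add, map_smul, map_smul, formBilin_self, smul_zero, zero_add,
      smul_eq_mul] at h0
    have h2 : b = (μ.1 e₀ - formBilin ω (n e₀) p) / formBilin ω (n e₀) δ := by
      rw [eq_div_iff (show formBilin ω (n e₀) δ ≠ 0 from hδ)]
      linarith
    rw [h1, basePoint, ← h2]
    abel
  · rintro ⟨a, ha⟩
    rw [ha, basePoint]
    exact Submodule.mem_span_pair.2 ⟨a, _, by abel⟩

/-- The moments of the leaves, relative to a point `P` on the line of the end `e₀`: the edge at the
root is treated as an edge of length `-a`. -/
theorem Curve.moment_leaf_sub (hsum : ∑ e, n e = 0) (Γ : Curve n) {P : V} {a : ℝ}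
    (h : Γ.pos (Γ.endVert e₀) = P + a • (n e₀ : V)) (e : Leaf e₀) {l : Finset (Leaf e₀) → ℝ}
    (hl : ∀ H ∈ Γ.clades e₀, H ≠ Finset.univ → l H = Γ.edgeLength e₀ H)
    (hl' : l Finset.univ = -a) :
    Γ.moment ω e - formBilin ω (n e) P =
      ∑ H ∈ Γ.clades e₀ with e ∈ H, l H * ∑ a ∈ H, formMatrix n e₀ ω e a := by
  have hu : Finset.univ ∈ (Γ.clades e₀).filter (e ∈ ·) :=
    Finset.mem_filter.2 ⟨Γ.isHierarchy_clades.univ_mem, Finset.mem_univ _⟩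
  have hf : ((Γ.clades e₀).filter (e ∈ ·)).erase Finset.univ =
      (Γ.clades e₀).filter fun H => H ≠ Finset.univ ∧ e ∈ H := by
    ext H
    simp only [Finset.mem_erase, Finset.mem_filter]
    tauto
  rw [Γ.moment_leaf, ← Finset.add_sum_erase _ _ hu, hf, hl', h, map_add, map_smul, sum_formMatrix,
    slopeSum_univ hsum, smul_eq_mul]
  have h1 : ∑ H ∈ Γ.clades e₀ with (H ≠ Finset.univ ∧ e ∈ H),
      Γ.edgeLength e₀ H * ∑ a ∈ H, formMatrix n e₀ ω e a =
      ∑ H ∈ Γ.clades e₀ with (H ≠ Finset.univ ∧ e ∈ H),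
        l H * ∑ a ∈ H, formMatrix n e₀ ω e a :=
    Finset.sum_congr rfl fun H hH => by
      obtain ⟨h1, h2, -⟩ := Finset.mem_filter.1 hH
      rw [hl H h1 h2]
  rw [h1]
  push_cast
  rw [map_neg]
  ring

/-- The lengths of the edges of a solution realize the prescribed moments. -/
theorem Solves.exists_realizes (hsum : ∑ e, n e = 0) (hδ : ω ![(n e₀ : V), (δ : V)] ≠ 0)
    {Γ : Curve n} (h : Solves ω e₀ δ μ p Γ) :
    ∃ l : Finset (Leaf e₀) → ℝ, (∀ H ∈ Γ.clades e₀, H ≠ Finset.univ → 0 < l H) ∧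
      Realizes (formMatrix n e₀ ω) Finset.univ (relMoment n ω e₀ δ μ p) (Γ.clades e₀) l := by
  obtain ⟨h1, a, ha⟩ := (solves_iff hδ).1 h
  refine ⟨fun H => if H = Finset.univ then -a else Γ.edgeLength e₀ H, fun H hH hne => ?_,
    fun e _ => ?_⟩
  · simp only [if_neg hne]
    exact Γ.edgeLength_pos hH hne
  · rw [relMoment, ← h1]
    exact Γ.moment_leaf_sub hsum ha e (fun H _ hne => if_neg hne) (if_pos rfl)

/-- Conversely, every realization of the prescribed moments comes from a solution. -/
theorem IsHierarchy.exists_solves (hsum : ∑ e, n e = 0) (hδ : ω ![(n e₀ : V), (δ : V)] ≠ 0)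
    {𝓗 : Finset (Finset (Leaf e₀))} (h : IsHierarchy 𝓗) {l : Finset (Leaf e₀) → ℝ}
    (hl : ∀ H ∈ 𝓗, H ≠ Finset.univ → 0 < l H)
    (hr : Realizes (formMatrix n e₀ ω) Finset.univ (relMoment n ω e₀ δ μ p) 𝓗 l) :
    ∃ Γ : Curve n, Solves ω e₀ δ μ p Γ ∧ Γ.clades e₀ = 𝓗 := by
  obtain ⟨Γ, hΓ, hpos, hlen⟩ := h.exists_curve (n := n) hsum l hl
    (basePoint n ω e₀ δ μ p + (-l Finset.univ) • (n e₀ : V))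
  refine ⟨Γ, (solves_iff hδ).2 ⟨fun e => ?_, _, hpos⟩, hΓ⟩
  by_cases he : e = e₀
  · subst he
    change formBilin ω (n e) (Γ.pos (Γ.endVert e)) = _
    rw [hpos, map_add, map_smul, formBilin_self, smul_zero, add_zero, formBilin_basePoint hδ]
  · have h1 := Γ.moment_leaf_sub (ω := ω) hsum hpos ⟨e, he⟩ (l := l)
      (fun H hH hne => (hlen H (hΓ ▸ hH) hne).symm) (neg_neg _).symm
    have h2 := hr ⟨e, he⟩ (Finset.mem_univ _)
    rw [hΓ, ← h2, relMoment] at h1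
    linarith

theorem Solves.of_iso {Γ Γ' : Curve n} (h : Solves ω e₀ δ μ p Γ) (hi : Curve.Iso Γ Γ') :
    Solves ω e₀ δ μ p Γ' := by
  obtain ⟨φ, h1, -, h3⟩ := hi
  refine ⟨fun e => ?_, ?_⟩
  · rw [← h.1 e, Curve.moment, Curve.moment, ← h1, h3]
  · rw [← h1, h3]
    exact h.2

theorem Curve.clades_of_curveIso {Γ Γ' : Curve n} (hi : Curve.Iso Γ Γ') :
    Γ'.clades e₀ = Γ.clades e₀ := by
  obtain ⟨φ, h1, -⟩ := hi
  exact AbstractCurve.clades_of_iso φ h1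

theorem mem_solutions_iff {c : ModuliSpace n} :
    c ∈ solutions n ω e₀ δ μ p ↔ Solves ω e₀ δ μ p c.out := by
  constructor
  · rintro ⟨Γ, h, rfl⟩
    exact h.of_iso (Setoid.symm (Quotient.mk_out Γ))
  · intro h
    exact ⟨c.out, h, c.out_eq⟩

/-- At a trivalent vertex, the edges other than the one towards `e₀` are two. -/
theorem AbstractCurve.exists_star_eq {Γ : AbstractCurve E} {v : Fin Γ.numVert}
    (h : Nat.card (Γ.Star v) = 3) : ∃ x y, x ≠ Γ.up e₀ v ∧ y ≠ Γ.up e₀ v ∧ y ≠ x ∧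
      ∀ z, z = Γ.up e₀ v ∨ z = x ∨ z = y := by
  classical
  have hf : Finite (Γ.Star v) := by unfold Star; infer_instance
  have := Fintype.ofFinite (Γ.Star v)
  obtain ⟨x, hx, -⟩ := Γ.nontrivial_ne_up e₀ (Γ.up e₀ v)
  obtain ⟨y, hy, hyx⟩ := Γ.nontrivial_ne_up e₀ x
  refine ⟨x, y, hx, hy, hyx, fun z => ?_⟩
  have h3 : ({Γ.up e₀ v, x, y} : Finset (Γ.Star v)).card = 3 :=
    Finset.card_eq_three.2 ⟨_, _, _, hx.symm, hy.symm, hyx.symm, rfl⟩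
  rw [Nat.card_eq_fintype_card, ← h3] at h
  have h4 := (Finset.card_eq_iff_eq_univ _).1 h.symm
  have := Finset.mem_univ z
  rw [← h4] at this
  simpa using this

theorem AbstractCurve.isBlock_block {Γ : AbstractCurve E} {v : Fin Γ.numVert} {x : Γ.Star v}
    (hx : x ≠ Γ.up e₀ v) : IsBlock (Γ.clades e₀) (Γ.block e₀ v x) := by
  rcases x with w | e
  · exact Or.inl (mem_clades.2 ⟨w, rfl⟩)
  · right
    simp [block, end_ne_of_ne_up hx]

theorem AbstractCurve.clade_eq_union {Γ : AbstractCurve E} {v : Fin Γ.numVert} {x y : Γ.Star v}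
    (hx : x ≠ Γ.up e₀ v) (hy : y ≠ Γ.up e₀ v) (h : ∀ z, z = Γ.up e₀ v ∨ z = x ∨ z = y) :
    Γ.clade e₀ v = Γ.block e₀ v x ∪ Γ.block e₀ v y := by
  refine Finset.Subset.antisymm (fun e he => ?_)
    (Finset.union_subset (block_subset hx) (block_subset hy))
  obtain ⟨z, hz, hez⟩ := exists_mem_block he
  rcases (h z).resolve_left hz with rfl | rfl
  · exact Finset.mem_union_left _ hez
  · exact Finset.mem_union_right _ hez

theorem AbstractCurve.disjoint_block {Γ : AbstractCurve E} {v : Fin Γ.numVert} {x y : Γ.Star v}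
    (hx : x ≠ Γ.up e₀ v) (hy : y ≠ Γ.up e₀ v) (h : y ≠ x) :
    Disjoint (Γ.block e₀ v x) (Γ.block e₀ v y) :=
  Finset.disjoint_left.2 fun _ h1 h2 => h (eq_of_mem_block hy hx h2 h1)

theorem Curve.isBinary_clades {Γ : Curve n} (h : Γ.IsTrivalent) :
    IsBinary Finset.univ (Γ.clades e₀) where
  subset _ _ := Finset.subset_univ _
  two_le := Γ.isHierarchy_clades.two_le
  top := Or.inl Γ.isHierarchy_clades.univ_mem
  laminar := Γ.isHierarchy_clades.laminar
  split H hH := by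
    obtain ⟨v, rfl⟩ := AbstractCurve.mem_clades.1 hH
    obtain ⟨x, y, hx, hy, hyx, hz⟩ := AbstractCurve.exists_star_eq (e₀ := e₀) (h v)
    have hu := AbstractCurve.clade_eq_union hx hy hz
    have hd := AbstractCurve.disjoint_block hx hy hyx
    refine ⟨Γ.block e₀ v x, AbstractCurve.block_subset hx,
      (AbstractCurve.block_nonempty hx).ne_empty, (AbstractCurve.block_ssubset hx).ne,
      AbstractCurve.isBlock_block hx, ?_⟩
    rw [hu, Finset.union_sdiff_cancel_left hd]
    exact AbstractCurve.isBlock_block hy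

/-- The bivector of a trivalent vertex, up to sign, in terms of the two edges beyond this vertex. -/
theorem Curve.bivector_eq {Γ : Curve n} {v : Fin Γ.numVert} {x y : Γ.Star v}
    (hx : x ≠ Γ.up e₀ v) (hy : y ≠ Γ.up e₀ v) (hyx : y ≠ x)
    (hz : ∀ z, z = Γ.up e₀ v ∨ z = x ∨ z = y) :
    Γ.bivector v = wedge (slopeSum n e₀ (Γ.block e₀ v x)) (slopeSum n e₀ (Γ.block e₀ v y)) ∨
    Γ.bivector v =
      -wedge (slopeSum n e₀ (Γ.block e₀ v x)) (slopeSum n e₀ (Γ.block e₀ v y)) := by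
  have hne := (Γ.exists_pair v).choose_spec
  simp only [Curve.bivector]
  set P := (Γ.exists_pair v).choose
  have hu := AbstractCurve.clade_eq_union hx hy hz
  have hd := AbstractCurve.disjoint_block hx hy hyx
  have e1 := Γ.outSlope_eq_slopeSum_block hx
  have e2 := Γ.outSlope_eq_slopeSum_block hy
  have e3 := Γ.outSlope_up_eq (e₀ := e₀) v
  rw [hu, slopeSum_union hd, neg_add] at e3
  set b := slopeSum n e₀ (Γ.block e₀ v x)
  set c := slopeSum n e₀ (Γ.block e₀ v y)
  have hs : wedge c b = -wedge b c := wedge_swap c b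
  rcases hz P.1 with h1 | h1 | h1 <;> rcases hz P.2 with h2 | h2 | h2 <;>
    first
    | exact absurd (h1.trans h2.symm) hne
    | (rw [h1, h2]
       simp only [e1, e2, e3, wedge_add_left, wedge_add_right, wedge_neg_left, wedge_neg_right,
         wedge_self, hs]
       simp)

open scoped Classical in
/-- The refined multiplicity is the weight of the tree. A vertex with `ω(π_V) = 0` contributes zero
on both sides. -/
theorem Curve.proj_refinedMult {Γ : Curve n} (h : Γ.IsTrivalent) {K : Submodule ℤ (Bivector N)}
    (hK : kernelLattice n ω ≤ K) :
    proj hK (Γ.refinedMult ω) = ∏ H ∈ Γ.clades e₀,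
      vertexWeight (formMatrix n e₀ ω) (wedgeWeight n e₀ K) (Γ.clades e₀) H := by
  rw [AbstractCurve.clades, Finset.prod_image fun _ _ _ _ h => AbstractCurve.clade_injective h,
    ← AbstractCurve.clades, Curve.refinedMult, map_prod]
  refine Finset.prod_congr rfl fun v _ => ?_
  obtain ⟨x, y, hx, hy, hyx, hz⟩ := AbstractCurve.exists_star_eq (e₀ := e₀) (h v)
  have hu := AbstractCurve.clade_eq_union hx hy hz
  have hd := AbstractCurve.disjoint_block hx hy hyx
  have hb := Curve.bivector_eq hx hy hyx hz
  have hB0 := (AbstractCurve.block_nonempty hx).ne_empty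
  have hC0 := (AbstractCurve.block_nonempty hy).ne_empty
  have hHm : Γ.clade e₀ v ∈ Γ.clades e₀ := AbstractCurve.mem_clades.2 ⟨v, rfl⟩
  rw [hu] at hHm ⊢
  rw [(Curve.isBinary_clades h).vertexWeight_eq (formMatrix_antisymm ω) hd hHm hB0 hC0
    (AbstractCurve.isBlock_block hx) (AbstractCurve.isBlock_block hy)]
  set B := Γ.block e₀ v x
  set C := Γ.block e₀ v y
  have hp := pairing_wedge_slopeSum (n := n) ω B C
  have hs := blockSum_swap (formMatrix_antisymm (n := n) (e₀ := e₀) ω) B C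
  have hq : wedgeWeight n e₀ K C B =
      qpow K (-wedge (slopeSum n e₀ B) (slopeSum n e₀ C)) := by
    rw [wedgeWeight, wedge_swap]
  have hq' : wedgeWeight n e₀ K B C = qpow K (wedge (slopeSum n e₀ B) (slopeSum n e₀ C)) := rfl
  have hmem : blockSum (formMatrix n e₀ ω) B C = 0 →
      qpow K (wedge (slopeSum n e₀ B) (slopeSum n e₀ C)) = 1 ∧
      qpow K (-wedge (slopeSum n e₀ B) (slopeSum n e₀ C)) = 1 := fun h0 =>
    have := hK (wedge_mem_kernelLattice hB0 hC0 hd h0)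
    ⟨qpow_eq_one this, qpow_eq_one (K.neg_mem this)⟩
  rw [hq, hq']
  set π := wedge (slopeSum n e₀ B) (slopeSum n e₀ C)
  rcases hb with hb | hb <;> rw [hb] <;> simp only [map_neg, neg_neg, hp] <;>
    rcases lt_trichotomy (blockSum (formMatrix n e₀ ω) B C) 0 with h0 | h0 | h0
  · rw [if_neg h0.not_gt, if_neg h0.not_gt, if_pos (by linarith), map_sub, proj_qpow, proj_qpow]
  · have := hmem h0
    rw [if_neg h0.not_gt, if_neg h0.not_gt, if_neg (by linarith), map_sub, proj_qpow, proj_qpow,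
      this.1, this.2, sub_self]
  · rw [if_pos h0, if_pos h0, map_sub, proj_qpow, proj_qpow]
  · rw [if_pos (by linarith), if_neg h0.not_gt, if_pos (by linarith), map_sub, proj_qpow, proj_qpow]
  · have := hmem h0
    rw [if_neg (by linarith), if_neg h0.not_gt, if_neg (by linarith), map_sub, proj_qpow, proj_qpow,
      this.1, this.2, sub_self]
  · rw [if_neg (by linarith), if_pos h0, map_sub, proj_qpow, proj_qpow]

end solutions

/-! ### Generic constraints -/

open Filter Topology

section generic

variable {V : Type*} [NormedAddCommGroup V] [NormedSpace ℝ V] {N : Submodule ℤ V} {E : Type*}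
  [Fintype E] {n : E → N} {ω : Form V} {e₀ : E} {δ : N} {μ : MomentSpace E} {p : V}

theorem card_leaf (e₀ : E) [Fintype (Leaf e₀)] : Fintype.card (Leaf e₀) + 1 = Fintype.card E := by
  classical
  have := Fintype.card_subtype_compl (fun e => e = e₀)
  rw [Fintype.card_subtype_eq] at this
  have h0 : 0 < Fintype.card E := Fintype.card_pos_iff.2 ⟨e₀⟩
  have h1 : Fintype.card (Leaf e₀) = Fintype.card {x // ¬ x = e₀} :=
    Fintype.card_congr (Equiv.refl _)
  omega

theorem sum_leaf [DecidableEq E] (g : E → ℝ) : ∑ e : Leaf e₀, g e = ∑ e, g e - g e₀ := by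
  rw [← Finset.add_sum_erase _ _ (Finset.mem_univ e₀), add_sub_cancel_left,
    Finset.sum_subtype (Finset.univ.erase e₀) (p := fun e => e ≠ e₀) (by simp)]

theorem two_le_card_leaf (hE : 3 ≤ Fintype.card E) [Fintype (Leaf e₀)] :
    2 ≤ (Finset.univ : Finset (Leaf e₀)).card := by
  have := card_leaf e₀
  rw [Finset.card_univ]
  omega

theorem IsBinary.isHierarchy {I : Type*} [Fintype I] [DecidableEq I] {𝓗 : Finset (Finset I)}
    (h : IsBinary Finset.univ 𝓗) (hI : 2 ≤ (Finset.univ : Finset I).card) : IsHierarchy 𝓗 where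
  univ_mem := h.top.resolve_right (by omega)
  two_le := h.two_le
  laminar := h.laminar

theorem Curve.sameType_of_clades_eq [DecidableEq E] {Γ Γ' : Curve n}
    (h : Γ.clades e₀ = Γ'.clades e₀) : SameType Γ Γ' := by
  obtain ⟨φ, h1, -⟩ := AbstractCurve.exists_iso_of_clades_eq h
  exact ⟨φ, h1⟩

theorem IsGeneric.injOn_clades [DecidableEq E] (h : IsGeneric n ω e₀ δ μ p) :
    Set.InjOn (fun c : ModuliSpace n => c.out.clades e₀) (solutions n ω e₀ δ μ p) := by
  intro c hc c' hc' heq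
  rw [mem_solutions_iff] at hc hc'
  have h1 := (h _ hc).2 c.out c'.out ⟨SimpleGraph.Iso.refl, fun _ => rfl⟩
    (Curve.sameType_of_clades_eq heq) ⟨fun e => (hc.1 e).trans (hc'.1 e).symm, by
      have := Submodule.sub_mem _ hc.2 hc'.2
      rwa [sub_sub_sub_cancel_right] at this⟩
  have h2 : (Quotient.mk _ c.out : ModuliSpace n) = Quotient.mk _ c'.out := Quotient.sound h1
  rwa [Quotient.out_eq, Quotient.out_eq] at h2

/-- Solutions are determined by their combinatorial type. -/
theorem IsGeneric.finite_solutions (h : IsGeneric n ω e₀ δ μ p) :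
    (solutions n ω e₀ δ μ p).Finite := by
  classical
  exact Set.Finite.of_finite_image (Set.toFinite _) h.injOn_clades

theorem sum_relMoment [DecidableEq E] (hsum : ∑ e, n e = 0)
    (hδ : ω ![(n e₀ : V), (δ : V)] ≠ 0) : ∑ e, relMoment n ω e₀ δ μ p e = 0 := by
  simp only [relMoment]
  rw [Finset.sum_sub_distrib, sum_leaf μ.1, μ.2,
    sum_leaf fun e => formBilin ω (n e) (basePoint n ω e₀ δ μ p), formBilin_basePoint hδ]
  have h2 : ∑ e, formBilin ω (n e) (basePoint n ω e₀ δ μ p) = 0 := by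
    rw [← LinearMap.sum_apply, ← map_sum]
    have : ∑ e, (n e : V) = 0 := by
      have := congrArg (Subtype.val) hsum
      simpa using this
    rw [this, map_zero, LinearMap.zero_apply]
  rw [h2]
  ring

/-- A tree with an edge of length zero would give a solution which is not trivalent. -/
theorem IsGeneric.not_rootedDegenerate [DecidableEq E] (hsum : ∑ e, n e = 0)
    (hE : 3 ≤ Fintype.card E) (hδ : ω ![(n e₀ : V), (δ : V)] ≠ 0)
    (h : IsGeneric n ω e₀ δ μ p) :
    ¬ RootedDegenerate (formMatrix n e₀ ω) Finset.univ (relMoment n ω e₀ δ μ p) := by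
  classical
  intro hd
  obtain ⟨𝓗, l, hb, hcard, hl, ⟨H₀, hH₀, hne₀, hz⟩, hu, hr⟩ :=
    hd.exists_isBinary (formMatrix_antisymm ω) (sum_relMoment hsum hδ)
  have hsub : 𝓗.filter (fun H => H = Finset.univ ∨ 0 < l H) ⊆ 𝓗 := Finset.filter_subset _ _
  have hh := hb.isHierarchy (two_le_card_leaf hE)
  have hh' : IsHierarchy (𝓗.filter fun H => H = Finset.univ ∨ 0 < l H) :=
    ⟨Finset.mem_filter.2 ⟨hu, Or.inl rfl⟩, fun H hH => hh.two_le H (hsub hH),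
      fun H hH H' hH' => hh.laminar H (hsub hH) H' (hsub hH')⟩
  obtain ⟨Γ, hΓ, hc⟩ := hh'.exists_solves (p := p) hsum hδ (l := l)
    (fun H hH hne => (Finset.mem_filter.1 hH).2.resolve_left hne) (fun e he => by
      rw [hr e he, Finset.filter_filter]
      refine (Finset.sum_subset (fun H hH => ?_) fun H hH hH' => ?_).symm
      · have := Finset.mem_filter.1 hH
        exact Finset.mem_filter.2 ⟨this.1, this.2.2⟩
      · obtain ⟨h1, h2⟩ := Finset.mem_filter.1 hH
        have h3 : ¬ (H = Finset.univ ∨ 0 < l H) := fun h3 =>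
          hH' (Finset.mem_filter.2 ⟨h1, h3, h2⟩)
        rw [not_or] at h3
        rw [((hl H h1 h3.1).eq_of_not_lt h3.2).symm, zero_mul])
  have h1 := Γ.trivalent_iff.1 (h Γ hΓ).1
  have h2 := Γ.card_clades (e₀ := e₀)
  rw [hc] at h2
  have h3 : (𝓗.filter fun H => H = Finset.univ ∨ 0 < l H).card < 𝓗.card :=
    Finset.card_lt_card ⟨hsub, fun h' =>
      ((Finset.mem_filter.1 (h' hH₀)).2.resolve_left hne₀).ne' hz⟩
  have h4 := card_leaf e₀
  rw [Finset.card_univ] at hcard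
  omega

/-- The refined count is a weighted count of rooted binary trees. -/
theorem IsGeneric.proj_refinedCount [DecidableEq E] (hsum : ∑ e, n e = 0)
    (hE : 3 ≤ Fintype.card E) (hδ : ω ![(n e₀ : V), (δ : V)] ≠ 0)
    (h : IsGeneric n ω e₀ δ μ p) {K : Submodule ℤ (Bivector N)} (hK : kernelLattice n ω ≤ K) :
    proj hK (refinedCount n ω e₀ δ μ p) = rootedTreeSum (formMatrix n e₀ ω) (wedgeWeight n e₀ K)
      Finset.univ (relMoment n ω e₀ δ μ p) := by
  classical
  rw [rootedTreeSum_eq_sum_realizable (formMatrix_antisymm ω) (two_le_card_leaf hE)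
    (sum_relMoment hsum hδ), refinedCount,
    finsum_mem_eq_finite_toFinset_sum _ h.finite_solutions, map_sum]
  refine Finset.sum_nbij (fun c : ModuliSpace n => c.out.clades e₀) (fun c hc => ?_) ?_
    (fun 𝓗 h𝓗 => ?_) (fun c hc => ?_)
  · rw [Set.Finite.mem_toFinset, mem_solutions_iff] at hc
    obtain ⟨l, h1, h2⟩ := hc.exists_realizes hsum hδ
    exact Finset.mem_filter.2 ⟨Finset.mem_univ _, Curve.isBinary_clades (h _ hc).1, l,
      fun _ => trivial, h1, h2⟩
  · rw [Set.Finite.coe_toFinset]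
    exact h.injOn_clades
  · obtain ⟨-, hb, l, -, h1, h2⟩ := Finset.mem_filter.1 h𝓗
    obtain ⟨Γ, hΓ, hc⟩ := (hb.isHierarchy (two_le_card_leaf hE)).exists_solves hsum hδ h1 h2
    refine ⟨Quotient.mk _ Γ, ?_, ?_⟩
    · rw [Set.Finite.coe_toFinset]
      exact ⟨Γ, hΓ, rfl⟩
    · rw [← hc]
      exact Curve.clades_of_curveIso (Setoid.symm (Quotient.mk_out Γ))
  · rw [Set.Finite.mem_toFinset, mem_solutions_iff] at hc
    exact Curve.proj_refinedMult (h _ hc).1 hK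

end generic

/-! ### Density of the generic constraints -/

section density

theorem Realizes.eq_sum_ray {I : Type*} [Fintype I] [DecidableEq I] {W : I → I → ℝ} {f : I → ℝ}
    {𝓗 : Finset (Finset I)} {l : Finset I → ℝ} (h : Realizes W Finset.univ f 𝓗 l) :
    f = ∑ H ∈ 𝓗, l H • ray W H := by
  funext e
  rw [h e (Finset.mem_univ e), Finset.sum_apply, Finset.sum_filter]
  refine Finset.sum_congr rfl fun H _ => ?_
  simp [ray]

/-- The space of families of moments of total sum zero. -/
def momentSubmodule (I : Type*) [Fintype I] : Submodule ℝ (I → ℝ) :=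
  LinearMap.ker (∑ e, LinearMap.proj e : Module.Dual ℝ (I → ℝ))

theorem mem_momentSubmodule {I : Type*} [Fintype I] {g : I → ℝ} :
    g ∈ momentSubmodule I ↔ ∑ e, g e = 0 := by simp [momentSubmodule]

theorem le_finrank_momentSubmodule (I : Type*) [Fintype I] :
    Fintype.card I ≤ Module.finrank ℝ (momentSubmodule I) + 1 := by
  have h1 := (∑ e, LinearMap.proj e : Module.Dual ℝ (I → ℝ)).finrank_range_add_finrank_ker
  have h2 := (LinearMap.range (∑ e, LinearMap.proj e : Module.Dual ℝ (I → ℝ))).finrank_le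
  rw [Module.finrank_self] at h2
  rw [Module.finrank_fintype_fun_eq_card] at h1
  change _ = Fintype.card I at h1
  unfold momentSubmodule
  omega

variable {V : Type*} [NormedAddCommGroup V] [NormedSpace ℝ V] {N : Submodule ℤ V} {E : Type*}
  [Fintype E] {n : E → N} {ω : Form V} {e₀ : E} {δ : N} {μ : MomentSpace E} {p : V}

/-- If the moments of the curves of a given type are linearly independent functions of the lengths,
then the evaluation map is injective on this type. -/
theorem Curve.iso_of_linearIndependent [DecidableEq E] (hsum : ∑ e, n e = 0)
    (hδ : ω ![(n e₀ : V), (δ : V)] ≠ 0) {Γ₁ Γ₂ : Curve n} (hc : Γ₁.clades e₀ = Γ₂.clades e₀)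
    (hli : LinearIndependent ℝ fun H : Γ₁.clades e₀ => ray (formMatrix n e₀ ω) H.1)
    (h : SameEval ω e₀ δ Γ₁ Γ₂) : Iso Γ₁ Γ₂ := by
  obtain ⟨a, b, hab⟩ := Submodule.mem_span_pair.1 h.2
  have h0 : formBilin ω (n e₀) (Γ₁.pos (Γ₁.endVert e₀)) =
    formBilin ω (n e₀) (Γ₂.pos (Γ₂.endVert e₀)) := h.1 e₀
  have hb : b = 0 := by
    have h1 := congrArg (formBilin ω (n e₀)) hab
    rw [map_sub, h0, sub_self, map_add, map_smul, map_smul, formBilin_self, smul_zero, zero_add,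
      smul_eq_mul] at h1
    exact (mul_eq_zero.1 h1).resolve_right hδ
  rw [hb, zero_smul, add_zero] at hab
  have hpos : Γ₁.pos (Γ₁.endVert e₀) = Γ₂.pos (Γ₂.endVert e₀) + a • (n e₀ : V) := by
    rw [hab]; abel
  have hpos2 : Γ₂.pos (Γ₂.endVert e₀) = Γ₂.pos (Γ₂.endVert e₀) + (0 : ℝ) • (n e₀ : V) := by simp
  let l₁ : Finset (Leaf e₀) → ℝ := fun H => if H = Finset.univ then -a else Γ₁.edgeLength e₀ H
  let l₂ : Finset (Leaf e₀) → ℝ := fun H => if H = Finset.univ then -0 else Γ₂.edgeLength e₀ H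
  have key : ∀ H ∈ Γ₁.clades e₀, l₁ H = l₂ H := by
    have h1 : Realizes (formMatrix n e₀ ω) Finset.univ
        (fun e => Γ₁.moment ω e - formBilin ω (n e) (Γ₂.pos (Γ₂.endVert e₀)))
        (Γ₁.clades e₀) l₁ := fun e _ =>
      Γ₁.moment_leaf_sub hsum hpos e (fun H _ hne => if_neg hne) (if_pos rfl)
    have h2 : Realizes (formMatrix n e₀ ω) Finset.univ
        (fun e => Γ₁.moment ω e - formBilin ω (n e) (Γ₂.pos (Γ₂.endVert e₀)))
        (Γ₁.clades e₀) l₂ := fun e _ => by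
      rw [hc]
      simp only [h.1 e]
      exact Γ₂.moment_leaf_sub hsum hpos2 e (fun H _ hne => if_neg hne) (if_pos rfl)
    have h3 := h1.eq_sum_ray.symm.trans h2.eq_sum_ray
    rw [← sub_eq_zero, ← Finset.sum_sub_distrib, ← Finset.sum_coe_sort] at h3
    simp only [← sub_smul] at h3
    intro H hH
    exact sub_eq_zero.1 (Fintype.linearIndependent_iff.1 hli
      (fun H => l₁ H.1 - l₂ H.1) h3 ⟨H, hH⟩)
  have ha : a = 0 := by
    have := key Finset.univ Γ₁.isHierarchy_clades.univ_mem
    simpa [l₁, l₂] using this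
  refine iso_of_clades_eq hc (fun H hH hne => ?_) ?_
  · have := key H hH
    simpa [l₁, l₂, hne] using this
  · rw [hpos, ha, zero_smul, add_zero]

/-- If the moments of the curves of the type of `Γ` fill the space of moments, then `Γ` is
regular, for reasons of dimension. -/
theorem Curve.isRegular_of_momentSubmodule_le [DecidableEq E] (hsum : ∑ e, n e = 0)
    (hδ : ω ![(n e₀ : V), (δ : V)] ≠ 0) {Γ : Curve n}
    (h : momentSubmodule (Leaf e₀) ≤
      Submodule.span ℝ (Set.range fun H : Γ.clades e₀ => ray (formMatrix n e₀ ω) H.1)) :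
    Γ.IsRegular ω e₀ δ := by
  have h1 := Γ.numVert_add_two_le
  have h2 := card_leaf e₀
  have h3 := le_finrank_momentSubmodule (Leaf e₀)
  have h4 := Submodule.finrank_mono h
  have h5 : Fintype.card (Γ.clades e₀) = Γ.numVert := by rw [Fintype.card_coe, Γ.card_clades]
  have h6 : Fintype.card (Γ.clades e₀) ≤
      (Set.range fun H : Γ.clades e₀ => ray (formMatrix n e₀ ω) H.1).finrank ℝ := by
    unfold Set.finrank
    omega
  have hli := linearIndependent_iff_card_le_finrank_span.2 h6
  have h7 := linearIndependent_iff_card_eq_finrank_span.1 hli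
  refine ⟨Γ.trivalent_iff.2 ?_, fun Γ₁ Γ₂ t₁ t₂ hs => ?_⟩
  · unfold Set.finrank at h7
    omega
  · obtain ⟨φ₁, hφ₁⟩ := t₁
    obtain ⟨φ₂, hφ₂⟩ := t₂
    have c₁ := AbstractCurve.clades_of_iso (e₀ := e₀) φ₁ hφ₁
    have c₂ := AbstractCurve.clades_of_iso (e₀ := e₀) φ₂ hφ₂
    refine Curve.iso_of_linearIndependent hsum hδ (c₁.trans c₂.symm) ?_ hs
    rw [c₁]
    exact hli

/-- Generic constraints are dense: it suffices to move the moments of the ends other than `e₀` out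
of finitely many proper subspaces. -/
theorem dense_isGeneric (hsum : ∑ e, n e = 0) (hδ : ω ![(n e₀ : V), (δ : V)] ≠ 0) :
    Dense {x : MomentSpace E × V | IsGeneric n ω e₀ δ x.1 x.2} := by
  classical
  rintro ⟨μ, p⟩
  rw [mem_closure_iff_nhds]
  intro U hU
  obtain ⟨U₁, hU₁, U₂, hU₂, hU'⟩ := mem_nhds_prod_iff.1 hU
  obtain ⟨U₃, hU₃, hU₃'⟩ := (mem_nhds_subtype _ _ _).1 hU₁
  let S (𝓗 : Finset (Finset (Leaf e₀))) : Submodule ℝ (Leaf e₀ → ℝ) :=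
    Submodule.span ℝ (Set.range fun H : 𝓗 => ray (formMatrix n e₀ ω) H.1)
  have hS : ∀ 𝓗, ∃ l : Module.Dual ℝ (Leaf e₀ → ℝ), S 𝓗 ≤ LinearMap.ker l ∧
      (¬ momentSubmodule (Leaf e₀) ≤ S 𝓗 → ∃ g ∈ momentSubmodule (Leaf e₀), l g ≠ 0) := by
    intro 𝓗
    by_cases h : momentSubmodule (Leaf e₀) ≤ S 𝓗
    · exact ⟨0, by simp, fun h' => absurd h h'⟩
    · obtain ⟨g, hg, hg'⟩ := SetLike.not_le_iff_exists.1 h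
      obtain ⟨l, h1, h2⟩ := Submodule.exists_le_ker_of_notMem hg'
      exact ⟨l, h2, fun _ => ⟨g, hg, h1⟩⟩
  choose l hl hl' using hS
  let ext (v : Leaf e₀ → ℝ) (e : E) : ℝ := μ.1 e + if h : e ≠ e₀ then v ⟨e, h⟩ else 0
  have hext : Continuous ext := by
    refine continuous_pi fun e => ?_
    by_cases h : e ≠ e₀
    · simp only [ext, dif_pos h]
      fun_prop
    · simp only [ext, dif_neg h]
      fun_prop
  set f₀ := relMoment n ω e₀ δ μ p with hf₀
  have h1 : (fun f => ext (f - f₀)) ⁻¹' U₃ ∈ 𝓝 f₀ := by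
    refine (hext.comp (continuous_id.sub continuous_const)).continuousAt.preimage_mem_nhds ?_
    have : ext (f₀ - f₀) = μ.1 := by
      funext e
      simp [ext]
    change U₃ ∈ 𝓝 (ext (f₀ - f₀))
    rw [this]
    exact hU₃
  obtain ⟨v, hv, hvU, hvl⟩ := exists_small_forall_dual_ne_zero (momentSubmodule (Leaf e₀))
    (Set.Finite.image l (Set.toFinite {𝓗 | ¬ momentSubmodule (Leaf e₀) ≤ S 𝓗}))
    (by rintro _ ⟨𝓗, h, rfl⟩; exact hl' 𝓗 h) f₀ h1
  have hsumv : ∑ e, ext v e = 0 := by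
    simp only [ext]
    have h2 := sum_leaf (e₀ := e₀) fun e => if h : e ≠ e₀ then v ⟨e, h⟩ else 0
    simp only [ne_eq, not_true_eq_false, dite_false, sub_zero] at h2
    rw [Finset.sum_add_distrib, μ.2, zero_add]
    simp only [ne_eq]
    rw [← h2, ← mem_momentSubmodule.1 hv]
    exact Finset.sum_congr rfl fun e _ => dif_pos e.2
  let μ' : MomentSpace E := ⟨ext v, hsumv⟩
  have hbase : basePoint n ω e₀ δ μ' p = basePoint n ω e₀ δ μ p := by
    have : μ'.1 e₀ = μ.1 e₀ := by simp [μ', ext]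
    rw [basePoint, this]
    rfl
  have hrel : relMoment n ω e₀ δ μ' p = f₀ + v := by
    funext e
    have : μ'.1 e = μ.1 e + v e := congrArg (μ.1 e + ·) (dif_pos e.2)
    rw [relMoment, hbase, this, hf₀, Pi.add_apply, relMoment]
    ring
  refine ⟨(μ', p), hU' ⟨hU₃' ?_, mem_of_mem_nhds hU₂⟩, fun Γ hΓ => ?_⟩
  · change ext v ∈ U₃
    have := hvU
    rwa [Set.mem_preimage, add_sub_cancel_left] at this
  · refine Curve.isRegular_of_momentSubmodule_le hsum hδ ?_
    by_contra hcon
    refine hvl (l (Γ.clades e₀)) ⟨_, hcon, rfl⟩ (hl (Γ.clades e₀) ?_)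
    obtain ⟨len, -, hr⟩ := hΓ.exists_realizes hsum hδ
    rw [← hrel, hr.eq_sum_ray]
    exact Submodule.sum_mem _ fun H hH =>
      Submodule.smul_mem _ _ (Submodule.subset_span ⟨⟨H, hH⟩, rfl⟩)

end density

/-! ### The invariant on the fan -/

section invariant

variable {V : Type*} [NormedAddCommGroup V] [NormedSpace ℝ V] {N : Submodule ℤ V} {E : Type*}
  [Fintype E] {n : E → N} {ω : Form V} {e₀ : E} {δ : N} {μ : MomentSpace E} {p : V}

theorem IsAdmissible.exists_slope [DiscreteTopology N] [IsZLattice ℝ N] (h : IsAdmissible n ω)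
    (e₀ : E) :
    ∃ δ : N, ω ![(n e₀ : V), (δ : V)] ≠ 0 := by
  by_contra! hcon
  obtain ⟨x, hx⟩ := h e₀
  have h1 : Submodule.span ℝ (N : Set V) ≤ LinearMap.ker (formBilin ω (n e₀)) :=
    Submodule.span_le.2 fun y hy => hcon ⟨y, hy⟩
  have h2 : x ∈ Submodule.span ℝ (N : Set V) := by
    rw [IsZLattice.span_top]
    trivial
  exact hx (h1 h2)

variable (n e₀) in
/-- `c` is the value of the weighted count of rooted trees for all generic matrices near that of
`ω` and all generic moments. -/
def IsNearbyCount [DecidableEq E] (ω : Form V) {K : Submodule ℤ (Bivector N)}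
    (c : LaurentMod K) : Prop :=
  ∀ᶠ W in 𝓝 (formMatrix n e₀ ω), IsGenericMatrix W → ∀ f : Leaf e₀ → ℝ, ∑ e, f e = 0 →
    VeryGeneric W Finset.univ f → rootedTreeSum W (wedgeWeight n e₀ K) Finset.univ f = c

theorem IsNearbyCount.unique [DecidableEq E] {K : Submodule ℤ (Bivector N)} {c c' : LaurentMod K}
    (h : IsNearbyCount n e₀ ω c) (h' : IsNearbyCount n e₀ ω c') : c = c' := by
  obtain ⟨W, hW, hgen⟩ := exists_isGenericMatrix_mem (formMatrix_antisymm ω) (h.and h')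
  obtain ⟨f, -, hf, hv⟩ := exists_veryGeneric_mem hgen (A := Finset.univ) (f₀ := 0) (by simp)
    univ_mem
  exact (hW.1 hgen f hf hv).symm.trans (hW.2 hgen f hf hv)

theorem IsGeneric.isNearbyCount [DecidableEq E] (hsum : ∑ e, n e = 0) (hE : 3 ≤ Fintype.card E)
    (hδ : ω ![(n e₀ : V), (δ : V)] ≠ 0) (h : IsGeneric n ω e₀ δ μ p)
    {K : Submodule ℤ (Bivector N)} (hK : kernelLattice n ω ≤ K) :
    IsNearbyCount n e₀ ω (proj hK (refinedCount n ω e₀ δ μ p)) := by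
  rw [h.proj_refinedCount hsum hE hδ hK]
  exact eventually_forall_rootedTreeSum_eq (isTrivialOnZeros_wedgeWeight hK)
    (isBichar_wedgeWeight n e₀ K) (two_le_card_leaf hE) (sum_relMoment hsum hδ)
    (h.not_rootedDegenerate hsum hE hδ)

theorem IsGeneric.refinedCount_eq (hsum : ∑ e, n e = 0) (hE : 3 ≤ Fintype.card E)
    (hδ : ω ![(n e₀ : V), (δ : V)] ≠ 0) (h : IsGeneric n ω e₀ δ μ p) {δ' : N}
    {μ' : MomentSpace E} {p' : V} (hδ' : ω ![(n e₀ : V), (δ' : V)] ≠ 0)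
    (h' : IsGeneric n ω e₀ δ' μ' p') :
    refinedCount n ω e₀ δ μ p = refinedCount n ω e₀ δ' μ' p' := by
  classical
  have := (h.isNearbyCount hsum hE hδ le_rfl).unique (h'.isNearbyCount hsum hE hδ' le_rfl)
  rwa [proj_self, proj_self] at this

/-- The count does not depend on the generic constraints. -/
theorem IsGeneric.refinedCount_eq_refinedInvariant (hsum : ∑ e, n e = 0)
    (hE : 3 ≤ Fintype.card E) (hω : IsAdmissible n ω) (hδ : ω ![(n e₀ : V), (δ : V)] ≠ 0)
    (h : IsGeneric n ω e₀ δ μ p) : refinedCount n ω e₀ δ μ p = refinedInvariant n ω e₀ := by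
  have hex : IsAdmissible n ω ∧ ∃ b, IsRefinedInvariant n ω e₀ b :=
    ⟨hω, _, fun _ hδ' _ _ h' => h'.refinedCount_eq hsum hE hδ' hδ h⟩
  rw [refinedInvariant, dif_pos hex]
  exact hex.2.choose_spec δ hδ μ p h

theorem wedgeWeight_singleton [DecidableEq E] {K : Submodule ℤ (Bivector N)}
    (hK : kernelLattice n ω ≤ K) {e : Leaf e₀} (he : ∀ x, ω ![(n e : V), x] = 0)
    (B : Finset (Leaf e₀)) :
    wedgeWeight n e₀ K {e} B = 1 ∧ wedgeWeight n e₀ K B {e} = 1 := by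
  have hb := isBichar_wedgeWeight n e₀ K
  have hz := isTrivialOnZeros_wedgeWeight (e₀ := e₀) hK
  have h0 : ∀ C, blockSum (formMatrix n e₀ ω) {e} C = 0 := fun C => by
    rw [blockSum_formMatrix, formBilin_apply, show slopeSum n e₀ {e} = n e from
      Finset.sum_singleton _ _]
    exact he _
  have h1 : ∀ C, e ∉ C → wedgeWeight n e₀ K {e} C = 1 ∧ wedgeWeight n e₀ K C {e} = 1 := by
    intro C hC
    by_cases hC0 : C = ∅
    · rw [hC0]
      exact ⟨hb.empty_right _, hb.empty_left _⟩
    · have hd : Disjoint {e} C := Finset.disjoint_singleton_left.2 hC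
      exact ⟨hz.eq_one _ _ (Finset.singleton_ne_empty e) hC0 hd (h0 C),
        hz.eq_one _ _ hC0 (Finset.singleton_ne_empty e) hd.symm (by
          rw [blockSum_swap hz.antisymm, h0, neg_zero])⟩
  by_cases heB : e ∈ B
  · have h2 := h1 (B.erase e) (Finset.notMem_erase e B)
    have hd : Disjoint {e} (B.erase e) := Finset.disjoint_singleton_left.2 (Finset.notMem_erase e B)
    have h3 : wedgeWeight n e₀ K {e} {e} = 1 := by rw [wedgeWeight, wedge_self, qpow_zero]
    rw [← Finset.insert_erase heB, Finset.insert_eq, hb.union_right _ _ _ hd,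
      hb.union_left _ _ _ hd, h2.1, h2.2, h3, mul_one]
    exact ⟨rfl, rfl⟩
  · exact h1 B heB

/-- If the form is degenerate in the direction of an end, every tree has weight zero. -/
theorem isNearbyCount_zero [DecidableEq E] (hsum : ∑ e, n e = 0) (hω : ¬ IsAdmissible n ω)
    {K : Submodule ℤ (Bivector N)} (hK : kernelLattice n ω ≤ K) :
    IsNearbyCount n e₀ ω (0 : LaurentMod K) := by
  refine Eventually.of_forall fun W _ f _ _ => ?_
  unfold IsAdmissible at hω
  push Not at hω
  obtain ⟨e, he⟩ := hω
  by_cases hee : e = e₀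
  · subst hee
    have hz := isTrivialOnZeros_wedgeWeight (e₀ := e) hK
    refine Finset.sum_eq_zero fun B hB => ?_
    split_ifs with h
    · have hne := nonempty_of_blockSum_ne_zero h.ne'
      have h0 : blockSum (formMatrix n e ω) B (Finset.univ \ B) = 0 := by
        rw [← blockSum_of_subset hz.antisymm (Finset.subset_univ B),
          blockSum_swap hz.antisymm, blockSum_formMatrix, slopeSum_univ hsum]
        push_cast
        rw [map_neg, LinearMap.neg_apply, neg_neg]
        exact he _
      rw [hz.sub_eq_zero hne.1 hne.2 Finset.disjoint_sdiff h0, zero_mul, zero_mul]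
    · rfl
  · exact rootedTreeSum_eq_zero_of_leaf (e := ⟨e, hee⟩) (wedgeWeight_singleton hK he)
      (Finset.mem_univ _)

/-- For all forms, admissible or not, the invariant is the count of trees for a generic matrix
nearby. -/
theorem isNearbyCount_refinedInvariant [DiscreteTopology N] [IsZLattice ℝ N] [DecidableEq E]
    (hsum : ∑ e, n e = 0) (hE : 3 ≤ Fintype.card E) {K : Submodule ℤ (Bivector N)}
    (hK : kernelLattice n ω ≤ K) : IsNearbyCount n e₀ ω (proj hK (refinedInvariant n ω e₀)) := by
  by_cases hω : IsAdmissible n ω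
  · obtain ⟨δ, hδ⟩ := hω.exists_slope e₀
    have : Nonempty (MomentSpace E × V) := ⟨(⟨0, by simp⟩, 0)⟩
    obtain ⟨⟨μ, p⟩, h⟩ := (dense_isGeneric (ω := ω) hsum hδ).nonempty
    have h : IsGeneric n ω e₀ δ μ p := h
    rw [← h.refinedCount_eq_refinedInvariant hsum hE hω hδ]
    exact h.isNearbyCount hsum hE hδ hK
  · rw [refinedInvariant, dif_neg fun h => hω h.1, map_zero]
    exact isNearbyCount_zero hsum hω hK

theorem pairing_lineMap {π : Bivector N} (hπ : π ∈ vertexBivectors n) (ω ω' : Form V) (t : ℝ) :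
    pairing N (AffineMap.lineMap ω' ω t) π = (1 - t) * pairing N ω' π + t * pairing N ω π := by
  obtain ⟨A, B, C, -, -, -, -, -, -, -, rfl⟩ := hπ
  rw [pairing_wedge, pairing_wedge, pairing_wedge, AffineMap.lineMap_apply_module]
  rfl

theorem continuous_formMatrix_lineMap (ω ω' : Form V) :
    Continuous fun t : ℝ => formMatrix n e₀ (AffineMap.lineMap ω' ω t) := by
  refine continuous_pi fun a => continuous_pi fun b => ?_
  have : ∀ t : ℝ, formMatrix n e₀ (AffineMap.lineMap ω' ω t) a b =
      (1 - t) * formMatrix n e₀ ω' a b + t * formMatrix n e₀ ω a b := fun t => by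
    rw [AffineMap.lineMap_apply_module]
    rfl
  simp only [this]
  fun_prop

theorem kernelLattice_lineMap_le {ω ω' : Form V} (h : ω' ∈ coneOf n ω) {t : ℝ} (ht : 0 ≤ t)
    (ht' : t ≤ 1) : kernelLattice n (AffineMap.lineMap ω' ω t) ≤ kernelLattice n ω' := by
  refine Submodule.span_mono fun π ⟨hπ, h0⟩ => ⟨hπ, ?_⟩
  rw [pairing_lineMap hπ] at h0
  obtain ⟨h1, h2, h3⟩ := h π hπ
  rcases ht.eq_or_lt with rfl | ht
  · linarith
  · rcases lt_trichotomy (pairing N ω π) 0 with hp | hp | hp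
    · nlinarith [h3 hp, mul_neg_of_pos_of_neg ht hp]
    · exact h1 hp
    · nlinarith [h2 hp, mul_pos ht hp]

theorem proj_refinedInvariant_congr {ω ω' : Form V} (hω : ω = ω') {K : Submodule ℤ (Bivector N)}
    (h : kernelLattice n ω ≤ K) (h' : kernelLattice n ω' ≤ K) :
    proj h (refinedInvariant n ω e₀) = proj h' (refinedInvariant n ω' e₀) := by
  subst hω
  rfl

theorem kernelLattice_le_of_mem_coneOf {ω ω' : Form V} (h : ω' ∈ coneOf n ω) :
    kernelLattice n ω ≤ kernelLattice n ω' :=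
  Submodule.span_mono fun π ⟨hπ, h0⟩ => ⟨hπ, (h π hπ).1 h0⟩

/-- On the segment from `ω'` to `ω`, the image of the invariant modulo the lattice of `ω'` is
locally constant. -/
theorem proj_refinedInvariant_of_mem_coneOf [DiscreteTopology N] [IsZLattice ℝ N]
    (hsum : ∑ e, n e = 0) (hE : 3 ≤ Fintype.card E) {ω ω' : Form V} (h : ω' ∈ coneOf n ω) :
    proj (kernelLattice_le_of_mem_coneOf h) (refinedInvariant n ω e₀) =
      refinedInvariant n ω' e₀ := by
  classical
  have hK : ∀ t : unitInterval,
      kernelLattice n (AffineMap.lineMap ω' ω (t : ℝ)) ≤ kernelLattice n ω' := fun t =>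
    kernelLattice_lineMap_le h t.2.1 t.2.2
  have hloc : IsLocallyConstant fun t : unitInterval =>
      proj (hK t) (refinedInvariant n (AffineMap.lineMap ω' ω (t : ℝ)) e₀) := by
    refine (IsLocallyConstant.iff_eventually_eq _).2 fun t => ?_
    have hc : Continuous fun t : unitInterval =>
        formMatrix n e₀ (AffineMap.lineMap ω' ω (t : ℝ)) :=
      (continuous_formMatrix_lineMap ω ω').comp continuous_subtype_val
    have h1 := (isNearbyCount_refinedInvariant (e₀ := e₀) hsum hE (hK t)).eventually_nhds
    filter_upwards [hc.continuousAt.eventually h1] with s hs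
    exact (isNearbyCount_refinedInvariant hsum hE (hK s)).unique hs
  have := hloc.apply_eq_of_preconnectedSpace 1 0
  rw [← proj_refinedInvariant_congr (ω := AffineMap.lineMap ω' ω ((1 : unitInterval) : ℝ))
    (AffineMap.lineMap_apply_one ω' ω) (hK 1), this,
    proj_refinedInvariant_congr (ω := AffineMap.lineMap ω' ω ((0 : unitInterval) : ℝ))
      (AffineMap.lineMap_apply_zero ω' ω) (hK 0) le_rfl, proj_self]

end invariant

section fan

variable {V : Type*} [NormedAddCommGroup V] [NormedSpace ℝ V] {N : Submodule ℤ V} {E : Type*}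
  [Fintype E] {n : E → N}

theorem mem_coneOf_self (ω : Form V) : ω ∈ coneOf n ω := fun _ _ =>
  ⟨id, le_of_lt, le_of_lt⟩

theorem kernelLattice_eq_coneLattice (ω₀ : Form V) :
    kernelLattice n ω₀ = coneLattice n (coneOf n ω₀) :=
  le_antisymm (Submodule.span_mono fun π ⟨hπ, h0⟩ => ⟨hπ, fun _ hω => (hω π hπ).1 h0⟩)
    (coneLattice_le_kernelLattice n (mem_coneOf_self ω₀))

/-- In the relative interior of a cone, the inequalities are strict: the segment from `ω₀` to `ω`
can be prolonged beyond `ω`. -/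
theorem pairing_eq_zero_of_mem_intrinsicInterior {ω₀ ω : Form V}
    (hω : ω ∈ intrinsicInterior ℝ (coneOf n ω₀)) {π : Bivector N} (hπ : π ∈ vertexBivectors n)
    (h0 : pairing N ω π = 0) : pairing N ω₀ π = 0 := by
  obtain ⟨y, hy, rfl⟩ := mem_intrinsicInterior.1 hω
  let g : ℝ → affineSpan ℝ (coneOf n ω₀) := fun t => ⟨AffineMap.lineMap y.1 ω₀ t,
    AffineMap.lineMap_mem t y.2 (subset_affineSpan ℝ _ (mem_coneOf_self ω₀))⟩
  have hg : Continuous g := Continuous.subtype_mk AffineMap.lineMap_continuous _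
  have h1 : ∀ᶠ t in 𝓝 (0 : ℝ), (g t : Form V) ∈ coneOf n ω₀ := by
    have h2 : g 0 = y := Subtype.ext (AffineMap.lineMap_apply_zero _ _)
    have := hg.continuousAt.preimage_mem_nhds (x := 0) (h2 ▸ isOpen_interior.mem_nhds hy)
    filter_upwards [this] with t ht
    have h3 : g t ∈ Subtype.val ⁻¹' coneOf n ω₀ := interior_subset ht
    exact h3
  obtain ⟨t, ht, ht'⟩ := ((h1.filter_mono nhdsWithin_le_nhds).and
    (self_mem_nhdsWithin (s := Set.Iio 0))).exists
  have ht'' : t < 0 := ht'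
  obtain ⟨-, h3, h4⟩ := ht π hπ
  have h5 : pairing N (g t : Form V) π = t * pairing N ω₀ π := by
    change pairing N (AffineMap.lineMap y.1 ω₀ t) π = _
    rw [pairing_lineMap hπ, h0]
    ring
  rw [h5] at h3 h4
  rcases lt_trichotomy (pairing N ω₀ π) 0 with hp | hp | hp
  · exact absurd (h4 hp) (mul_pos_of_neg_of_neg ht'' hp).not_ge
  · exact hp
  · exact absurd (h3 hp) (mul_neg_of_neg_of_pos ht'' hp).not_ge

theorem kernelLattice_eq_of_mem_intrinsicInterior {ω₀ ω : Form V}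
    (hω : ω ∈ intrinsicInterior ℝ (coneOf n ω₀)) :
    kernelLattice n ω = coneLattice n (coneOf n ω₀) := by
  refine le_antisymm ?_ (coneLattice_le_kernelLattice n (intrinsicInterior_subset hω))
  rw [← kernelLattice_eq_coneLattice]
  exact Submodule.span_mono fun π ⟨hπ, h0⟩ =>
    ⟨hπ, pairing_eq_zero_of_mem_intrinsicInterior hω hπ h0⟩

theorem kernelLattice_choose_le {σ : Set (Form V)} (h : σ ∈ fan n) :
    kernelLattice n h.choose ≤ coneLattice n σ := by
  have := (kernelLattice_eq_coneLattice (n := n) h.choose).le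
  rwa [h.choose_spec] at this

open scoped Classical in
/-- The value of the invariant on a cone: its value at a chosen form which cuts out this cone. -/
def coneInvariant (n : E → N) (e₀ : E) (σ : Set (Form V)) : LaurentMod (coneLattice n σ) :=
  if h : σ ∈ fan n then proj (kernelLattice_choose_le h) (refinedInvariant n h.choose e₀) else 0

theorem proj_coneInvariant_eq [DiscreteTopology N] [IsZLattice ℝ N] (hsum : ∑ e, n e = 0)
    (hE : 3 ≤ Fintype.card E) (e₀ : E) {σ : Set (Form V)} (hσ : σ ∈ fan n) {ω : Form V}
    (hω : ω ∈ σ) :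
    proj (coneLattice_le_kernelLattice n hω) (coneInvariant n e₀ σ) =
      refinedInvariant n ω e₀ := by
  rw [coneInvariant, dif_pos hσ, proj_proj]
  exact proj_refinedInvariant_of_mem_coneOf hsum hE (hσ.choose_spec.symm ▸ hω)

end fan

end RefinedTropical

end

open RefinedTropical in
theorem theorem5p2 {V : Type*} [NormedAddCommGroup V] [NormedSpace ℝ V] [FiniteDimensional ℝ V]
    (N : Submodule ℤ V) [DiscreteTopology N] [IsZLattice ℝ N]
    (hr : 2 ≤ Module.finrank ℤ N)
    {E : Type*} [Fintype E] (hE : 3 ≤ Fintype.card E)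
    (n : E → N) (hn : ∀ e, n e ≠ 0) (hsum : ∑ e, n e = 0) (e₀ : E) :
    -- the invariant is well defined: generic constraints are dense, and each of them gives
    -- finitely many solutions, whose refined count is the invariant
    (∀ ω : Form V, IsAdmissible n ω → ∀ δ : N, ω ![(n e₀ : V), (δ : V)] ≠ 0 →
      Dense {x : MomentSpace E × V | IsGeneric n ω e₀ δ x.1 x.2} ∧
      ∀ (μ : MomentSpace E) (p : V), IsGeneric n ω e₀ δ μ p →
        (solutions n ω e₀ δ μ p).Finite ∧
          refinedCount n ω e₀ δ μ p = refinedInvariant n ω e₀) ∧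
    ∃ B : ∀ σ : Set (Form V), LaurentMod (coneLattice n σ),
      -- the invariant is constant on the relative interior of each cone
      (∀ σ ∈ fan n, ∀ (ω : Form V) (hω : ω ∈ intrinsicInterior ℝ σ),
        kernelLattice n ω = coneLattice n σ ∧
          proj (coneLattice_le_kernelLattice n (intrinsicInterior_subset hω)) (B σ) =
            refinedInvariant n ω e₀) ∧
      -- for two cones of the fan, being a face of the other is the same as being contained in it
      ∀ σ ∈ fan n, ∀ τ ∈ fan n, ∀ h : τ ⊆ σ, proj (coneLattice_anti n h) (B σ) = B τ := by
  refine ⟨fun ω hω δ hδ => ⟨dense_isGeneric hsum hδ, fun μ p h =>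
    ⟨h.finite_solutions, h.refinedCount_eq_refinedInvariant hsum hE hω hδ⟩⟩,
    coneInvariant n e₀, fun σ hσ ω hω => ⟨?_, ?_⟩, fun σ hσ τ hτ h => ?_⟩
  · obtain ⟨ω₀, rfl⟩ := hσ
    exact kernelLattice_eq_of_mem_intrinsicInterior hω
  · exact proj_coneInvariant_eq hsum hE e₀ hσ (intrinsicInterior_subset hω)
  · have hmem : hτ.choose ∈ τ := by
      have := mem_coneOf_self (n := n) hτ.choose
      rwa [hτ.choose_spec] at this
    nth_rewrite 2 [coneInvariant]
    rw [dif_pos hτ, ← proj_coneInvariant_eq hsum hE e₀ hσ (h hmem), proj_proj]
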